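/- Let $n\ge 1$, let $K=\{\lambda\in\mathbb{R}^n:\lambda_i>0 \text{ for all } i\}$, and let $f:\overline K\to\mathbb{R}$ be symmetric and continuous, differentiable in $K$, such that in $K$: $f_i=\partial f/\partial\lambda_i>0$ for all $i$, $f$ is concave, $f>0$, and $f$ is homogeneous of degree one; moreover $f=0$ on $\partial K$, $f(1,\dots,1)=1$, and for some $\epsilon_0,\delta_0>0$ one has $\lim_{R\to\infty}f(\lambda_1,\dots,\lambda_{n-1},\lambda_n+R)\ge 1+\epsilon_0$ uniformly for $\lambda$ in the ball $B_{\delta_0}(1,\dots,1)$. Let $\Omega\subset\mathbb{R}^n$ be a bounded domain with smooth boundary, $\sigma\in(0,1)$, $\epsilon>0$, $0<T\le\infty$, and let $u_0\in C^\infty(\Omega)\cap C^{1,1}(\overline\Omega)$ with $u_0=0$ on $\partial\Omega$. For a positive function $v$ on $\Omega$, let $\kappa[v]=(\kappa_1,\dots,\kappa_n)$ be the principal curvatures, with respect to the upward unit normal, of the graph $\{(x,v(x))\}$ in the half-space model $\{x_{n+1}>0\}$ of $\mathbb{H}^{n+1}$; that is, the eigenvalues of the matrix $\frac1w(\delta_{ij}+v\gamma^{ik}v_{kl}\gamma^{lj})$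 with $w=\sqrt{1+|Dv|^2}$ and $\gamma^{ij}=\delta_{ij}-\frac{v_iv_j}{w(1+w)}$. The graph is called strictly locally convex if $\{\delta_{ij}+v_iv_j+vv_{ij}\}>0$ in $\Omega$. A *solution* is a positive function $u=u^\epsilon$ on $\overline\Omega\times[0,T)$, continuous, and smooth except at the corner $\partial\Omega\times\{0\}$, with $\kappa[u(\cdot,t)]\in\overline K$ (so that $f(\kappa)$ is defined) in $\Omega\times[0,T)$, such that $$u_t=uw\,(f(\kappa[u(\cdot,t)])-\sigma)\ \text{ in }\Omega\times[0,T),\qquad u(\cdot,0)=u_0+\epsilon\ \text{ in }\Omega,\qquad u=\epsilon\ \text{ on }\partial\Omega\times[0,T).$$ It is *admissible* if moreover the graph $\Sigma^\epsilon(t)$ of $u(\cdot,t)$ over $\Omega$ is strictly locally convex for every $t\in[0,T)$. Write $\Sigma^\epsilon_0=\Sigma^\epsilon(0)$. 1. If $u^\epsilon$ is an admissible solution and $f(\kappa[\Sigma^\epsilon_0])>\sigma$ at every point of $\Omega$, then $f(\kappa[\Sigma^\epsilon(t)])>\sigma$ at every point of $\Omega$ for all $t\in[0,T)$. 2. If $u^\epsilon$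 is a solution (not assumed admissible) and $\Sigma^\epsilon_0$ is strictly locally convex, then $\Sigma^\epsilon(t)$ is strictly locally convex for all $t\in[0,T)$. -/

import Mathlib

open scoped ContDiff Topology

noncomputable section

namespace HypFlow

/-! ### The curvature function -/

/-- The open positive cone `K = {λ ∈ ℝⁿ : λ i > 0 for all i}`. -/
def posCone (n : ℕ) : Set (Fin n → ℝ) := {l | ∀ i, 0 < l i}

/-- The structure conditions on the curvature function `f`, a symmetric continuous function on
the closure of `K`. Its values outside the closure of `K` play no role. -/
structure IsCurvatureFunction {n : ℕ} (f : (Fin n → ℝ) → ℝ) : Prop where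
  symmetric : ∀ l ∈ posCone n, ∀ π : Equiv.Perm (Fin n), f (l ∘ π) = f l
  continuousOn : ContinuousOn f (closure (posCone n))
  differentiableOn : DifferentiableOn ℝ f (posCone n)
  partial_pos : ∀ l ∈ posCone n, ∀ i, 0 < fderiv ℝ f l (Pi.single i 1)
  concave : ConcaveOn ℝ (posCone n) f
  pos : ∀ l ∈ posCone n, 0 < f l
  zero_on_frontier : ∀ l ∈ frontier (posCone n), f l = 0
  normalized : f (fun _ => 1) = 1
  homogeneous : ∀ l ∈ posCone n, ∀ s : ℝ, 0 < s → f (s • l) = s * f l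
  /-- `lim_{R → ∞} f (λ₁, …, λₙ + R) ≥ 1 + ε₀` uniformly for `λ` in the Euclidean ball
  `B_{δ₀}(1, …, 1)`; by symmetry it does not matter which coordinate `i` is increased. -/
  growth : ∃ ε₀ > 0, ∃ δ₀ > 0, ∀ i : Fin n, ∀ η > 0, ∃ R₀ : ℝ, ∀ R ≥ R₀, ∀ l : Fin n → ℝ,
    ∑ j, (l j - 1) ^ 2 < δ₀ ^ 2 → 1 + ε₀ - η ≤ f (l + Pi.single i R)

/-! ### Vertical graphs in the half-space model of hyperbolic space

`x ↦ (x, v x)` with `v > 0`. Vectors of `ℝⁿ⁺¹ = ℝⁿ × ℝ` are pairs, the second entry being the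
vertical component. -/

variable {n : ℕ}

/-- The partial derivative `vᵢ`. -/
def grad (v : EuclideanSpace ℝ (Fin n) → ℝ) (x : EuclideanSpace ℝ (Fin n)) (i : Fin n) : ℝ :=
  fderiv ℝ v x (EuclideanSpace.single i 1)

/-- The second partial derivatives `vᵢⱼ`. -/
def hess (v : EuclideanSpace ℝ (Fin n) → ℝ) (x : EuclideanSpace ℝ (Fin n)) :
    Matrix (Fin n) (Fin n) ℝ :=
  Matrix.of fun i j =>
    fderiv ℝ (fderiv ℝ v) x (EuclideanSpace.single i 1) (EuclideanSpace.single j 1)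

/-- `w = √(1 + |Dv|²)`. -/
def slope (v : EuclideanSpace ℝ (Fin n) → ℝ) (x : EuclideanSpace ℝ (Fin n)) : ℝ :=
  Real.sqrt (1 + ∑ i, grad v x i ^ 2)

/-- The Euclidean inner product of `ℝⁿ × ℝ`. -/
def eucInner (X Y : (Fin n → ℝ) × ℝ) : ℝ := X.1 ⬝ᵥ Y.1 + X.2 * Y.2

/-- The hyperbolic inner product at a point of height `s`. -/
def hypInner (s : ℝ) (X Y : (Fin n → ℝ) × ℝ) : ℝ := eucInner X Y / s ^ 2

/-- The coordinate tangent vector `eᵢ + vᵢ eₙ₊₁` of the graph. -/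
def tangent (v : EuclideanSpace ℝ (Fin n) → ℝ) (x : EuclideanSpace ℝ (Fin n)) (i : Fin n) :
    (Fin n → ℝ) × ℝ := (Pi.single i 1, grad v x i)

/-- The hyperbolic covariant derivative `D_X Y` of the half-space `{s > 0}` at height `s`, where
`dY` is the Euclidean directional derivative of `Y` along `X`
(the Levi-Civita connection of `s⁻²` times the Euclidean metric). -/
def hypCovDeriv (s : ℝ) (X Y dY : (Fin n → ℝ) × ℝ) : (Fin n → ℝ) × ℝ :=
  dY - s⁻¹ • (X.2 • Y + Y.2 • X - eucInner X Y • ((0, 1) : (Fin n → ℝ) × ℝ))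

/-- The upward hyperbolic unit normal `v (-Dv, 1) / w`. -/
def hypNormal (v : EuclideanSpace ℝ (Fin n) → ℝ) (x : EuclideanSpace ℝ (Fin n)) :
    (Fin n → ℝ) × ℝ := (v x / slope v x) • ((-(grad v x), 1) : (Fin n → ℝ) × ℝ)

/-- The induced hyperbolic metric `gᵢⱼ`. -/
def firstForm (v : EuclideanSpace ℝ (Fin n) → ℝ) (x : EuclideanSpace ℝ (Fin n)) :
    Matrix (Fin n) (Fin n) ℝ :=
  Matrix.of fun i j => hypInner (v x) (tangent v x i) (tangent v x j)

/-- The hyperbolic second fundamental form `hᵢⱼ = ⟨D_{τᵢ} τⱼ, ν_H⟩_H`. -/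
def secondForm (v : EuclideanSpace ℝ (Fin n) → ℝ) (x : EuclideanSpace ℝ (Fin n)) :
    Matrix (Fin n) (Fin n) ℝ :=
  Matrix.of fun i j => hypInner (v x)
    (hypCovDeriv (v x) (tangent v x i) (tangent v x j) (0, hess v x i j)) (hypNormal v x)

/-- `γⁱʲ = δᵢⱼ - vᵢ vⱼ / (w (1 + w))`. -/
def gam (v : EuclideanSpace ℝ (Fin n) → ℝ) (x : EuclideanSpace ℝ (Fin n)) :
    Matrix (Fin n) (Fin n) ℝ :=
  1 - (slope v x * (1 + slope v x))⁻¹ • Matrix.vecMulVec (grad v x) (grad v x)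

/-- The second fundamental form in the frame with coefficient matrix `v γ`, which is orthonormal
for the hyperbolic metric of the graph (see `frame_orthonormal`). -/
def curvMatrix (v : EuclideanSpace ℝ (Fin n) → ℝ) (x : EuclideanSpace ℝ (Fin n)) :
    Matrix (Fin n) (Fin n) ℝ :=
  (v x • gam v x).transpose * secondForm v x * (v x • gam v x)

open scoped Classical in
/-- The hyperbolic principal curvatures `κ` of the graph of `v` at `x`, listed with multiplicity:
the eigenvalues of the second fundamental form in an orthonormal frame. The matrix is symmetric
where `v` is `C²` (see `curvMatrix_isHermitian`); elsewhere the value is a placeholder. -/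
def principalCurvatures (v : EuclideanSpace ℝ (Fin n) → ℝ) (x : EuclideanSpace ℝ (Fin n)) :
    Fin n → ℝ :=
  if h : (curvMatrix v x).IsHermitian then h.eigenvalues else 0

/-- Strict local convexity of the graph at `x`: `{δᵢⱼ + vᵢ vⱼ + v vᵢⱼ} > 0`. -/
def StrictlyConvexAt (v : EuclideanSpace ℝ (Fin n) → ℝ) (x : EuclideanSpace ℝ (Fin n)) : Prop :=
  (1 + Matrix.vecMulVec (grad v x) (grad v x) + v x • hess v x).PosDef

/-! ### Sanity facts on the geometric definitions -/

theorem slope_pos (v : EuclideanSpace ℝ (Fin n) → ℝ) (x : EuclideanSpace ℝ (Fin n)) :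
    0 < slope v x :=
  Real.sqrt_pos.2 (by positivity)

theorem slope_sq (v : EuclideanSpace ℝ (Fin n) → ℝ) (x : EuclideanSpace ℝ (Fin n)) :
    grad v x ⬝ᵥ grad v x = slope v x ^ 2 - 1 := by
  have : slope v x ^ 2 = 1 + ∑ i, grad v x i ^ 2 := Real.sq_sqrt (by positivity)
  rw [this, dotProduct]
  simp [sq]

theorem gam_transpose (v : EuclideanSpace ℝ (Fin n) → ℝ) (x : EuclideanSpace ℝ (Fin n)) :
    (gam v x).transpose = gam v x := by
  simp [gam, Matrix.transpose_sub, Matrix.transpose_smul, Matrix.transpose_vecMulVec]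

theorem firstForm_eq (v : EuclideanSpace ℝ (Fin n) → ℝ) (x : EuclideanSpace ℝ (Fin n)) :
    firstForm v x = ((v x) ^ 2)⁻¹ • (1 + Matrix.vecMulVec (grad v x) (grad v x)) := by
  ext i j
  simp [firstForm, hypInner, eucInner, tangent, Matrix.vecMulVec_apply, Matrix.one_apply,
    Pi.single_apply, div_eq_inv_mul, eq_comm]

theorem gam_sandwich (v : EuclideanSpace ℝ (Fin n) → ℝ) (x : EuclideanSpace ℝ (Fin n)) :
    gam v x * (1 + Matrix.vecMulVec (grad v x) (grad v x)) * gam v x = 1 := by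
  have hw := slope_pos v x
  have hp := slope_sq v x
  have hV : Matrix.vecMulVec (grad v x) (grad v x) * Matrix.vecMulVec (grad v x) (grad v x)
      = (slope v x ^ 2 - 1) • Matrix.vecMulVec (grad v x) (grad v x) := by
    rw [Matrix.vecMulVec_mul_vecMulVec, hp]
    ext i j; simp [Matrix.vecMulVec_apply]; ring
  unfold gam
  generalize Matrix.vecMulVec (grad v x) (grad v x) = V at *
  generalize slope v x = w at *
  simp only [sub_mul, mul_add, mul_sub, add_mul, one_mul, mul_one, smul_mul_assoc,
    mul_smul_comm, hV, smul_smul]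
  ext i j
  simp only [Matrix.sub_apply, Matrix.add_apply, Matrix.smul_apply, smul_eq_mul]
  field_simp
  ring

/-- The frame with coefficient matrix `v γ` is orthonormal for the hyperbolic metric. -/
theorem frame_orthonormal (v : EuclideanSpace ℝ (Fin n) → ℝ) (x : EuclideanSpace ℝ (Fin n))
    (hv : 0 < v x) :
    (v x • gam v x).transpose * firstForm v x * (v x • gam v x) = 1 := by
  rw [firstForm_eq, Matrix.transpose_smul, gam_transpose]
  simp only [smul_mul_assoc, mul_smul_comm, smul_smul, gam_sandwich]
  rw [show v x * ((v x ^ 2)⁻¹ * v x) = 1 by field_simp, one_smul]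

/-- The relation between hyperbolic and Euclidean second fundamental forms. -/
theorem secondForm_eq (v : EuclideanSpace ℝ (Fin n) → ℝ) (x : EuclideanSpace ℝ (Fin n))
    (hv : 0 < v x) :
    secondForm v x = (slope v x * v x ^ 2)⁻¹ •
      (1 + Matrix.vecMulVec (grad v x) (grad v x) + v x • hess v x) := by
  have hw := slope_pos v x
  ext i j
  have h1 : (Pi.single j (1 : ℝ) : Fin n → ℝ) i = (1 : Matrix (Fin n) (Fin n) ℝ) i j := by
    simp [Matrix.one_apply, Pi.single_apply]
  simp only [secondForm, hypInner, eucInner, hypCovDeriv, tangent, hypNormal, Matrix.of_apply,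
    Prod.fst_sub, Prod.snd_sub, Prod.smul_fst, Prod.smul_snd, Prod.fst_add, Prod.snd_add,
    smul_eq_mul, sub_dotProduct, add_dotProduct, smul_dotProduct, dotProduct_smul,
    dotProduct_neg, single_dotProduct, zero_dotProduct, h1, Matrix.smul_apply,
    Matrix.add_apply, Matrix.vecMulVec_apply, smul_zero, one_mul]
  field_simp
  ring

/-- The formula `a = (δ + v γ (D²v) γ) / w`. -/
theorem curvMatrix_eq (v : EuclideanSpace ℝ (Fin n) → ℝ) (x : EuclideanSpace ℝ (Fin n))
    (hv : 0 < v x) :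
    curvMatrix v x = (slope v x)⁻¹ • (1 + v x • (gam v x * hess v x * gam v x)) := by
  have hw := slope_pos v x
  rw [curvMatrix, secondForm_eq v x hv, Matrix.transpose_smul, gam_transpose]
  simp only [smul_mul_assoc, mul_smul_comm, smul_smul]
  rw [mul_add, add_mul, gam_sandwich, mul_smul_comm, smul_mul_assoc]
  congr 1
  field_simp

theorem curvMatrix_isHermitian (v : EuclideanSpace ℝ (Fin n) → ℝ)
    (x : EuclideanSpace ℝ (Fin n)) (hv : 0 < v x) (h2 : ContDiffAt ℝ 2 v x) :
    (curvMatrix v x).IsHermitian := by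
  have hH : (hess v x).transpose = hess v x := by
    ext i j
    exact (h2.isSymmSndFDerivAt (by simp)).eq _ _
  rw [Matrix.IsHermitian, Matrix.conjTranspose_eq_transpose_of_trivial, curvMatrix_eq v x hv]
  simp [Matrix.transpose_mul, gam_transpose, hH, Matrix.mul_assoc]

/-! ### The domain, the initial height and the approximate flow -/

/-- A bounded domain of `ℝⁿ` with smooth boundary: near each boundary point it is the sublevel
set of a smooth function with non-vanishing differential. -/
structure IsBoundedSmoothDomain (Ω : Set (EuclideanSpace ℝ (Fin n))) : Prop where
  isOpen : IsOpen Ω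
  isConnected : IsConnected Ω
  isBounded : Bornology.IsBounded Ω
  smooth_boundary : ∀ p ∈ frontier Ω, ∃ U : Set (EuclideanSpace ℝ (Fin n)),
    ∃ ρ : EuclideanSpace ℝ (Fin n) → ℝ, IsOpen U ∧ p ∈ U ∧ ContDiffOn ℝ ∞ ρ U ∧
      fderiv ℝ ρ p ≠ 0 ∧ ∀ x ∈ U, x ∈ Ω ↔ ρ x < 0

/-- `u₀ ∈ C^∞(Ω) ∩ C^{1,1}(Ω̄)` with `u₀ = 0` on `∂Ω`. -/
structure IsInitialHeight (Ω : Set (EuclideanSpace ℝ (Fin n)))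
    (u₀ : EuclideanSpace ℝ (Fin n) → ℝ) : Prop where
  contDiffOn : ContDiffOn ℝ ∞ u₀ Ω
  continuousOn : ContinuousOn u₀ (closure Ω)
  lipschitz_fderiv : ∃ L, LipschitzOnWith L (fderiv ℝ u₀) Ω
  zero_on_frontier : ∀ x ∈ frontier Ω, u₀ x = 0

/-- The time interval `[0, T)`, where `T = ⊤` is allowed. -/
def timeInterval (T : EReal) : Set ℝ := {t | 0 ≤ t ∧ (t : EReal) < T}

/-- Solutions `u` of the Dirichlet problem `u_t = u w (f(κ) - σ)` on `Ω × [0, T)`,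
`u(·, 0) = u₀ + ε`, `u = ε` on `∂Ω × [0, T)`: positive functions, continuous on `Ω̄ × [0, T)` and
smooth there except at the corner `∂Ω × {0}`, whose curvatures lie in the closed cone, where `f`
is defined. -/
structure IsSolution (f : (Fin n → ℝ) → ℝ) (σ ε : ℝ) (T : EReal)
    (Ω : Set (EuclideanSpace ℝ (Fin n))) (u₀ : EuclideanSpace ℝ (Fin n) → ℝ)
    (u : EuclideanSpace ℝ (Fin n) → ℝ → ℝ) : Prop where
  continuousOn : ContinuousOn (Function.uncurry u) (closure Ω ×ˢ timeInterval T)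
  contDiffOn : ContDiffOn ℝ ∞ (Function.uncurry u)
    ((closure Ω ×ˢ timeInterval T) \ (frontier Ω ×ˢ {0}))
  pos : ∀ x ∈ closure Ω, ∀ t ∈ timeInterval T, 0 < u x t
  curvature_mem : ∀ x ∈ Ω, ∀ t ∈ timeInterval T,
    principalCurvatures (fun y => u y t) x ∈ closure (posCone n)
  evolution : ∀ x ∈ Ω, ∀ t ∈ timeInterval T,
    HasDerivWithinAt (fun s => u x s)
      (u x t * slope (fun y => u y t) x *
        (f (principalCurvatures (fun y => u y t) x) - σ)) (timeInterval T) t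
  initial : ∀ x ∈ Ω, u x 0 = u₀ x + ε
  boundary : ∀ x ∈ frontier Ω, ∀ t ∈ timeInterval T, u x t = ε

/-- Admissible solutions: the flow surfaces are strictly locally convex for all `t ∈ [0, T)`. -/
structure IsAdmissibleSolution (f : (Fin n → ℝ) → ℝ) (σ ε : ℝ) (T : EReal)
    (Ω : Set (EuclideanSpace ℝ (Fin n))) (u₀ : EuclideanSpace ℝ (Fin n) → ℝ)
    (u : EuclideanSpace ℝ (Fin n) → ℝ → ℝ) : Prop extends IsSolution f σ ε T Ω u₀ u where
  strictlyConvex : ∀ x ∈ Ω, ∀ t ∈ timeInterval T, StrictlyConvexAt (fun y => u y t) x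

end HypFlow

end

noncomputable section

open scoped Matrix

namespace HypFlow

/-! ### Symmetric concave functions of the eigenvalues -/

section CurvatureFunction

variable {n : ℕ} {f : (Fin n → ℝ) → ℝ}

/-! Two difficulties shape the argument: `u` need not be smooth at the corner `∂Ω × {0}`, and `f` is
only assumed differentiable. Hence every maximum principle is run either against strict barriers
that are separated on the boundary, or locally in a ball inside `Ω`, and no derivative of an
eigenvalue is ever taken. The flow equation gives `w f(κ) = u_t / u + σ w` (`speed`), which inherits
smoothness from `u`. Its first variation comes from Schur's inequality: `f` of the diagonal in a
fixed orthonormal basis dominates `f` of the eigenvalues, with equality where that basis is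
principal, so the two derivatives agree there (`IsCurvatureFunction.exists_principalFrame`).

Convexity. As `f` is positive in `K` and zero on its boundary, strict local convexity means `B = w
f(κ) > 0`. With `l = w κ` and `φ = ∇f(l)`, the evolution of `B` (`IsPrincipalFrame.speed_evolution`)
contains the terms `σ φ i (1 - l i) (w + l i / w)`. Euler's identity `∑ φ i * l i = B` and `∑ φ i ≥
1` make their sum nearly `σ ∑ φ i` or more when `B` is small, and this beats all other terms at a
contact with a small multiple of `r² - |x - x₀|²`. So `B` cannot decrease there, and its value at
the centre keeps a positive lower bound. No upper bound on `∑ φ i` is needed.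

Expansion. Lowering a graph by `q` changes its curvature in a controlled way
(`IsCurvatureFunction.principalCurvatures_sub_const`), which makes slightly lowered graphs strict
subsolutions. Comparison with lowered copies of the initial graph gives `u(·,0) ≤ u(·,t)`; together
with the convexity of `u² + |x|²` along lines this bounds the gradient. Comparing `u(·,t+h)` with a
lowered and slowed copy of `u` gives monotonicity in time (`IsAdmissibleSolution.mono_time`), that
is `f(κ) ≥ σ`. Strictness is a strong maximum principle for `u u_t`: on compact sets the equation is
now uniformly elliptic, and a decaying barrier `η e^{-Kt} (r² - |x - x₀|²)²` stays below `u u_t`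
(`IsSolution.lt_curvature`). -/

theorem isOpen_posCone : IsOpen (posCone n) := by
  simp only [posCone, Set.ofPred_forall]
  exact isOpen_iInter_of_finite fun i => isOpen_lt continuous_const (continuous_apply i)

theorem closure_posCone : closure (posCone n) = {l | ∀ i, 0 ≤ l i} := by
  have h : posCone n = Set.pi Set.univ fun _ => Set.Ioi (0 : ℝ) := by
    ext l; simp [posCone]
  rw [h, closure_pi_set]
  ext l; simp [closure_Ioi, Pi.le_def]

theorem one_mem_posCone : (fun _ => 1 : Fin n → ℝ) ∈ posCone n := fun _ => one_pos

theorem smul_mem_posCone {l : Fin n → ℝ} (hl : l ∈ posCone n) {s : ℝ} (hs : 0 < s) :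
    s • l ∈ posCone n := fun i => mul_pos hs (hl i)

theorem add_mem_posCone {l m : Fin n → ℝ} (hl : l ∈ posCone n) (hm : m ∈ posCone n) :
    l + m ∈ posCone n := fun i => add_pos (hl i) (hm i)

theorem linearMap_apply_eq_sum (L : (Fin n → ℝ) →L[ℝ] ℝ) (m : Fin n → ℝ) :
    L m = ∑ i, L (Pi.single i 1) * m i := by
  conv_lhs => rw [pi_eq_sum_univ' m]
  simp only [map_sum, map_smul, smul_eq_mul]
  exact Finset.sum_congr rfl fun i _ => mul_comm _ _

namespace IsCurvatureFunction

theorem nonneg (hf : IsCurvatureFunction f) {l : Fin n → ℝ} (hl : l ∈ closure (posCone n)) :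
    0 ≤ f l := by
  by_cases h : l ∈ posCone n
  · exact (hf.pos l h).le
  · exact (hf.zero_on_frontier l ⟨hl, by rwa [isOpen_posCone.interior_eq]⟩).ge

/-- Since `f` vanishes on the boundary of the cone, its sign decides whether a point of the closed
cone is interior. This is what turns convexity into a statement about a scalar function. -/
theorem mem_posCone (hf : IsCurvatureFunction f) {l : Fin n → ℝ} (hl : l ∈ closure (posCone n))
    (h : 0 < f l) : l ∈ posCone n := by
  by_contra h'
  exact h.ne' (hf.zero_on_frontier l ⟨hl, by rwa [isOpen_posCone.interior_eq]⟩)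

theorem hasFDerivAt (hf : IsCurvatureFunction f) {l : Fin n → ℝ} (hl : l ∈ posCone n) :
    HasFDerivAt f (fderiv ℝ f l) l :=
  ((hf.differentiableOn l hl).differentiableAt (isOpen_posCone.mem_nhds hl)).hasFDerivAt

/-- A concave function lies below its tangent planes. -/
theorem le_tangent (hf : IsCurvatureFunction f) {l m : Fin n → ℝ} (hl : l ∈ posCone n)
    (hm : m ∈ posCone n) : f m ≤ f l + fderiv ℝ f l (m - l) := by
  have hd : HasDerivAt (fun s : ℝ => f (l + s • (m - l))) (fderiv ℝ f l (m - l)) 0 := by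
    have h1 : HasDerivAt (fun s : ℝ => l + s • (m - l)) (m - l) 0 := by
      simpa using ((hasDerivAt_id (0 : ℝ)).smul_const (m - l)).const_add l
    have h2 : HasFDerivAt f (fderiv ℝ f l) (l + (0 : ℝ) • (m - l)) := by
      simpa using hf.hasFDerivAt hl
    exact h2.comp_hasDerivAt 0 h1
  have hlim := (hasDerivAt_iff_tendsto_slope.1 hd).mono_left
    (nhdsWithin_mono 0 (s := Set.Ioi 0) (fun s (hs : (0 : ℝ) < s) => hs.ne'))
  have : f m - f l ≤ fderiv ℝ f l (m - l) := by
    refine ge_of_tendsto hlim ?_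
    filter_upwards [Ioo_mem_nhdsGT (one_pos : (0 : ℝ) < 1)] with s hs
    have hc := hf.concave.2 hl hm (sub_nonneg.2 hs.2.le) hs.1.le (by ring)
    have he : (1 - s) • l + s • m = l + s • (m - l) := by module
    rw [he] at hc
    simp only [smul_eq_mul] at hc
    rw [slope_def_field, le_div_iff₀ (by linarith [hs.1])]
    simp only [zero_smul, add_zero, sub_zero]
    nlinarith
  linarith

theorem mono (hf : IsCurvatureFunction f) {l m : Fin n → ℝ} (hl : l ∈ posCone n)
    (h : ∀ i, l i ≤ m i) : f l ≤ f m := by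
  have hm : m ∈ posCone n := fun i => (hl i).trans_le (h i)
  have h1 := hf.le_tangent hm hl
  rw [linearMap_apply_eq_sum] at h1
  have : ∑ i, fderiv ℝ f m (Pi.single i 1) * (l - m) i ≤ 0 :=
    Finset.sum_nonpos fun i _ =>
      mul_nonpos_of_nonneg_of_nonpos (hf.partial_pos m hm i).le (sub_nonpos.2 (h i))
  linarith

/-- Euler's identity. -/
theorem sum_partial_mul (hf : IsCurvatureFunction f) {l : Fin n → ℝ} (hl : l ∈ posCone n) :
    ∑ i, fderiv ℝ f l (Pi.single i 1) * l i = f l := by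
  rw [← linearMap_apply_eq_sum]
  have h1 : HasDerivAt (fun s : ℝ => s • l) l 1 := by
    simpa using (hasDerivAt_id (1 : ℝ)).smul_const l
  have h2 : HasFDerivAt f (fderiv ℝ f l) ((1 : ℝ) • l) := by
    simpa using hf.hasFDerivAt hl
  have h3 := h2.comp_hasDerivAt 1 h1
  have h4 : HasDerivAt (fun s : ℝ => s * f l) (f l) 1 := by
    simpa using (hasDerivAt_id (1 : ℝ)).mul_const (f l)
  refine h3.unique (h4.congr_of_eventuallyEq ?_)
  filter_upwards [lt_mem_nhds (one_pos : (0 : ℝ) < 1)] with s hs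
  exact hf.homogeneous l hl s hs

/-- The tangent plane at `l`, evaluated at `(1, …, 1)` where `f = 1`; Euler's identity cancels the
remaining terms. -/
theorem one_le_sum_partial (hf : IsCurvatureFunction f) {l : Fin n → ℝ} (hl : l ∈ posCone n) :
    1 ≤ ∑ i, fderiv ℝ f l (Pi.single i 1) := by
  have h := hf.le_tangent hl one_mem_posCone
  rw [hf.normalized, map_sub, linearMap_apply_eq_sum, linearMap_apply_eq_sum _ l,
    hf.sum_partial_mul hl] at h
  simpa using h

/-- By homogeneity the tangent plane at `l + m` is a linear function lying above `f` at both `l` and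
`m`. -/
theorem add_le (hf : IsCurvatureFunction f) {l m : Fin n → ℝ} (hl : l ∈ posCone n)
    (hm : m ∈ posCone n) : f l + f m ≤ f (l + m) := by
  have hlm := add_mem_posCone hl hm
  have h1 := hf.le_tangent hlm hl
  have h2 := hf.le_tangent hlm hm
  have h3 := hf.sum_partial_mul hlm
  rw [← linearMap_apply_eq_sum, map_add] at h3
  simp only [sub_add_cancel_left, sub_add_cancel_right, map_neg] at h1 h2
  linarith

/-- Averaging by a doubly stochastic matrix increases `f`. -/
theorem le_doublyStochastic (hf : IsCurvatureFunction f) {S : Matrix (Fin n) (Fin n) ℝ}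
    (hS : S ∈ doublyStochastic ℝ (Fin n)) {l : Fin n → ℝ} (hl : l ∈ posCone n) :
    f l ≤ f (S *ᵥ l) := by
  -- Birkhoff: `S` is a convex combination of permutation matrices, and symmetry gives `f` the same
  -- value at every permuted point.
  obtain ⟨w, hw0, hw1, rfl⟩ := exists_eq_sum_perm_of_mem_doublyStochastic hS
  have hp : ∀ π : Equiv.Perm (Fin n), π.permMatrix ℝ *ᵥ l = l ∘ π := by
    intro π; ext i; simp [Matrix.permMatrix_mulVec]
  have h := hf.concave.le_map_sum (t := Finset.univ) (w := w)
    (p := fun π : Equiv.Perm (Fin n) => l ∘ π) (fun i _ => hw0 i) hw1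
    (fun π _ i => hl (π i))
  simp only [hf.symmetric l hl, ← Finset.sum_smul, hw1, one_smul] at h
  simpa [Matrix.sum_mulVec, Matrix.smul_mulVec, hp] using h

end IsCurvatureFunction

theorem sq_mem_doublyStochastic {Q : Matrix (Fin n) (Fin n) ℝ} (hQ : Qᵀ * Q = 1) :
    (Matrix.of fun i j => Q i j ^ 2) ∈ doublyStochastic ℝ (Fin n) := by
  have hQ' : Q * Qᵀ = 1 := mul_eq_one_comm.1 hQ
  rw [mem_doublyStochastic_iff_sum]
  refine ⟨fun i j => sq_nonneg _, fun i => ?_, fun j => ?_⟩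
  · have := congrFun (congrFun hQ' i) i
    simpa [Matrix.mul_apply, sq] using this
  · have := congrFun (congrFun hQ j) j
    simpa [Matrix.mul_apply, sq] using this

theorem diag_conj_diagonal (R : Matrix (Fin n) (Fin n) ℝ) (μ : Fin n → ℝ) :
    (fun i => (R * Matrix.diagonal μ * Rᵀ) i i) = (Matrix.of fun i j => R i j ^ 2) *ᵥ μ := by
  ext i
  simp only [Matrix.mul_apply (M := R * Matrix.diagonal μ), Matrix.mul_diagonal,
    Matrix.transpose_apply, Matrix.mulVec, dotProduct, Matrix.of_apply]
  exact Finset.sum_congr rfl fun j _ => by ring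

theorem exists_diagonalization {C : Matrix (Fin n) (Fin n) ℝ} (hC : C.IsHermitian) :
    ∃ P : Matrix (Fin n) (Fin n) ℝ, Pᵀ * P = 1 ∧ P * Pᵀ = 1 ∧
      C = P * Matrix.diagonal hC.eigenvalues * Pᵀ := by
  refine ⟨hC.eigenvectorUnitary, ?_, ?_, ?_⟩
  · have := Unitary.coe_star_mul_self hC.eigenvectorUnitary
    simpa [Matrix.star_eq_conjTranspose] using this
  · have := Unitary.coe_mul_star_self hC.eigenvectorUnitary
    simpa [Matrix.star_eq_conjTranspose] using this
  · have := hC.spectral_theorem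
    rw [Unitary.conjStarAlgAut_apply] at this
    simpa [Matrix.star_eq_conjTranspose, Function.comp_def] using this

/-- Schur's inequality: `f` of the eigenvalues is at most `f` of the diagonal in any orthonormal
basis. -/
theorem IsCurvatureFunction.eigenvalues_le_diag (hf : IsCurvatureFunction f)
    {C : Matrix (Fin n) (Fin n) ℝ} (hC : C.IsHermitian) (hl : hC.eigenvalues ∈ posCone n)
    {Q : Matrix (Fin n) (Fin n) ℝ} (hQ : Qᵀ * Q = 1) :
    f hC.eigenvalues ≤ f fun i => (Qᵀ * C * Q) i i := by
  obtain ⟨P, hP, hP', hCP⟩ := exists_diagonalization hC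
  have h1 : Qᵀ * C * Q = (Qᵀ * P) * Matrix.diagonal hC.eigenvalues * (Qᵀ * P)ᵀ := by
    conv_lhs => rw [hCP]
    simp only [Matrix.transpose_mul, Matrix.transpose_transpose, Matrix.mul_assoc]
  rw [h1, diag_conj_diagonal]
  refine hf.le_doublyStochastic (sq_mem_doublyStochastic ?_) hl
  rw [Matrix.transpose_mul, Matrix.transpose_transpose, Matrix.mul_assoc, ← Matrix.mul_assoc Q,
    mul_eq_one_comm.1 hQ, Matrix.one_mul, hP]

/-- Here `μ` is some diagonalisation of `C`, possibly in another order than `eigenvalues`. Passing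
through a doubly stochastic matrix avoids constructing the permutation that matches the two lists.
-/
theorem IsCurvatureFunction.le_eigenvalues (hf : IsCurvatureFunction f)
    {C : Matrix (Fin n) (Fin n) ℝ} (hC : C.IsHermitian) {Q : Matrix (Fin n) (Fin n) ℝ}
    (hQ : Qᵀ * Q = 1) {μ : Fin n → ℝ} (hμ : μ ∈ posCone n)
    (h : C = Q * Matrix.diagonal μ * Qᵀ) : f μ ≤ f hC.eigenvalues := by
  obtain ⟨P, hP, hP', hCP⟩ := exists_diagonalization hC
  have h1 : Matrix.diagonal hC.eigenvalues = (Pᵀ * Q) * Matrix.diagonal μ * (Pᵀ * Q)ᵀ := by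
    have : Pᵀ * C * P = Matrix.diagonal hC.eigenvalues := by
      conv_lhs => rw [hCP]
      rw [Matrix.mul_assoc, Matrix.mul_assoc, hP, Matrix.mul_one, ← Matrix.mul_assoc, hP,
        Matrix.one_mul]
    rw [← this, h]
    simp only [Matrix.transpose_mul, Matrix.transpose_transpose, Matrix.mul_assoc]
  have h2 := diag_conj_diagonal (Pᵀ * Q) μ
  rw [← h1] at h2
  simp only [Matrix.diagonal_apply_eq] at h2
  have h3 : (fun i => hC.eigenvalues i) = hC.eigenvalues := rfl
  rw [← h3, h2]
  refine hf.le_doublyStochastic (sq_mem_doublyStochastic ?_) hμ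
  rw [Matrix.transpose_mul, Matrix.transpose_transpose, Matrix.mul_assoc, ← Matrix.mul_assoc P,
    hP', Matrix.one_mul, hQ]

end CurvatureFunction

/-! ### Curvature comparison for graphs at a point -/

section Pointwise

variable {n : ℕ} {f : (Fin n → ℝ) → ℝ} {v : EuclideanSpace ℝ (Fin n) → ℝ}
  {x : EuclideanSpace ℝ (Fin n)}

/-- The matrix `δᵢⱼ + vᵢ vⱼ + v vᵢⱼ`. -/
def convexForm (v : EuclideanSpace ℝ (Fin n) → ℝ) (x : EuclideanSpace ℝ (Fin n)) :
    Matrix (Fin n) (Fin n) ℝ :=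
  1 + Matrix.vecMulVec (grad v x) (grad v x) + v x • hess v x

theorem gam_mul_metric_mul_gam (v : EuclideanSpace ℝ (Fin n) → ℝ)
    (x : EuclideanSpace ℝ (Fin n)) :
    gam v x * ((1 + Matrix.vecMulVec (grad v x) (grad v x)) * gam v x) = 1 := by
  rw [← Matrix.mul_assoc, gam_sandwich]

theorem isUnit_gam (v : EuclideanSpace ℝ (Fin n) → ℝ) (x : EuclideanSpace ℝ (Fin n)) :
    IsUnit (gam v x) :=
  IsUnit.of_mul_eq_one _ (gam_mul_metric_mul_gam v x)

theorem curvMatrix_eq_conj (hv : 0 < v x) :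
    curvMatrix v x = (slope v x)⁻¹ • (gam v x * convexForm v x * gam v x) := by
  rw [curvMatrix_eq v x hv, convexForm, mul_add, add_mul, gam_sandwich, mul_smul_comm,
    smul_mul_assoc]

theorem principalCurvatures_eq (hv : 0 < v x) (h2 : ContDiffAt ℝ 2 v x) :
    principalCurvatures v x = (curvMatrix_isHermitian v x hv h2).eigenvalues := by
  rw [principalCurvatures, dif_pos]

/-- The curvature matrix is the congruence of `convexForm` by the invertible symmetric `γ`, scaled
by `1 / w > 0`. -/
theorem posDef_curvMatrix_iff (hv : 0 < v x) :
    (curvMatrix v x).PosDef ↔ StrictlyConvexAt v x := by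
  have hw := slope_pos v x
  have h1 : (gam v x * convexForm v x * gam v x).PosDef ↔ (convexForm v x).PosDef := by
    have := Matrix.IsUnit.posDef_star_left_conjugate_iff (isUnit_gam v x) (x := convexForm v x)
    rwa [Matrix.star_eq_conjTranspose, Matrix.conjTranspose_eq_transpose_of_trivial,
      gam_transpose] at this
  rw [curvMatrix_eq_conj hv]
  change _ ↔ (convexForm v x).PosDef
  rw [← h1]
  refine ⟨fun h => ?_, fun h => h.smul (inv_pos.2 hw)⟩
  have := h.smul hw
  rwa [smul_smul, mul_inv_cancel₀ hw.ne', one_smul] at this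

theorem strictlyConvexAt_iff (hv : 0 < v x) (h2 : ContDiffAt ℝ 2 v x) :
    StrictlyConvexAt v x ↔ principalCurvatures v x ∈ posCone n := by
  rw [principalCurvatures_eq hv h2, ← posDef_curvMatrix_iff hv,
    (curvMatrix_isHermitian v x hv h2).posDef_iff_eigenvalues_pos]
  rfl

theorem slope_congr {a b : EuclideanSpace ℝ (Fin n) → ℝ} (h : grad a x = grad b x) :
    slope a x = slope b x := by
  simp only [slope, h]

theorem gam_congr {a b : EuclideanSpace ℝ (Fin n) → ℝ} (h : grad a x = grad b x) :
    gam a x = gam b x := by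
  simp only [gam, h, slope_congr h]

/-- Among graphs touching to first order, the curvature is monotone in the Hessian. -/
theorem IsCurvatureFunction.principalCurvatures_mono (hf : IsCurvatureFunction f)
    {a b : EuclideanSpace ℝ (Fin n) → ℝ} (hb0 : 0 < b x) (hab : a x = b x)
    (hgrad : grad a x = grad b x) (ha : ContDiffAt ℝ 2 a x) (hb : ContDiffAt ℝ 2 b x)
    (hH : (hess a x - hess b x).PosSemidef) (hconv : StrictlyConvexAt b x) :
    f (principalCurvatures b x) ≤ f (principalCurvatures a x) := by
  have ha0 : 0 < a x := hab ▸ hb0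
  have hw := slope_pos b x
  have hsub : curvMatrix a x - curvMatrix b x =
      (slope b x)⁻¹ • b x • ((gam b x)ᵀ * (hess a x - hess b x) * gam b x) := by
    rw [curvMatrix_eq a x ha0, curvMatrix_eq b x hb0, slope_congr hgrad, gam_congr hgrad, hab,
      gam_transpose, ← smul_sub, add_sub_add_left_eq_sub, ← smul_sub]
    simp only [Matrix.mul_sub, Matrix.sub_mul]
  have hpsd : (curvMatrix a x - curvMatrix b x).PosSemidef := by
    rw [hsub]
    have := hH.conjTranspose_mul_mul_same (gam b x)
    rw [Matrix.conjTranspose_eq_transpose_of_trivial] at this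
    exact (this.smul hb0.le).smul (inv_pos.2 hw).le
  have hbpd := (posDef_curvMatrix_iff hb0).2 hconv
  rw [principalCurvatures_eq hb0 hb, principalCurvatures_eq ha0 ha]
  set hA := curvMatrix_isHermitian a x ha0 ha
  set hB := curvMatrix_isHermitian b x hb0 hb
  -- The basis diagonalises the matrix of `a`. Schur's inequality is applied to the matrix of `b` in
  -- this basis, and its diagonal there is entrywise at most the eigenvalues of `a`.
  obtain ⟨Q, hQ, hQ', hdiag⟩ := exists_diagonalization hA
  have h1 : Qᵀ * curvMatrix a x * Q = Matrix.diagonal hA.eigenvalues := by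
    conv_lhs => rw [hdiag]
    rw [Matrix.mul_assoc, Matrix.mul_assoc, hQ, Matrix.mul_one, ← Matrix.mul_assoc, hQ,
      Matrix.one_mul]
  refine (hf.eigenvalues_le_diag hB (fun i => hbpd.eigenvalues_pos i) hQ).trans
    (hf.mono ?_ fun i => ?_)
  · intro i
    have hinj : Function.Injective Q.mulVec := by
      intro y z hyz
      have := congrArg (fun y => Qᵀ *ᵥ y) hyz
      simpa [Matrix.mulVec_mulVec, hQ] using this
    have := hbpd.conjTranspose_mul_mul_same hinj
    rw [Matrix.conjTranspose_eq_transpose_of_trivial] at this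
    exact this.diag_pos
  · have h2 := (hpsd.conjTranspose_mul_mul_same Q).diag_nonneg (i := i)
    rw [Matrix.conjTranspose_eq_transpose_of_trivial, Matrix.mul_sub, Matrix.sub_mul, h1] at h2
    simpa using h2

theorem grad_sub_const (v : EuclideanSpace ℝ (Fin n) → ℝ) (c : ℝ) :
    grad (fun y => v y - c) = grad v := by
  funext y i; rw [grad, fderiv_sub_const, grad]

theorem hess_sub_const (v : EuclideanSpace ℝ (Fin n) → ℝ) (c : ℝ) :
    hess (fun y => v y - c) = hess v := by
  funext y
  have : (fderiv ℝ fun y => v y - c) = fderiv ℝ v := by funext z; exact fderiv_sub_const c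
  simp only [hess, this]

/-- Lowering leaves the gradient and the Hessian unchanged, so the new form is a convex combination,
with weights `c / v` and `1 - c / v`, of the metric `1 + Dv ⊗ Dv` and the old form. -/
theorem StrictlyConvexAt.sub_const (hconv : StrictlyConvexAt v x) {c : ℝ} (hc : 0 < c)
    (hcv : c < v x) : StrictlyConvexAt (fun y => v y - c) x := by
  have hv : 0 < v x := hc.trans hcv
  have h : convexForm (fun y => v y - c) x =
      (c / v x) • (1 + Matrix.vecMulVec (grad v x) (grad v x)) +
        ((v x - c) / v x) • convexForm v x := by
    simp only [convexForm, grad_sub_const, hess_sub_const, smul_add, smul_smul]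
    have e1 : (v x - c) / v x * v x = v x - c := by field_simp
    have e2 : c / v x + (v x - c) / v x = 1 := by field_simp; ring
    rw [e1]
    calc _ = (c / v x + (v x - c) / v x) • ((1 : Matrix (Fin n) (Fin n) ℝ) +
        Matrix.vecMulVec (grad v x) (grad v x)) + (v x - c) • hess v x := by rw [e2, one_smul]
      _ = _ := by module
  change (convexForm (fun y => v y - c) x).PosDef
  rw [h]
  have h1 : (1 + Matrix.vecMulVec (grad v x) (grad v x)).PosSemidef := by
    have := Matrix.posSemidef_vecMulVec_self_star (grad v x)
    rw [star_trivial] at this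
    exact Matrix.PosSemidef.one.add this
  exact Matrix.PosDef.posSemidef_add (h1.smul (div_pos hc hv).le)
    (Matrix.PosDef.smul (show (convexForm v x).PosDef from hconv)
      (div_pos (sub_pos.2 hcv) hv))

/-- Effect on the curvature of a vertical Euclidean translation downwards. -/
theorem IsCurvatureFunction.principalCurvatures_sub_const (hf : IsCurvatureFunction f)
    (h2 : ContDiffAt ℝ 2 v x) (hconv : StrictlyConvexAt v x) {c : ℝ} (hc : 0 < c)
    (hcv : c < v x) :
    c / v x + (v x - c) / v x * (slope v x * f (principalCurvatures v x)) ≤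
      slope v x * f (principalCurvatures (fun y => v y - c) x) := by
  have hv : 0 < v x := hc.trans hcv
  have hw := slope_pos v x
  have hb : 0 < v x - c := sub_pos.2 hcv
  have h2' : ContDiffAt ℝ 2 (fun y => v y - c) x := h2.sub contDiffAt_const
  have hκ := (strictlyConvexAt_iff hv h2).1 hconv
  rw [principalCurvatures_eq (v := fun y => v y - c) hb h2']
  rw [principalCurvatures_eq hv h2] at hκ ⊢
  set hA := curvMatrix_isHermitian v x hv h2
  set hB := curvMatrix_isHermitian (fun y => v y - c) x hb h2'
  obtain ⟨Q, hQ, hQ', hdiag⟩ := exists_diagonalization hA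
  set r := (v x - c) / v x with hr
  have hr0 : 0 < r := div_pos hb hv
  have hq0 : 0 < c / v x / slope v x := div_pos (div_pos hc hv) hw
  have hsum : c / v x + r = 1 := by rw [hr]; field_simp; ring
  have hgw : slope (fun y => v y - c) x = slope v x :=
    slope_congr (by rw [grad_sub_const])
  have hgg : gam (fun y => v y - c) x = gam v x := gam_congr (by rw [grad_sub_const])
  -- The new matrix is a positive combination of the identity and the old one, hence diagonal in the
  -- same basis; superadditivity and homogeneity of `f` then give the estimate.
  have hC : curvMatrix (fun y => v y - c) x =
      (c / v x / slope v x) • 1 + r • curvMatrix v x := by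
    rw [curvMatrix_eq v x hv, curvMatrix_eq (fun y => v y - c) x hb, hgw, hgg, hess_sub_const]
    have e1 : v x - c = r * v x := by rw [hr]; field_simp
    have e2 : c / v x / slope v x = (slope v x)⁻¹ * (1 - r) := by
      rw [← hsum]; field_simp; ring
    rw [e1, e2]
    module
  have hμ : (c / v x / slope v x) • (fun _ => 1 : Fin n → ℝ) + r • hA.eigenvalues ∈ posCone n :=
    add_mem_posCone (smul_mem_posCone one_mem_posCone hq0) (smul_mem_posCone hκ hr0)
  have hd : curvMatrix (fun y => v y - c) x = Q * Matrix.diagonal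
      ((c / v x / slope v x) • (fun _ => 1 : Fin n → ℝ) + r • hA.eigenvalues) * Qᵀ := by
    rw [hC]
    conv_lhs => rw [hdiag]
    have : Matrix.diagonal
      ((c / v x / slope v x) • (fun _ => 1 : Fin n → ℝ) + r • hA.eigenvalues) =
      (c / v x / slope v x) • 1 + r • Matrix.diagonal hA.eigenvalues := by
      ext i j
      by_cases hij : i = j
      · subst hij; simp
      · simp [hij]
    rw [this, Matrix.mul_add, Matrix.add_mul]
    simp only [mul_smul_comm, smul_mul_assoc, Matrix.mul_one, hQ']
  have h3 := hf.le_eigenvalues hB hQ hμ hd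
  have h4 := hf.add_le (smul_mem_posCone one_mem_posCone hq0) (smul_mem_posCone hκ hr0)
  rw [hf.homogeneous _ one_mem_posCone _ hq0, hf.homogeneous _ hκ _ hr0, hf.normalized] at h4
  have h5 := mul_le_mul_of_nonneg_left (h4.trans h3) hw.le
  calc _ = slope v x * (c / v x / slope v x * 1 + r * f hA.eigenvalues) := by
        field_simp
    _ ≤ _ := h5

end Pointwise

/-! ### Contact arguments -/

section Contact

/-- A continuous function on a space-time cylinder which is positive initially stays positive if
it cannot touch zero for a first time. -/
theorem pos_of_no_contact {X : Type*} [TopologicalSpace X] {S : Set X} (hS : IsCompact S)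
    {τ : ℝ} {h : X → ℝ → ℝ} (hc : ContinuousOn (Function.uncurry h) (S ×ˢ Set.Icc 0 τ))
    (h0 : ∀ x ∈ S, 0 < h x 0)
    (hno : ∀ x ∈ S, ∀ t ∈ Set.Ioc 0 τ, h x t = 0 → (∀ y ∈ S, 0 ≤ h y t) →
      (∀ s ∈ Set.Ico 0 t, 0 < h x s) → False) :
    ∀ x ∈ S, ∀ t ∈ Set.Icc 0 τ, 0 < h x t := by
  by_contra! hcon
  obtain ⟨x₁, hx₁, t₁, ht₁, h₁⟩ := hcon
  have hcyl : IsCompact (S ×ˢ Set.Icc 0 τ) := hS.prod isCompact_Icc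
  obtain ⟨C, hC, hCeq⟩ := continuousOn_iff_isClosed.1 hc (Set.Iic 0) isClosed_Iic
  have hZ : IsCompact ((S ×ˢ Set.Icc 0 τ) ∩ Function.uncurry h ⁻¹' Set.Iic 0) := by
    rw [Set.inter_comm, hCeq, Set.inter_comm]; exact hcyl.inter_right hC
  -- The first contact: a point of least time in the compact set where `h ≤ 0`.
  obtain ⟨⟨x, t⟩, ⟨⟨hx, ht⟩, hxt⟩, hmin⟩ := hZ.exists_isMinOn ⟨(x₁, t₁), ⟨hx₁, ht₁⟩, h₁⟩
    continuous_snd.continuousOn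
  have hbefore : ∀ y ∈ S, ∀ s ∈ Set.Ico 0 t, 0 < h y s := by
    intro y hy s hs
    by_contra! hle
    have : t ≤ s := hmin (a := (y, s)) ⟨⟨hy, hs.1, hs.2.le.trans ht.2⟩, hle⟩
    exact absurd hs.2 this.not_gt
  have ht0 : 0 < t := by
    rcases ht.1.eq_or_lt with h' | h'
    · exact ((not_le.2 (by
        have h1 : 0 = t := h'; rw [← h1]; exact h0 x hx) : ¬ h x t ≤ 0) hxt).elim
    · exact h'
  have hnn : ∀ y ∈ S, 0 ≤ h y t := by
    intro y hy
    have hcy : ContinuousOn (h y) (Set.Icc 0 τ) := by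
      have : ContinuousOn (fun s => (y, s)) (Set.Icc (0 : ℝ) τ) := by fun_prop
      exact hc.comp this fun s hs => ⟨hy, hs⟩
    have hlim : Filter.Tendsto (h y) (𝓝[Set.Ico 0 t] t) (𝓝 (h y t)) :=
      (hcy t ht).mono_left (nhdsWithin_mono _ fun s hs => ⟨hs.1, hs.2.le.trans ht.2⟩)
    have hne : (𝓝[Set.Ico 0 t] t).NeBot := by
      rw [← mem_closure_iff_nhdsWithin_neBot, closure_Ico ht0.ne]
      exact ⟨ht0.le, le_rfl⟩
    exact ge_of_tendsto hlim (by
      filter_upwards [self_mem_nhdsWithin] with s hs using (hbefore y hy s hs).le)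
  exact hno x hx t ⟨ht0, ht.2⟩ (le_antisymm hxt (hnn x hx)) hnn (hbefore x hx)

theorem deriv_nonpos_of_pos_before {h : ℝ → ℝ} {d t : ℝ} (ht : 0 < t)
    (hd : HasDerivWithinAt h d (Set.Iio t) t) (h0 : h t = 0)
    (hb : ∀ s ∈ Set.Ico 0 t, 0 < h s) : d ≤ 0 := by
  have hl := (hasDerivWithinAt_iff_tendsto_slope' (by simp)).1 hd
  refine le_of_tendsto hl ?_
  filter_upwards [Ioo_mem_nhdsLT ht] with s hs
  rw [slope_def_field, h0, sub_zero]
  exact div_nonpos_of_nonneg_of_nonpos (hb s ⟨hs.1.le, hs.2⟩).le (sub_nonpos.2 hs.2.le)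

theorem deriv_deriv_nonneg_of_isLocalMin {φ : ℝ → ℝ} {t : ℝ} (hmin : IsLocalMin φ t)
    (hc : ContinuousAt φ t) : 0 ≤ deriv (deriv φ) t := by
  by_contra! hneg
  have hd := hmin.deriv_eq_zero
  -- A negative second derivative would make the minimum a maximum as well, so `φ` would be locally
  -- constant with vanishing second derivative.
  have hmax := isLocalMax_of_deriv_deriv_neg hneg hd hc
  have hconst : φ =ᶠ[𝓝 t] fun _ => φ t := by
    filter_upwards [hmin, hmax] with s h1 h2 using le_antisymm h2 h1
  have h1 : deriv φ =ᶠ[𝓝 t] fun _ => 0 := by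
    have := hconst.deriv
    simpa using this
  rw [h1.deriv_eq] at hneg
  simp at hneg

variable {E : Type*} [NormedAddCommGroup E] [NormedSpace ℝ E]

theorem hasDerivAt_add_smul (x e : E) (s : ℝ) : HasDerivAt (fun s : ℝ => x + s • e) e s := by
  simpa using ((hasDerivAt_id s).smul_const e).const_add x

/-- Second derivatives along lines. -/
theorem deriv_deriv_line {a : E → ℝ} {x : E} (ha : ContDiffAt ℝ 2 a x) (e : E) :
    deriv (deriv fun s : ℝ => a (x + s • e)) 0 = fderiv ℝ (fderiv ℝ a) x e e := by
  have hx : x = x + (0 : ℝ) • e := by simp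
  have h1 : deriv (fun s : ℝ => a (x + s • e)) =ᶠ[𝓝 0] fun s => fderiv ℝ a (x + s • e) e := by
    have hev : ∀ᶠ y in 𝓝 x, DifferentiableAt ℝ a y :=
      (ha.eventually (by simp)).mono fun y hy => hy.differentiableAt (by simp)
    have ht : Filter.Tendsto (fun s : ℝ => x + s • e) (𝓝 0) (𝓝 x) := by
      have := (hasDerivAt_add_smul x e 0).continuousAt.tendsto
      simpa using this
    filter_upwards [ht.eventually hev] with s hs
    exact (hs.hasFDerivAt.comp_hasDerivAt s (hasDerivAt_add_smul x e s)).deriv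
  rw [h1.deriv_eq]
  have h2 : DifferentiableAt ℝ (fderiv ℝ a) x :=
    (ha.fderiv_right (m := 1) (by norm_num)).differentiableAt (by simp)
  have h3 : HasFDerivAt (fderiv ℝ a) (fderiv ℝ (fderiv ℝ a) x) (x + (0 : ℝ) • e) := by
    rw [← hx]; exact h2.hasFDerivAt
  have h4 : HasDerivAt (fun s : ℝ => fderiv ℝ a (x + s • e)) (fderiv ℝ (fderiv ℝ a) x e) 0 :=
    h3.comp_hasDerivAt 0 (hasDerivAt_add_smul x e 0)
  have h5 := h4.clm_apply (hasDerivAt_const (0 : ℝ) e)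
  simpa using h5.deriv

/-- The second derivative test (necessary condition). -/
theorem IsLocalMin.fderiv_fderiv_nonneg {a : E → ℝ} {x : E} (hmin : IsLocalMin a x)
    (ha : ContDiffAt ℝ 2 a x) (e : E) : 0 ≤ fderiv ℝ (fderiv ℝ a) x e e := by
  rw [← deriv_deriv_line ha]
  have hc : ContinuousAt (fun s : ℝ => x + s • e) 0 :=
    (hasDerivAt_add_smul x e 0).continuousAt
  refine deriv_deriv_nonneg_of_isLocalMin ?_ ?_
  · have : IsLocalMin a (x + (0 : ℝ) • e) := by simpa using hmin
    exact IsLocalMin.comp_continuous (g := fun s : ℝ => x + s • e) this hc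
  · have : ContinuousAt a (x + (0 : ℝ) • e) := by simpa using ha.continuousAt
    exact ContinuousAt.comp (f := fun s : ℝ => x + s • e) this hc

end Contact

/-! ### Comparison principle for the flow -/

section Comparison

variable {n : ℕ} {f : (Fin n → ℝ) → ℝ}

theorem toLp_eq_sum_single (y : Fin n → ℝ) :
    WithLp.toLp 2 y = ∑ i, y i • EuclideanSpace.single i (1 : ℝ) := by
  ext j
  simp [Pi.single_apply]

theorem fderiv_toLp (v : EuclideanSpace ℝ (Fin n) → ℝ) (x : EuclideanSpace ℝ (Fin n))
    (y : Fin n → ℝ) : fderiv ℝ v x (WithLp.toLp 2 y) = grad v x ⬝ᵥ y := by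
  rw [toLp_eq_sum_single, map_sum]
  simp only [map_smul, smul_eq_mul, dotProduct, grad]
  exact Finset.sum_congr rfl fun i _ => mul_comm _ _

theorem fderiv_fderiv_toLp (v : EuclideanSpace ℝ (Fin n) → ℝ) (x : EuclideanSpace ℝ (Fin n))
    (y z : Fin n → ℝ) :
    fderiv ℝ (fderiv ℝ v) x (WithLp.toLp 2 y) (WithLp.toLp 2 z) = y ⬝ᵥ (hess v x *ᵥ z) := by
  rw [toLp_eq_sum_single, toLp_eq_sum_single]
  simp only [map_sum, map_smul, sum_apply, smul_apply,
    smul_eq_mul, dotProduct, Matrix.mulVec, hess, Matrix.of_apply, Finset.mul_sum]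
  rw [Finset.sum_comm]
  exact Finset.sum_congr rfl fun i _ => Finset.sum_congr rfl fun j _ => by ring

theorem hess_isHermitian {v : EuclideanSpace ℝ (Fin n) → ℝ} {x : EuclideanSpace ℝ (Fin n)}
    (h2 : ContDiffAt ℝ 2 v x) : (hess v x).IsHermitian := by
  ext i j
  exact (h2.isSymmSndFDerivAt (by simp)).eq _ _

theorem grad_eq_of_isLocalMin_sub {a b : EuclideanSpace ℝ (Fin n) → ℝ}
    {x : EuclideanSpace ℝ (Fin n)} (ha : ContDiffAt ℝ 2 a x) (hb : ContDiffAt ℝ 2 b x)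
    (hmin : IsLocalMin (fun y => a y - b y) x) : grad a x = grad b x := by
  have h := hmin.fderiv_eq_zero
  rw [fderiv_fun_sub (ha.differentiableAt (by simp)) (hb.differentiableAt (by simp))] at h
  rw [sub_eq_zero] at h
  funext i
  simp only [grad, h]

theorem hess_sub_posSemidef_of_isLocalMin {a b : EuclideanSpace ℝ (Fin n) → ℝ}
    {x : EuclideanSpace ℝ (Fin n)} (ha : ContDiffAt ℝ 2 a x) (hb : ContDiffAt ℝ 2 b x)
    (hmin : IsLocalMin (fun y => a y - b y) x) : (hess a x - hess b x).PosSemidef := by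
  refine Matrix.PosSemidef.of_dotProduct_mulVec_nonneg
    ((hess_isHermitian ha).sub (hess_isHermitian hb)) fun y => ?_
  have h := IsLocalMin.fderiv_fderiv_nonneg hmin (ha.sub hb) (WithLp.toLp 2 y)
  have h1 : fderiv ℝ (fun y => a y - b y) =ᶠ[𝓝 x] fun y => fderiv ℝ a y - fderiv ℝ b y := by
    filter_upwards [ha.eventually (by simp), hb.eventually (by simp)] with y h1 h2
    exact fderiv_fun_sub (h1.differentiableAt (by simp)) (h2.differentiableAt (by simp))
  rw [h1.fderiv_eq, fderiv_fun_sub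
    ((ha.fderiv_right (m := 1) (by norm_num)).differentiableAt (by simp))
    ((hb.fderiv_right (m := 1) (by norm_num)).differentiableAt (by simp))] at h
  rw [star_trivial, Matrix.sub_mulVec, dotProduct_sub, ← fderiv_fderiv_toLp,
    ← fderiv_fderiv_toLp]
  simpa using h

/-- A strictly locally convex strict subsolution stays below a solution. -/
theorem IsCurvatureFunction.comparison (hf : IsCurvatureFunction f)
    {Ω : Set (EuclideanSpace ℝ (Fin n))} (hΩ : IsOpen Ω) (hbdd : Bornology.IsBounded Ω)
    {τ σ : ℝ} {a b : EuclideanSpace ℝ (Fin n) → ℝ → ℝ}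
    (hac : ContinuousOn (Function.uncurry a) (closure Ω ×ˢ Set.Icc 0 τ))
    (hbc : ContinuousOn (Function.uncurry b) (closure Ω ×ˢ Set.Icc 0 τ))
    (h0 : ∀ x ∈ closure Ω, b x 0 < a x 0)
    (hfr : ∀ x ∈ frontier Ω, ∀ t ∈ Set.Icc 0 τ, b x t < a x t)
    (ha2 : ∀ x ∈ Ω, ∀ t ∈ Set.Ioc 0 τ, ContDiffAt ℝ 2 (fun y => a y t) x)
    (hb2 : ∀ x ∈ Ω, ∀ t ∈ Set.Ioc 0 τ, ContDiffAt ℝ 2 (fun y => b y t) x)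
    (ha' : ∀ x ∈ Ω, ∀ t ∈ Set.Ioc 0 τ, HasDerivWithinAt (a x)
      (a x t * slope (fun y => a y t) x * (f (principalCurvatures (fun y => a y t) x) - σ))
      (Set.Iio t) t)
    (hb' : ∀ x ∈ Ω, ∀ t ∈ Set.Ioc 0 τ, ∃ d, HasDerivWithinAt (b x) d (Set.Iio t) t ∧
      d < b x t * slope (fun y => b y t) x *
        (f (principalCurvatures (fun y => b y t) x) - σ))
    (hbpos : ∀ x ∈ Ω, ∀ t ∈ Set.Ioc 0 τ, 0 < b x t)
    (hbconv : ∀ x ∈ Ω, ∀ t ∈ Set.Ioc 0 τ, StrictlyConvexAt (fun y => b y t) x) :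
    ∀ x ∈ closure Ω, ∀ t ∈ Set.Icc 0 τ, b x t < a x t := by
  have key := pos_of_no_contact (S := closure Ω) hbdd.isCompact_closure (τ := τ)
    (h := fun x t => a x t - b x t) (hac.sub hbc) (fun x hx => sub_pos.2 (h0 x hx)) ?_
  · exact fun x hx t ht => sub_pos.1 (key x hx t ht)
  intro x hx t ht hz hnn hbefore
  have hxΩ : x ∈ Ω := by
    by_contra hn
    have := hfr x ⟨hx, by rwa [hΩ.interior_eq]⟩ t ⟨ht.1.le, ht.2⟩
    linarith
  have hmin : IsLocalMin (fun y => a y t - b y t) x := by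
    filter_upwards [hΩ.mem_nhds hxΩ] with y hy
    change a x t - b x t ≤ _
    rw [hz]; exact hnn y (subset_closure hy)
  have hab : a x t = b x t := sub_eq_zero.1 hz
  have hgrad := grad_eq_of_isLocalMin_sub (ha2 x hxΩ t ht) (hb2 x hxΩ t ht) hmin
  have hmono := hf.principalCurvatures_mono (a := fun y => a y t) (b := fun y => b y t)
    (hbpos x hxΩ t ht) hab hgrad (ha2 x hxΩ t ht) (hb2 x hxΩ t ht)
    (hess_sub_posSemidef_of_isLocalMin (ha2 x hxΩ t ht) (hb2 x hxΩ t ht) hmin)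
    (hbconv x hxΩ t ht)
  obtain ⟨d, hd, hlt⟩ := hb' x hxΩ t ht
  -- `a - b` was positive before the contact, so its left derivative is at most zero; the curvature
  -- inequality and the strictness of the subsolution make it positive.
  have hder := deriv_nonpos_of_pos_before ht.1 ((ha' x hxΩ t ht).sub hd) hz hbefore
  have hpos : 0 < a x t * slope (fun y => a y t) x :=
    mul_pos (hab ▸ hbpos x hxΩ t ht) (slope_pos _ _)
  have hw := slope_congr hgrad
  rw [← hab, ← hw] at hlt
  have := mul_le_mul_of_nonneg_left (sub_le_sub_right hmono σ) hpos.le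
  linarith

end Comparison

/-! ### Monotonicity in time of expanding admissible solutions -/

section Solutions

variable {n : ℕ} {f : (Fin n → ℝ) → ℝ} {σ ε : ℝ} {T : EReal}
  {Ω : Set (EuclideanSpace ℝ (Fin n))} {u₀ : EuclideanSpace ℝ (Fin n) → ℝ}
  {u : EuclideanSpace ℝ (Fin n) → ℝ → ℝ}

theorem mem_timeInterval_of_le {t s : ℝ} (ht : t ∈ timeInterval T) (hs0 : 0 ≤ s) (hs : s ≤ t) :
    s ∈ timeInterval T :=
  ⟨hs0, (EReal.coe_le_coe_iff.2 hs).trans_lt ht.2⟩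

theorem Icc_subset_timeInterval {t : ℝ} (ht : t ∈ timeInterval T) :
    Set.Icc 0 t ⊆ timeInterval T := fun _ hs => mem_timeInterval_of_le ht hs.1 hs.2

theorem exists_gt_mem_timeInterval {t : ℝ} (ht : t ∈ timeInterval T) :
    ∃ t' ∈ timeInterval T, t < t' := by
  obtain ⟨q, hq1, hq2⟩ := EReal.lt_iff_exists_real_btwn.1 ht.2
  have h : t < q := EReal.coe_lt_coe_iff.1 hq1
  exact ⟨q, ⟨ht.1.trans h.le, hq2⟩, h⟩

theorem not_mem_frontier_of_mem (hΩ : IsOpen Ω) {x : EuclideanSpace ℝ (Fin n)} (hx : x ∈ Ω) :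
    x ∉ frontier Ω := fun h => h.2 (by rwa [hΩ.interior_eq])

theorem IsSolution.contDiffOn_interior (hu : IsSolution f σ ε T Ω u₀ u) (hΩ : IsOpen Ω) :
    ContDiffOn ℝ ∞ (Function.uncurry u) (Ω ×ˢ timeInterval T) :=
  hu.contDiffOn.mono fun _ hp =>
    ⟨⟨subset_closure hp.1, hp.2⟩, fun h => not_mem_frontier_of_mem hΩ hp.1 h.1⟩

theorem IsSolution.contDiffAt_slice (hu : IsSolution f σ ε T Ω u₀ u) (hΩ : IsOpen Ω)
    {x : EuclideanSpace ℝ (Fin n)} (hx : x ∈ Ω) {t : ℝ} (ht : t ∈ timeInterval T) :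
    ContDiffAt ℝ ∞ (fun y => u y t) x := by
  have h1 : ContDiffOn ℝ ∞ (fun y : EuclideanSpace ℝ (Fin n) => (y, t)) Ω := by fun_prop
  exact ((hu.contDiffOn_interior hΩ).comp h1 fun y hy => ⟨hy, ht⟩).contDiffAt (hΩ.mem_nhds hx)

theorem contDiffAt_two_of_infty {E : Type*} [NormedAddCommGroup E] [NormedSpace ℝ E]
    {v : E → ℝ} {x : E} (h : ContDiffAt ℝ ∞ v x) : ContDiffAt ℝ 2 v x :=
  contDiffAt_infty.1 h 2

theorem IsSolution.hasDerivWithinAt_Iio (hu : IsSolution f σ ε T Ω u₀ u)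
    {x : EuclideanSpace ℝ (Fin n)} (hx : x ∈ Ω) {t : ℝ} (ht : t ∈ timeInterval T)
    (ht0 : 0 < t) :
    HasDerivWithinAt (u x) (u x t * slope (fun y => u y t) x *
        (f (principalCurvatures (fun y => u y t) x) - σ)) (Set.Iio t) t :=
  (hu.evolution x hx t ht).mono_of_mem_nhdsWithin
    (Filter.mem_of_superset (Ioo_mem_nhdsLT ht0) fun _ hs =>
      mem_timeInterval_of_le ht hs.1.le hs.2.le)

theorem IsSolution.continuousOn_Icc (hu : IsSolution f σ ε T Ω u₀ u) {τ : ℝ}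
    (hτ : τ ∈ timeInterval T) :
    ContinuousOn (Function.uncurry u) (closure Ω ×ˢ Set.Icc 0 τ) :=
  hu.continuousOn.mono (Set.prod_mono le_rfl (Icc_subset_timeInterval hτ))

/-- Positive two-sided bounds on compact time intervals. -/
theorem IsSolution.exists_bounds (hu : IsSolution f σ ε T Ω u₀ u)
    (hbdd : Bornology.IsBounded Ω) {τ : ℝ} (hτ : τ ∈ timeInterval T) :
    ∃ c > 0, ∃ M > 0, ∀ x ∈ closure Ω, ∀ t ∈ Set.Icc 0 τ, c ≤ u x t ∧ u x t ≤ M := by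
  have hK : IsCompact (closure Ω ×ˢ Set.Icc 0 τ) := hbdd.isCompact_closure.prod isCompact_Icc
  rcases (closure Ω ×ˢ Set.Icc 0 τ).eq_empty_or_nonempty with he | hne
  · refine ⟨1, one_pos, 1, one_pos, fun x hx t ht => ?_⟩
    have : (x, t) ∈ closure Ω ×ˢ Set.Icc 0 τ := ⟨hx, ht⟩
    rw [he] at this
    exact this.elim
  · obtain ⟨p, hp, hpmin⟩ := hK.exists_isMinOn hne (hu.continuousOn_Icc hτ)
    obtain ⟨q, hq, hqmax⟩ := hK.exists_isMaxOn hne (hu.continuousOn_Icc hτ)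
    have hpos : ∀ p ∈ closure Ω ×ˢ Set.Icc 0 τ, 0 < Function.uncurry u p := fun p hp =>
      hu.pos _ hp.1 _ (Icc_subset_timeInterval hτ hp.2)
    exact ⟨_, hpos p hp, _, hpos q hq, fun x hx t ht =>
      ⟨hpmin (a := (x, t)) ⟨hx, ht⟩, hqmax (a := (x, t)) ⟨hx, ht⟩⟩⟩

/-! #### Gradient bound -/

theorem slope_le_of_grad_le {v : EuclideanSpace ℝ (Fin n) → ℝ} {x : EuclideanSpace ℝ (Fin n)}
    {C : ℝ} (h : ∀ i, |grad v x i| ≤ C) : slope v x ≤ Real.sqrt (1 + n * C ^ 2) := by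
  refine Real.sqrt_le_sqrt (add_le_add_right ?_ 1)
  calc ∑ i, grad v x i ^ 2 ≤ ∑ _i : Fin n, C ^ 2 :=
        Finset.sum_le_sum fun i _ => sq_le_sq' (abs_le.1 (h i)).1 (abs_le.1 (h i)).2
    _ = n * C ^ 2 := by simp

/-- The exit parameter is the infimum of the `r ≥ 0` for which `x + r • e` lies outside `Ω`. No
convexity of `Ω` is involved: only the segment up to the first exit is used. -/
theorem exists_exit {E : Type*} [NormedAddCommGroup E] [NormedSpace ℝ E] {Ω : Set E}
    (hΩ : IsOpen Ω) (hbdd : Bornology.IsBounded Ω) {x e : E} (hx : x ∈ Ω) (he : e ≠ 0) :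
    ∃ s : ℝ, 0 < s ∧ x + s • e ∈ frontier Ω ∧ ∀ r ∈ Set.Ico 0 s, x + r • e ∈ Ω := by
  have hcont : Continuous fun r : ℝ => x + r • e := by fun_prop
  set Z : Set ℝ := Set.Ici 0 ∩ (fun r : ℝ => x + r • e) ⁻¹' Ωᶜ with hZ
  have hclosed : IsClosed Z := isClosed_Ici.inter (hΩ.isClosed_compl.preimage hcont)
  have hne : Z.Nonempty := by
    obtain ⟨R, hR⟩ := hbdd.exists_norm_le
    have hR0 : 0 ≤ R := (norm_nonneg x).trans (hR x hx)
    have hen : 0 < ‖e‖ := norm_pos_iff.2 he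
    have hq : 0 ≤ (2 * R + 1) / ‖e‖ := by positivity
    refine ⟨(2 * R + 1) / ‖e‖, hq, fun hmem => ?_⟩
    have h1 := hR _ hmem
    have h2 : ‖((2 * R + 1) / ‖e‖) • e‖ = 2 * R + 1 := by
      rw [norm_smul, Real.norm_of_nonneg hq, div_mul_cancel₀ _ hen.ne']
    have h3 : ‖((2 * R + 1) / ‖e‖) • e‖ ≤ ‖x + ((2 * R + 1) / ‖e‖) • e‖ + ‖x‖ := by
      simpa using norm_sub_le (x + ((2 * R + 1) / ‖e‖) • e) x
    have h4 := hR x hx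
    linarith
  have hbelow : BddBelow Z := ⟨0, fun r hr => hr.1⟩
  have hmem := hclosed.csInf_mem hne hbelow
  have hin : ∀ r ∈ Set.Ico 0 (sInf Z), x + r • e ∈ Ω := by
    intro r hr
    by_contra hn
    exact (csInf_le hbelow (show r ∈ Z from ⟨hr.1, hn⟩)).not_gt hr.2
  have hpos : 0 < sInf Z := by
    rcases (show 0 ≤ sInf Z from hmem.1).eq_or_lt with h | h
    · have := hmem.2
      rw [← h] at this
      simp [hx] at this
    · exact h
  refine ⟨sInf Z, hpos, ⟨?_, fun h => hmem.2 (interior_subset h)⟩, hin⟩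
  have hcl : sInf Z ∈ closure (Set.Ico 0 (sInf Z)) := by
    rw [closure_Ico hpos.ne]; exact ⟨hpos.le, le_rfl⟩
  exact map_mem_closure (f := fun r : ℝ => x + r • e) hcont hcl hin

/-- A locally convex graph with controlled boundary slope has bounded gradient. -/
theorem mul_fderiv_le_of_strictlyConvex (hΩ : IsOpen Ω) (hbdd : Bornology.IsBounded Ω)
    {v : EuclideanSpace ℝ (Fin n) → ℝ} (hv2 : ∀ x ∈ Ω, ContDiffAt ℝ 2 v x)
    (hvc : ContinuousOn v (closure Ω)) (hconv : ∀ x ∈ Ω, StrictlyConvexAt v x)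
    {M R L : ℝ} (hL : 0 ≤ L) (hpos : ∀ x ∈ closure Ω, 0 < v x) (hM : ∀ x ∈ closure Ω, v x ≤ M)
    (hR : ∀ x ∈ closure Ω, ‖x‖ ≤ R)
    (hbdry : ∀ x ∈ Ω, ∀ e : EuclideanSpace ℝ (Fin n), ‖e‖ = 1 → ∀ s : ℝ, 0 < s →
      x + s • e ∈ frontier Ω → (∀ r ∈ Set.Ico 0 s, x + r • e ∈ Ω) →
      v (x + s • e) - v x ≤ L * s)
    {x : EuclideanSpace ℝ (Fin n)} (hx : x ∈ Ω) {e : EuclideanSpace ℝ (Fin n)} (he : ‖e‖ = 1) :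
    v x * fderiv ℝ v x e ≤ L * M + 2 * R := by
  obtain ⟨s, hs, hfr, hin⟩ := exists_exit hΩ hbdd hx (e := e) (by rintro rfl; simp at he)
  have hbd := hbdry x hx e he s hs hfr hin
  -- This is `v² + |·|²` along the ray. Its second derivative is twice the form `δ + Dv ⊗ Dv + v
  -- D²v` at `e`, so strict local convexity of the graph makes it convex.
  set θ : ℝ → ℝ := fun r => v (x + r • e) ^ 2 + (‖x‖ ^ 2 + 2 * r * inner ℝ x e + r ^ 2) with hθ
  set θ' : ℝ → ℝ := fun r =>
    2 * v (x + r • e) * fderiv ℝ v (x + r • e) e + (2 * inner ℝ x e + 2 * r) with hθ'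
  have hd1 : ∀ r ∈ Set.Ico 0 s, HasDerivAt (fun r : ℝ => v (x + r • e))
      (fderiv ℝ v (x + r • e) e) r := fun r hr =>
    ((hv2 _ (hin r hr)).differentiableAt (by simp)).hasFDerivAt.comp_hasDerivAt r
      (hasDerivAt_add_smul x e r)
  have hd2 : ∀ r ∈ Set.Ico 0 s, HasDerivAt (fun r : ℝ => fderiv ℝ v (x + r • e) e)
      (fderiv ℝ (fderiv ℝ v) (x + r • e) e e) r := fun r hr => by
    have h1 : DifferentiableAt ℝ (fderiv ℝ v) (x + r • e) :=
      ((hv2 _ (hin r hr)).fderiv_right (m := 1) (by norm_num)).differentiableAt (by simp)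
    have h2 : HasDerivAt (fun r : ℝ => fderiv ℝ v (x + r • e))
        (fderiv ℝ (fderiv ℝ v) (x + r • e) e) r :=
      h1.hasFDerivAt.comp_hasDerivAt r (hasDerivAt_add_smul x e r)
    simpa using h2.clm_apply (hasDerivAt_const r e)
  have hθd : ∀ r ∈ Set.Ico 0 s, HasDerivAt θ (θ' r) r := fun r hr => by
    have h := ((hd1 r hr).pow 2).add ((((hasDerivAt_id r).const_mul 2).mul_const
      (inner ℝ x e)).const_add (‖x‖ ^ 2) |>.add ((hasDerivAt_id r).pow 2))
    exact h.congr_deriv (by simp [hθ'])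
  have hθd2 : ∀ r ∈ Set.Ico 0 s, HasDerivAt θ'
      (2 * (fderiv ℝ v (x + r • e) e * fderiv ℝ v (x + r • e) e +
        v (x + r • e) * fderiv ℝ (fderiv ℝ v) (x + r • e) e e) + 2) r := fun r hr => by
    have h := (((hd1 r hr).const_mul 2).mul (hd2 r hr)).add
      (((hasDerivAt_id r).const_mul 2).const_add (2 * inner ℝ x e))
    exact h.congr_deriv (by ring)
  have hmono : MonotoneOn θ' (Set.Ico 0 s) := by
    refine monotoneOn_of_deriv_nonneg (convex_Ico 0 s)
      (fun r hr => (hθd2 r hr).continuousAt.continuousWithinAt)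
      (fun r hr => (hθd2 r (interior_subset hr)).differentiableAt.differentiableWithinAt)
      fun r hr => ?_
    rw [(hθd2 r (interior_subset hr)).deriv]
    have hc := (hconv _ (hin r (interior_subset hr))).posSemidef.dotProduct_mulVec_nonneg
      (WithLp.ofLp e)
    have h1 : fderiv ℝ v (x + r • e) e = grad v (x + r • e) ⬝ᵥ WithLp.ofLp e :=
      fderiv_toLp v (x + r • e) (WithLp.ofLp e)
    have h2 : fderiv ℝ (fderiv ℝ v) (x + r • e) e e =
      WithLp.ofLp e ⬝ᵥ (hess v (x + r • e) *ᵥ WithLp.ofLp e) :=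
      fderiv_fderiv_toLp v (x + r • e) (WithLp.ofLp e) (WithLp.ofLp e)
    have h3 : WithLp.ofLp e ⬝ᵥ WithLp.ofLp e = 1 := by
      have := EuclideanSpace.real_norm_sq_eq e
      rw [he] at this
      simp only [dotProduct, ← sq]
      linarith
    simp only [star_trivial, Matrix.add_mulVec, dotProduct_add, Matrix.one_mulVec,
      Matrix.smul_mulVec, dotProduct_smul, smul_eq_mul, h3, Matrix.vecMulVec_mulVec, ← h2] at hc
    rw [← h1] at hc
    have h4 : WithLp.ofLp e ⬝ᵥ grad v (x + r • e) = fderiv ℝ v (x + r • e) e := by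
      rw [h1, dotProduct_comm]
    simp only [MulOpposite.smul_eq_mul_unop, MulOpposite.unop_op, h4] at hc
    linarith
  have hcont : ContinuousOn θ (Set.Icc 0 s) := by
    have hmaps : Set.MapsTo (fun r : ℝ => x + r • e) (Set.Icc 0 s) (closure Ω) := by
      intro r hr
      rcases hr.2.eq_or_lt with h | h
      · rw [h]; exact hfr.1
      · exact subset_closure (hin r ⟨hr.1, h⟩)
    have h1 : ContinuousOn (fun r : ℝ => v (x + r • e)) (Set.Icc 0 s) :=
      hvc.comp (by fun_prop) hmaps
    exact (h1.pow 2).add (by fun_prop)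
  -- The mean value theorem needs only continuity at the boundary endpoint; monotonicity of `θ'`
  -- bounds `θ' 0` by the chord slope, which the boundary hypothesis controls.
  obtain ⟨ξ, hξ, hξe⟩ := exists_hasDerivAt_eq_slope θ θ' hs hcont
    fun r hr => hθd r ⟨hr.1.le, hr.2⟩
  have h0 : θ' 0 ≤ θ' ξ := hmono ⟨le_rfl, hs⟩ ⟨hξ.1.le, hξ.2⟩ hξ.1.le
  rw [hξe, sub_zero, le_div_iff₀ hs] at h0
  have hxc := subset_closure hx
  have hnorm : ‖x + s • e‖ ^ 2 = ‖x‖ ^ 2 + 2 * s * inner ℝ x e + s ^ 2 := by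
    rw [norm_add_sq_real, norm_smul, he, inner_smul_right, mul_one, Real.norm_of_nonneg hs.le]
    ring
  have hin1 : |inner ℝ x e| ≤ ‖x‖ := by
    have := abs_real_inner_le_norm x e
    rwa [he, mul_one] at this
  have hy := hR _ hfr.1
  have hxR := hR x hxc
  have hxn := norm_nonneg x
  have hyn := norm_nonneg (x + s • e)
  have htri : ‖x + s • e‖ ≤ ‖x‖ + s := by
    have := norm_add_le x (s • e)
    rwa [norm_smul, he, mul_one, Real.norm_of_nonneg hs.le] at this
  have hθs : θ s - θ 0 = (v (x + s • e) ^ 2 - v x ^ 2) + (‖x + s • e‖ ^ 2 - ‖x‖ ^ 2) := by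
    rw [hnorm]; simp [hθ]; ring
  have hθ0 : θ' 0 = 2 * v x * fderiv ℝ v x e + 2 * inner ℝ x e := by simp [hθ']
  have hA : v (x + s • e) ^ 2 - v x ^ 2 ≤ 2 * (L * M) * s := by
    have h1 := hpos x hxc
    have h2 := hM x hxc
    have h3 := hpos _ hfr.1
    have h4 := hM _ hfr.1
    have h5 : 0 ≤ L * s := by positivity
    calc v (x + s • e) ^ 2 - v x ^ 2 = (v (x + s • e) - v x) * (v (x + s • e) + v x) := by ring
      _ ≤ (L * s) * (v (x + s • e) + v x) := mul_le_mul_of_nonneg_right hbd (by linarith)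
      _ ≤ (L * s) * (2 * M) := mul_le_mul_of_nonneg_left (by linarith) h5
      _ = _ := by ring
  have hB : ‖x + s • e‖ ^ 2 - ‖x‖ ^ 2 ≤ 2 * R * s := by
    calc ‖x + s • e‖ ^ 2 - ‖x‖ ^ 2 = (‖x + s • e‖ - ‖x‖) * (‖x + s • e‖ + ‖x‖) := by ring
      _ ≤ s * (‖x + s • e‖ + ‖x‖) := mul_le_mul_of_nonneg_right (by linarith) (by linarith)
      _ ≤ s * (2 * R) := mul_le_mul_of_nonneg_left (by linarith) hs.le
      _ = _ := by ring
  rw [hθs, hθ0] at h0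
  have h1 : 2 * v x * fderiv ℝ v x e + 2 * inner ℝ x e ≤ 2 * (L * M) + 2 * R := by
    refine le_of_mul_le_mul_right ?_ hs
    linarith
  linarith [(abs_le.1 hin1).1]

end Solutions

/-! ### Comparison with lowered and slowed copies of the solution -/

section Monotone

variable {n : ℕ} {f : (Fin n → ℝ) → ℝ} {σ ε : ℝ} {T : EReal}
  {Ω : Set (EuclideanSpace ℝ (Fin n))} {u₀ : EuclideanSpace ℝ (Fin n) → ℝ}
  {u : EuclideanSpace ℝ (Fin n) → ℝ → ℝ}

theorem zero_mem_timeInterval {t : ℝ} (ht : t ∈ timeInterval T) : (0 : ℝ) ∈ timeInterval T :=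
  mem_timeInterval_of_le ht le_rfl ht.1

theorem IsInitialHeight.exists_fderiv_bound (hu₀ : IsInitialHeight Ω u₀)
    (hbdd : Bornology.IsBounded Ω) : ∃ L, 0 ≤ L ∧ ∀ x ∈ Ω, ‖fderiv ℝ u₀ x‖ ≤ L := by
  obtain ⟨L, hL⟩ := hu₀.lipschitz_fderiv
  rcases Ω.eq_empty_or_nonempty with rfl | ⟨x₀, hx₀⟩
  · exact ⟨0, le_rfl, by simp⟩
  obtain ⟨D, hD⟩ := Metric.isBounded_iff.1 hbdd
  refine ⟨‖fderiv ℝ u₀ x₀‖ + L * D, ?_, fun x hx => ?_⟩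
  · have := hD hx₀ hx₀
    rw [dist_self] at this
    positivity
  · have h1 := hL.dist_le_mul x hx x₀ hx₀
    rw [dist_eq_norm] at h1
    have h2 := norm_sub_norm_le (fderiv ℝ u₀ x) (fderiv ℝ u₀ x₀)
    have h3 : (L : ℝ) * dist x x₀ ≤ L * D := mul_le_mul_of_nonneg_left (hD hx hx₀) L.2
    linarith

theorem IsSolution.fderiv_initial (hu : IsSolution f σ ε T Ω u₀ u) (hΩ : IsOpen Ω)
    {x : EuclideanSpace ℝ (Fin n)} (hx : x ∈ Ω) :
    fderiv ℝ (fun y => u y 0) x = fderiv ℝ u₀ x := by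
  have h : (fun y => u y 0) =ᶠ[𝓝 x] fun y => u₀ y + ε := by
    filter_upwards [hΩ.mem_nhds hx] with y hy using hu.initial y hy
  rw [h.fderiv_eq, fderiv_add_const]

theorem slope_le_of_norm_fderiv_le {v : EuclideanSpace ℝ (Fin n) → ℝ}
    {x : EuclideanSpace ℝ (Fin n)} {C : ℝ} (h : ‖fderiv ℝ v x‖ ≤ C) :
    slope v x ≤ Real.sqrt (1 + n * C ^ 2) := by
  refine slope_le_of_grad_le fun i => ?_
  have := (fderiv ℝ v x).le_opNorm (EuclideanSpace.single i 1)
  simp only [PiLp.norm_single, norm_one, mul_one] at this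
  exact this.trans h

/-- An expanding admissible solution stays above its initial height. -/
theorem IsAdmissibleSolution.initial_le (hf : IsCurvatureFunction f)
    (hu : IsAdmissibleSolution f σ ε T Ω u₀ u) (hΩ : IsOpen Ω) (hbdd : Bornology.IsBounded Ω)
    (hu₀ : IsInitialHeight Ω u₀) (hσ : 0 < σ)
    (h0 : ∀ x ∈ Ω, σ < f (principalCurvatures (fun y => u y 0) x))
    {t : ℝ} (ht : t ∈ timeInterval T) {x : EuclideanSpace ℝ (Fin n)} (hx : x ∈ closure Ω) :
    u x 0 ≤ u x t := by
  have hs := hu.toIsSolution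
  have h0T := zero_mem_timeInterval ht
  obtain ⟨c, hc, M, hM, hb⟩ := hs.exists_bounds hbdd ht
  obtain ⟨L, hL, hLb⟩ := hu₀.exists_fderiv_bound hbdd
  set W := Real.sqrt (1 + n * L ^ 2)
  have hW : ∀ y ∈ Ω, slope (fun y => u y 0) y ≤ W := fun y hy =>
    slope_le_of_norm_fderiv_le (by rw [hs.fderiv_initial hΩ hy]; exact hLb y hy)
  -- Lowering by `q` costs at most `q w σ ≤ q σ W` in flow speed; letting `q` grow like `exp (K r)`
  -- pays for this, and the extra `1` makes the inequality strict.
  set K := σ * W + 1 with hK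
  have hK0 : 0 < K := by positivity
  have hlt : ∀ s : ℝ, 0 < s → s * Real.exp (K * t) < c →
      u x 0 - s * Real.exp (K * t) < u x t := by
    intro s hs0 hsc
    have hq : ∀ r ∈ Set.Icc 0 t, s * Real.exp (K * r) < c := fun r hr =>
      lt_of_le_of_lt (mul_le_mul_of_nonneg_left (Real.exp_le_exp.2
        (mul_le_mul_of_nonneg_left hr.2 hK0.le)) hs0.le) hsc
    have hq0 : ∀ r : ℝ, 0 < s * Real.exp (K * r) := fun r => by positivity
    have hIoc : ∀ r ∈ Set.Ioc 0 t, r ∈ Set.Icc 0 t := fun r hr => ⟨hr.1.le, hr.2⟩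
    have h0Icc : (0 : ℝ) ∈ Set.Icc 0 t := ⟨le_rfl, ht.1⟩
    -- The barrier is the initial graph lowered by `s * exp (K r)`. It lies strictly below `u` at
    -- time `0` and on the boundary, so nothing is required at the corner.
    refine hf.comparison hΩ hbdd (τ := t) (σ := σ) (a := u)
      (b := fun y r => u y 0 - s * Real.exp (K * r)) (hs.continuousOn_Icc ht) ?_ ?_ ?_
      (fun y hy r hr => contDiffAt_two_of_infty (hs.contDiffAt_slice hΩ hy
        (Icc_subset_timeInterval ht (hIoc r hr)))) ?_
      (fun y hy r hr => hs.hasDerivWithinAt_Iio hy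
        (Icc_subset_timeInterval ht (hIoc r hr)) hr.1) ?_ ?_ ?_ x hx t ⟨ht.1, le_rfl⟩
    · refine ContinuousOn.sub ?_ (by fun_prop)
      have : ContinuousOn (fun p : EuclideanSpace ℝ (Fin n) × ℝ => (p.1, (0 : ℝ)))
        (closure Ω ×ˢ Set.Icc 0 t) := by fun_prop
      exact (hs.continuousOn_Icc ht).comp this fun p hp => ⟨hp.1, h0Icc⟩
    · intro y _
      linarith [hq0 0]
    · intro y hy r hr
      rw [hs.boundary y hy 0 h0T, hs.boundary y hy r (Icc_subset_timeInterval ht hr)]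
      linarith [hq0 r]
    · exact fun y hy r hr => (contDiffAt_two_of_infty (hs.contDiffAt_slice hΩ hy h0T)).sub
        contDiffAt_const
    · intro y hy r hr
      have hd : HasDerivAt (fun r => u y 0 - s * Real.exp (K * r))
          (-(s * Real.exp (K * r) * K)) r := by
        have := (((hasDerivAt_id r).const_mul K).exp.const_mul s).const_sub (u y 0)
        exact this.congr_deriv (by simp [mul_assoc])
      refine ⟨_, hd.hasDerivWithinAt, ?_⟩
      have hcy := (hb y (subset_closure hy) 0 h0Icc).1
      have hqr := hq r (hIoc r hr)
      have hqr0 := hq0 r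
      have hgw : slope (fun z => u z 0 - s * Real.exp (K * r)) y = slope (fun z => u z 0) y :=
        slope_congr (by rw [grad_sub_const])
      have hsh := hf.principalCurvatures_sub_const (v := fun z => u z 0) (x := y)
        (contDiffAt_two_of_infty (hs.contDiffAt_slice hΩ hy h0T))
        (hu.strictlyConvex y hy 0 h0T) hqr0 (hqr.trans_le hcy)
      have hw := slope_pos (fun z => u z 0) y
      have hwW := hW y hy
      have hfy := h0 y hy
      rw [hgw]
      generalize s * Real.exp (K * r) = q at *
      generalize f (principalCurvatures (fun z => u z 0 - q) y) = φb at *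
      generalize f (principalCurvatures (fun z => u z 0) y) = φ at *
      generalize slope (fun z => u z 0) y = w at *
      have ha : 0 < u y 0 := hc.trans_le hcy
      generalize u y 0 = a at *
      have hfr : 0 ≤ (a - q) / a := div_nonneg (by linarith) ha.le
      -- Only the lower bound `σ < φ` on the initial curvature is used; `φ` itself may be unbounded
      -- near the boundary.
      have h1 : q / a + (a - q) / a * (w * σ) ≤ w * φb :=
        le_trans (by gcongr) hsh
      have h2 : q / a + (a - q) / a * (w * σ) - w * σ = q / a * (1 - w * σ) := by
        field_simp; ring
      have h3 : (a - q) * (q / a * (1 - w * σ)) ≤ (a - q) * w * (φb - σ) := by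
        have := mul_le_mul_of_nonneg_left (show q / a * (1 - w * σ) ≤ w * φb - w * σ by linarith)
          (show 0 ≤ a - q by linarith)
        linarith
      have h4 : (a - q) * (q / a * (1 - w * σ)) = (a - q) / a * (q * (1 - w * σ)) := by ring
      have h5 : (a - q) / a ≤ 1 := by rw [div_le_one ha]; linarith
      have h6 : -(q * (w * σ)) ≤ (a - q) / a * (q * (1 - w * σ)) := by
        have h7 : 0 ≤ q * (w * σ) := by positivity
        have h8 : 0 ≤ (a - q) / a * q := by positivity
        nlinarith
      have h9 : q * (w * σ) < q * K := by
        refine mul_lt_mul_of_pos_left ?_ hqr0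
        rw [hK, mul_comm w]
        have := mul_le_mul_of_nonneg_left hwW hσ.le
        linarith
      linarith
    · intro y hy r hr
      have hcy := (hb y (subset_closure hy) 0 h0Icc).1
      have := hq r (hIoc r hr)
      change 0 < u y 0 - _
      linarith
    · intro y hy r hr
      have hcy := (hb y (subset_closure hy) 0 h0Icc).1
      exact (hu.strictlyConvex y hy 0 h0T).sub_const (hq0 r)
        ((hq r (hIoc r hr)).trans_le hcy)
  have hlim : Filter.Tendsto (fun s : ℝ => u x 0 - s * Real.exp (K * t)) (𝓝[>] 0)
      (𝓝 (u x 0)) := by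
    have : Continuous fun s : ℝ => u x 0 - s * Real.exp (K * t) := by fun_prop
    have := (this.tendsto 0).mono_left (nhdsWithin_le_nhds (s := Set.Ioi (0 : ℝ)))
    simpa using this
  refine le_of_tendsto hlim ?_
  filter_upwards [Ioo_mem_nhdsGT (show (0 : ℝ) < c / Real.exp (K * t) by positivity)] with s hs'
  exact (hlt s hs'.1 ((lt_div_iff₀ (Real.exp_pos _)).1 hs'.2)).le

/-- The gradient of an expanding admissible solution is bounded on compact time intervals. -/
theorem IsAdmissibleSolution.exists_slope_bound (hf : IsCurvatureFunction f)
    (hu : IsAdmissibleSolution f σ ε T Ω u₀ u) (hΩ : IsOpen Ω) (hbdd : Bornology.IsBounded Ω)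
    (hu₀ : IsInitialHeight Ω u₀) (hσ : 0 < σ)
    (h0 : ∀ x ∈ Ω, σ < f (principalCurvatures (fun y => u y 0) x))
    {τ : ℝ} (hτ : τ ∈ timeInterval T) :
    ∃ W, ∀ x ∈ Ω, ∀ t ∈ Set.Icc 0 τ, slope (fun y => u y t) x ≤ W := by
  have hs := hu.toIsSolution
  have h0T := zero_mem_timeInterval hτ
  obtain ⟨c, hc, M, hM, hb⟩ := hs.exists_bounds hbdd hτ
  obtain ⟨L, hL, hLb⟩ := hu₀.exists_fderiv_bound hbdd
  obtain ⟨R, hR⟩ := hbdd.closure.exists_norm_le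
  refine ⟨Real.sqrt (1 + n * ((L * M + 2 * R) / c) ^ 2), fun x hx t ht => ?_⟩
  have htT := Icc_subset_timeInterval hτ ht
  have key : ∀ e : EuclideanSpace ℝ (Fin n), ‖e‖ = 1 →
      u x t * fderiv ℝ (fun y => u y t) x e ≤ L * M + 2 * R := by
    intro e he
    refine mul_fderiv_le_of_strictlyConvex hΩ hbdd (v := fun y => u y t)
      (fun y hy => contDiffAt_two_of_infty (hs.contDiffAt_slice hΩ hy htT)) ?_
      (fun y hy => hu.strictlyConvex y hy t htT) hL (fun y hy => hs.pos y hy t htT)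
      (fun y hy => (hb y hy t ht).2) hR ?_ hx he
    · have : ContinuousOn (fun y : EuclideanSpace ℝ (Fin n) => (y, t)) (closure Ω) := by fun_prop
      exact hs.continuousOn.comp this fun y hy => ⟨hy, htT⟩
    · intro y hy e he s hs0 hfr hin
      -- Since `u(·,t) ≥ u₀ + ε` with equality on the boundary, the rise of `u(·,t)` along a segment
      -- ending on the boundary is at most that of `u₀`.
      have h1 : u y 0 ≤ u y t := hu.initial_le hf hΩ hbdd hu₀ hσ h0 htT (subset_closure hy)
      rw [hs.initial y hy] at h1
      have h2 : ‖u₀ (y + s • e) - u₀ (y + (0 : ℝ) • e)‖ ≤ L * (s - 0) := by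
        refine norm_image_sub_le_of_norm_deriv_right_le_segment (f := fun r : ℝ => u₀ (y + r • e))
          (f' := fun r => fderiv ℝ u₀ (y + r • e) e) ?_ ?_ ?_ s ⟨hs0.le, le_rfl⟩
        · refine hu₀.continuousOn.comp (by fun_prop) fun r hr => ?_
          rcases hr.2.eq_or_lt with h | h
          · rw [h]; exact hfr.1
          · exact subset_closure (hin r ⟨hr.1, h⟩)
        · intro r hr
          have hd : HasFDerivAt u₀ (fderiv ℝ u₀ (y + r • e)) (y + r • e) :=
            ((hu₀.contDiffOn.contDiffAt (hΩ.mem_nhds (hin r hr))).differentiableAt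
              (by simp)).hasFDerivAt
          exact (hd.comp_hasDerivAt r (hasDerivAt_add_smul y e r)).hasDerivWithinAt
        · intro r hr
          have := (fderiv ℝ u₀ (y + r • e)).le_opNorm e
          rw [he, mul_one] at this
          exact this.trans (hLb _ (hin r hr))
      rw [zero_smul, add_zero, sub_zero, Real.norm_eq_abs, hu₀.zero_on_frontier _ hfr] at h2
      have h3 := (abs_le.1 h2).2
      have h4 := hs.boundary _ hfr t htT
      change u (y + s • e) t - u y t ≤ L * s
      linarith
  refine slope_le_of_grad_le fun i => ?_
  have hcx := (hb x (subset_closure hx) t ht).1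
  have hux : 0 < u x t := hc.trans_le hcx
  have hn1 : ‖(EuclideanSpace.single i (1 : ℝ) : EuclideanSpace ℝ (Fin n))‖ = 1 := by simp
  have k1 := key _ hn1
  have k2 := key (-EuclideanSpace.single i 1) (by rw [norm_neg, hn1])
  rw [map_neg] at k2
  change u x t * grad (fun y => u y t) x i ≤ _ at k1
  change u x t * -grad (fun y => u y t) x i ≤ _ at k2
  have k3 : u x t * |grad (fun y => u y t) x i| ≤ L * M + 2 * R := by
    rcases abs_cases (grad (fun y => u y t) x i) with h | h <;> rw [h.1] <;> assumption
  rw [le_div_iff₀ hc, mul_comm]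
  exact (mul_le_mul_of_nonneg_right hcx (abs_nonneg _)).trans k3

/-- Keeps the slowed clock in `IsAdmissibleSolution.mono_time` nonnegative. -/
theorem exp_sub_one_le {y : ℝ} : Real.exp y - 1 ≤ y * Real.exp y := by
  have h1 := Real.add_one_le_exp (-y)
  have h2 := mul_le_mul_of_nonneg_right h1 (Real.exp_pos y).le
  rw [← Real.exp_add, neg_add_cancel, Real.exp_zero] at h2
  linarith

/-- Lowering by `q` turns the term `a w φ` into at least `(a - q)² / a * w φ`, a loss proportional
to `φ`, for which no bound is available. Slowing time by the factor `1 - 2 q / c` absorbs it,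
because `(a - q)² / a ≥ a - 2 q ≥ a (1 - 2 q / c)`. Slowing costs at most `2 σ W M / c * q` in the
`σ` term, which `q K` covers with `q` to spare. -/
theorem dilation_arith {σ c M W K q a w φ φb : ℝ} (hσ : 0 < σ) (hc : 0 < c)
    (hqr0 : 0 < q) (hqr : q < c / 2) (hca : c ≤ a) (haM : a ≤ M) (hw : 0 < w) (hwW : w ≤ W)
    (hφ0 : 0 ≤ φ) (hsh : q / a + (a - q) / a * (w * φ) ≤ w * φb)
    (hK : K = 2 * σ * W * M / c + 1) :
    a * w * (φ - σ) * (1 - 2 * q / c) - q * K < (a - q) * w * (φb - σ) := by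
  have ha : 0 < a := hc.trans_le hca
  have h1 : (a - q) * (q / a + (a - q) / a * (w * φ)) ≤ (a - q) * (w * φb) :=
    mul_le_mul_of_nonneg_left hsh (by linarith)
  have h2 : 0 ≤ w * φ * ((a - q) ^ 2 / a - a + 2 * q * a / c) := by
    refine mul_nonneg (by positivity) ?_
    have e1 : (a - q) ^ 2 / a = a - 2 * q + q ^ 2 / a := by field_simp; ring
    have e2 : 2 * q ≤ 2 * q * a / c := by
      rw [le_div_iff₀ hc]
      exact mul_le_mul_of_nonneg_left hca (by linarith)
    have e3 : 0 ≤ q ^ 2 / a := by positivity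
    linarith
  have h3 : 0 ≤ (a - q) * (q / a) := mul_nonneg (by linarith) (by positivity)
  have h4 : w * σ * (2 * q * a / c) ≤ 2 * σ * W * M / c * q := by
    have hW : 0 ≤ W := hw.le.trans hwW
    calc w * σ * (2 * q * a / c) ≤ W * σ * (2 * q * M / c) := by gcongr
      _ = _ := by ring
  have h5 : 0 ≤ w * σ * q := by positivity
  have h6 : q * K = 2 * σ * W * M / c * q + q := by rw [hK]; ring
  have h7 : (a - q) * ((a - q) / a * (w * φ)) = w * φ * ((a - q) ^ 2 / a) := by ring
  have h8 : a * w * (φ - σ) * (1 - 2 * q / c) = w * φ * (a - 2 * q * a / c) - w * σ * a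
      + w * σ * (2 * q * a / c) := by ring
  linarith

set_option maxHeartbeats 1000000 in
/-- Expanding admissible solutions are nondecreasing in time. -/
theorem IsAdmissibleSolution.mono_time (hf : IsCurvatureFunction f)
    (hu : IsAdmissibleSolution f σ ε T Ω u₀ u) (hΩ : IsOpen Ω) (hbdd : Bornology.IsBounded Ω)
    (hu₀ : IsInitialHeight Ω u₀) (hσ : 0 < σ)
    (h0 : ∀ x ∈ Ω, σ < f (principalCurvatures (fun y => u y 0) x))
    {t h : ℝ} (ht0 : 0 ≤ t) (hh : 0 ≤ h) (hth : t + h ∈ timeInterval T)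
    {x : EuclideanSpace ℝ (Fin n)} (hx : x ∈ closure Ω) : u x t ≤ u x (t + h) := by
  have hs := hu.toIsSolution
  have ht : t ∈ timeInterval T := mem_timeInterval_of_le hth ht0 (by linarith)
  obtain ⟨c, hc, M, hM, hb⟩ := hs.exists_bounds hbdd ht
  obtain ⟨W', hW'⟩ := hu.exists_slope_bound hf hΩ hbdd hu₀ hσ h0 ht
  set W := max W' 0
  have hW : ∀ x ∈ Ω, ∀ t' ∈ Set.Icc 0 t, slope (fun y => u y t') x ≤ W := fun x hx t' ht' =>
    (hW' x hx t' ht').trans (le_max_left _ _)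
  have hW0 : 0 ≤ W := le_max_right _ _
  set K := 2 * σ * W * M / c + 1 with hK
  have hK0 : 0 < K := by positivity
  -- The slowed clock: chosen so that `θ s 0 = 0` and its derivative is `1 - 2 q / c` with `q = s *
  -- exp (K r)`.
  set θ : ℝ → ℝ → ℝ := fun s r => r - s * (2 / (c * K) * (Real.exp (K * r) - 1)) with hθ
  have hθc : ∀ s, Continuous (θ s) := fun s => by fun_prop
  have hlt : ∀ s : ℝ, 0 < s → s * Real.exp (K * t) < c / 2 →
      u x (θ s t) - s * Real.exp (K * t) < u x (t + h) := by
    intro s hs0 hsc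
    have hq : ∀ r ∈ Set.Icc 0 t, s * Real.exp (K * r) < c / 2 := fun r hr =>
      lt_of_le_of_lt (mul_le_mul_of_nonneg_left (Real.exp_le_exp.2
        (mul_le_mul_of_nonneg_left hr.2 hK0.le)) hs0.le) hsc
    have hq0 : ∀ r : ℝ, 0 < s * Real.exp (K * r) := fun r => by positivity
    have hIoc : ∀ r ∈ Set.Ioc 0 t, r ∈ Set.Icc 0 t := fun r hr => ⟨hr.1.le, hr.2⟩
    have hθm : ∀ r ∈ Set.Icc 0 t, θ s r ∈ Set.Icc 0 r := by
      intro r hr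
      have he1 : 1 ≤ Real.exp (K * r) := Real.one_le_exp (mul_nonneg hK0.le hr.1)
      have hck : 0 < c * K := by positivity
      constructor
      · have h1 := exp_sub_one_le (y := K * r)
        have h2 : s * (2 / (c * K) * (Real.exp (K * r) - 1)) ≤
            s * (2 / (c * K) * (K * r * Real.exp (K * r))) := by gcongr
        have h3 : s * (2 / (c * K) * (K * r * Real.exp (K * r))) =
            (s * Real.exp (K * r)) / (c / 2) * r := by field_simp
        have h4 : (s * Real.exp (K * r)) / (c / 2) ≤ 1 := by
          rw [div_le_one (by positivity)]; exact (hq r hr).le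
        have h5 := mul_le_mul_of_nonneg_right h4 hr.1
        simp only [hθ]
        linarith
      · have : 0 ≤ s * (2 / (c * K) * (Real.exp (K * r) - 1)) :=
          mul_nonneg hs0.le (mul_nonneg (by positivity) (by linarith))
        simp only [hθ]
        linarith
    have hθt : ∀ r ∈ Set.Icc 0 t, θ s r ∈ Set.Icc 0 t := fun r hr =>
      ⟨(hθm r hr).1, (hθm r hr).2.trans hr.2⟩
    have hθT : ∀ r ∈ Set.Icc 0 t, θ s r ∈ timeInterval T := fun r hr =>
      Icc_subset_timeInterval ht (hθt r hr)
    have hshift : ∀ r ∈ Set.Icc 0 t, r + h ∈ timeInterval T := fun r hr =>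
      mem_timeInterval_of_le hth (by linarith [hr.1]) (by linarith [hr.2])
    refine hf.comparison hΩ hbdd (τ := t) (σ := σ) (a := fun y r => u y (r + h))
      (b := fun y r => u y (θ s r) - s * Real.exp (K * r)) ?_ ?_ ?_ ?_
      (fun y hy r hr => contDiffAt_two_of_infty (hs.contDiffAt_slice hΩ hy
        (hshift r (hIoc r hr)))) ?_ ?_ ?_ ?_ ?_ x hx t ⟨ht.1, le_rfl⟩
    · have : ContinuousOn (fun p : EuclideanSpace ℝ (Fin n) × ℝ => (p.1, p.2 + h))
        (closure Ω ×ˢ Set.Icc 0 t) := by fun_prop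
      exact hs.continuousOn.comp this fun p hp => ⟨hp.1, hshift _ hp.2⟩
    · refine ContinuousOn.sub ?_ (by fun_prop)
      have : ContinuousOn (fun p : EuclideanSpace ℝ (Fin n) × ℝ => (p.1, θ s p.2))
        (closure Ω ×ˢ Set.Icc 0 t) :=
        (continuous_fst.prodMk ((hθc s).comp continuous_snd)).continuousOn
      exact hs.continuousOn.comp this fun p hp => ⟨hp.1, hθT _ hp.2⟩
    · intro y hy
      have h1 := hu.initial_le hf hΩ hbdd hu₀ hσ h0
        (mem_timeInterval_of_le hth hh (by linarith)) hy
      have h2 : θ s 0 = 0 := by simp [hθ]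
      have h3 := hq0 0
      change u y (θ s 0) - _ < u y (0 + h)
      rw [h2, zero_add]
      linarith
    · intro y hy r hr
      rw [hs.boundary y hy _ (hθT r hr), hs.boundary y hy _ (hshift r hr)]
      linarith [hq0 r]
    · exact fun y hy r hr => (contDiffAt_two_of_infty (hs.contDiffAt_slice hΩ hy
        (hθT r (hIoc r hr)))).sub contDiffAt_const
    · intro y hy r hr
      have h1 := hs.hasDerivWithinAt_Iio hy (hshift r (hIoc r hr)) (by linarith [hr.1])
      have h2 : HasDerivWithinAt (fun r => r + h) 1 (Set.Iio r) r :=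
        ((hasDerivAt_id r).add_const h).hasDerivWithinAt
      exact (HasDerivWithinAt.comp (h₂ := u y) (h := fun r => r + h) r h1 h2
        (fun z hz => add_lt_add_left hz h)).congr_deriv (mul_one _)
    · intro y hy r hr
      have hrI := hIoc r hr
      have hθd : HasDerivAt (θ s) (1 - 2 * (s * Real.exp (K * r)) / c) r := by
        have := (hasDerivAt_id r).sub ((((((hasDerivAt_id r).const_mul K).exp).sub_const
          1).const_mul (2 / (c * K))).const_mul s)
        refine this.congr_deriv ?_
        simp only [id, mul_one]
        field_simp
      -- The evolution equation is a derivative within the time interval, so the chain rule applies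
      -- without knowing that the clock shows a positive time.
      have hd1 := HasDerivWithinAt.comp (h₂ := u y) (h := θ s) r
        (hs.evolution y hy (θ s r) (hθT r hrI)) (hθd.hasDerivWithinAt (s := Set.Ioo 0 r))
        (fun z hz => hθT z ⟨hz.1.le, hz.2.le.trans hr.2⟩)
      have hd2 : HasDerivAt (fun r => s * Real.exp (K * r)) (s * Real.exp (K * r) * K) r := by
        have := (((hasDerivAt_id r).const_mul K).exp.const_mul s)
        exact this.congr_deriv (by simp [mul_assoc])
      refine ⟨_, (hd1.mono_of_mem_nhdsWithin (Ioo_mem_nhdsLT hr.1)).sub hd2.hasDerivWithinAt, ?_⟩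
      have hbb := hb y (subset_closure hy) (θ s r) (hθt r hrI)
      have hqr := hq r hrI
      have hqr0 := hq0 r
      have hgw : slope (fun z => u z (θ s r) - s * Real.exp (K * r)) y =
          slope (fun z => u z (θ s r)) y := slope_congr (by rw [grad_sub_const])
      have hsh := hf.principalCurvatures_sub_const (v := fun z => u z (θ s r)) (x := y)
        (contDiffAt_two_of_infty (hs.contDiffAt_slice hΩ hy (hθT r hrI)))
        (hu.strictlyConvex y hy _ (hθT r hrI)) hqr0 (by linarith [hbb.1])
      have hw := slope_pos (fun z => u z (θ s r)) y
      have hwW := hW y hy _ (hθt r hrI)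
      have hφ0 := hf.nonneg (hs.curvature_mem y hy _ (hθT r hrI))
      rw [hgw]
      exact dilation_arith hσ hc hqr0 hqr hbb.1 hbb.2 hw hwW hφ0 hsh hK
    · intro y hy r hr
      have hcy := (hb y (subset_closure hy) _ (hθt r (hIoc r hr))).1
      have := hq r (hIoc r hr)
      change 0 < u y _ - _
      linarith
    · intro y hy r hr
      have hcy := (hb y (subset_closure hy) _ (hθt r (hIoc r hr))).1
      exact (hu.strictlyConvex y hy _ (hθT r (hIoc r hr))).sub_const (hq0 r)
        (by linarith [hq r (hIoc r hr)])
  have hev : ∀ᶠ s in 𝓝[>] (0 : ℝ), 0 < s ∧ s * Real.exp (K * t) < c / 2 := by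
    filter_upwards [Ioo_mem_nhdsGT (show (0 : ℝ) < c / 2 / Real.exp (K * t) by positivity)]
      with s hs'
    exact ⟨hs'.1, (lt_div_iff₀ (Real.exp_pos _)).1 hs'.2⟩
  have hθlim : Filter.Tendsto (fun s => θ s t) (𝓝[>] 0) (𝓝[Set.Iic t] t) := by
    refine tendsto_nhdsWithin_iff.2 ⟨?_, ?_⟩
    · have : Continuous fun s => θ s t := by fun_prop
      have := (this.tendsto 0).mono_left (nhdsWithin_le_nhds (s := Set.Ioi (0 : ℝ)))
      simpa [hθ] using this
    · filter_upwards [self_mem_nhdsWithin] with s hs'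
      have he1 : 1 ≤ Real.exp (K * t) := Real.one_le_exp (mul_nonneg hK0.le ht0)
      have : 0 ≤ s * (2 / (c * K) * (Real.exp (K * t) - 1)) :=
        mul_nonneg (le_of_lt hs') (mul_nonneg (by positivity) (by linarith))
      simp only [hθ, Set.mem_Iic]
      linarith
  -- As `s → 0` the clock approaches `t` from the left, so the limit uses left continuity at a
  -- positive time; `t = 0` is the earlier comparison with the initial graph.
  rcases ht0.eq_or_lt with h00 | htpos
  · rw [← h00, zero_add]
    exact hu.initial_le hf hΩ hbdd hu₀ hσ h0 (by rwa [← h00, zero_add] at hth) hx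
  have hcx : ContinuousWithinAt (u x) (Set.Iic t) t := by
    have h1 : ContinuousWithinAt (u x) (Set.Icc 0 t) t := by
      have : ContinuousOn (fun r : ℝ => (x, r)) (Set.Icc 0 t) := by fun_prop
      exact (hs.continuousOn_Icc ht).comp this (fun r hr => ⟨hx, hr⟩) t ⟨ht0, le_rfl⟩
    exact h1.mono_of_mem_nhdsWithin (Icc_mem_nhdsLE htpos)
  have hlim : Filter.Tendsto (fun s : ℝ => u x (θ s t) - s * Real.exp (K * t)) (𝓝[>] 0)
      (𝓝 (u x t)) := by
    have h1 : Filter.Tendsto (fun s : ℝ => s * Real.exp (K * t)) (𝓝[>] 0) (𝓝 0) := by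
      have : Continuous fun s : ℝ => s * Real.exp (K * t) := by fun_prop
      have := (this.tendsto 0).mono_left (nhdsWithin_le_nhds (s := Set.Ioi (0 : ℝ)))
      simpa using this
    simpa using (hcx.tendsto.comp hθlim).sub h1
  refine le_of_tendsto hlim ?_
  filter_upwards [hev] with s hs' using (hlt s hs'.1 hs'.2).le

end Monotone

/-! ### Space-time derivatives -/

section DirDeriv

variable {P : Type*} [NormedAddCommGroup P] [NormedSpace ℝ P] {ψ χ : P → ℝ} {p a b : P}

/-- The directional derivative of a function along a constant vector. -/
def dirDeriv (a : P) (ψ : P → ℝ) (p : P) : ℝ := fderiv ℝ ψ p a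

theorem contDiffAt_dirDeriv (a : P) (h : ContDiffAt ℝ ∞ ψ p) :
    ContDiffAt ℝ ∞ (dirDeriv a ψ) p :=
  (h.fderiv_right (m := ∞) (by simp)).clm_apply contDiffAt_const

theorem differentiableAt_of_smooth (h : ContDiffAt ℝ ∞ ψ p) : DifferentiableAt ℝ ψ p :=
  h.differentiableAt (by simp)

/-- Smoothness in a neighbourhood of a point. -/
def SmoothNear (ψ : P → ℝ) (p : P) : Prop := ∀ᶠ q in 𝓝 p, ContDiffAt ℝ ∞ ψ q

namespace SmoothNear

theorem contDiffAt (h : SmoothNear ψ p) : ContDiffAt ℝ ∞ ψ p := h.self_of_nhds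

theorem differentiableAt (h : SmoothNear ψ p) : DifferentiableAt ℝ ψ p :=
  differentiableAt_of_smooth h.contDiffAt

theorem eventually (h : SmoothNear ψ p) : ∀ᶠ q in 𝓝 p, SmoothNear ψ q :=
  eventually_eventually_nhds.2 h

theorem dirDeriv (h : SmoothNear ψ p) (a : P) : SmoothNear (dirDeriv a ψ) p :=
  Filter.Eventually.mono h fun _ hq => contDiffAt_dirDeriv a hq

theorem add (hψ : SmoothNear ψ p) (hχ : SmoothNear χ p) :
    SmoothNear (fun q => ψ q + χ q) p := by
  filter_upwards [hψ, hχ] with q h1 h2 using h1.add h2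

theorem sub (hψ : SmoothNear ψ p) (hχ : SmoothNear χ p) :
    SmoothNear (fun q => ψ q - χ q) p := by
  filter_upwards [hψ, hχ] with q h1 h2 using h1.sub h2

theorem mul (hψ : SmoothNear ψ p) (hχ : SmoothNear χ p) :
    SmoothNear (fun q => ψ q * χ q) p := by
  filter_upwards [hψ, hχ] with q h1 h2 using h1.mul h2

theorem const (c : ℝ) : SmoothNear (fun _ : P => c) p :=
  Filter.Eventually.of_forall fun _ => contDiffAt_const

theorem sum {ι : Type*} {s : Finset ι} {ψ : ι → P → ℝ} (h : ∀ i ∈ s, SmoothNear (ψ i) p) :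
    SmoothNear (fun q => ∑ i ∈ s, ψ i q) p := by
  have : ∀ᶠ q in 𝓝 p, ∀ i ∈ s, ContDiffAt ℝ ∞ (ψ i) q := (Finset.eventually_all s).2 h
  filter_upwards [this] with q hq using ContDiffAt.sum hq

theorem sqrt (h : SmoothNear ψ p) (h0 : ∀ q, 0 < ψ q) :
    SmoothNear (fun q => Real.sqrt (ψ q)) p := by
  filter_upwards [h] with q hq using hq.sqrt (h0 q).ne'

theorem congr (h : SmoothNear ψ p) (he : χ =ᶠ[𝓝 p] ψ) : SmoothNear χ p := by
  filter_upwards [h, he.eventuallyEq_nhds] with q hq hq' using hq.congr_of_eventuallyEq hq'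

end SmoothNear

theorem dirDeriv_add (hψ : DifferentiableAt ℝ ψ p) (hχ : DifferentiableAt ℝ χ p) :
    dirDeriv a (fun q => ψ q + χ q) p = dirDeriv a ψ p + dirDeriv a χ p := by
  simp [dirDeriv, fderiv_fun_add hψ hχ]

theorem dirDeriv_sub (hψ : DifferentiableAt ℝ ψ p) (hχ : DifferentiableAt ℝ χ p) :
    dirDeriv a (fun q => ψ q - χ q) p = dirDeriv a ψ p - dirDeriv a χ p := by
  simp [dirDeriv, fderiv_fun_sub hψ hχ]

theorem dirDeriv_mul (hψ : DifferentiableAt ℝ ψ p) (hχ : DifferentiableAt ℝ χ p) :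
    dirDeriv a (fun q => ψ q * χ q) p = dirDeriv a ψ p * χ p + ψ p * dirDeriv a χ p := by
  simp [dirDeriv, fderiv_fun_mul hψ hχ]; ring

theorem dirDeriv_const (c : ℝ) : dirDeriv a (fun _ => c) p = 0 := by
  simp [dirDeriv]

theorem dirDeriv_congr (h : ψ =ᶠ[𝓝 p] χ) : dirDeriv a ψ p = dirDeriv a χ p := by
  simp [dirDeriv, h.fderiv_eq]

theorem dirDeriv_eventuallyEq (h : ψ =ᶠ[𝓝 p] χ) : dirDeriv a ψ =ᶠ[𝓝 p] dirDeriv a χ := by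
  filter_upwards [h.eventuallyEq_nhds] with q hq using dirDeriv_congr hq

theorem dirDeriv_dirDeriv (h : ContDiffAt ℝ ∞ ψ p) :
    dirDeriv a (dirDeriv b ψ) p = fderiv ℝ (fderiv ℝ ψ) p a b := by
  have h1 : DifferentiableAt ℝ (fderiv ℝ ψ) p :=
    (h.fderiv_right (m := ∞) (by simp)).differentiableAt (by simp)
  have h2 : HasFDerivAt (dirDeriv b ψ) _ p := h1.hasFDerivAt.clm_apply (hasFDerivAt_const b p)
  rw [dirDeriv, h2.fderiv]
  simp

theorem dirDeriv_comm (h : ContDiffAt ℝ ∞ ψ p) :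
    dirDeriv a (dirDeriv b ψ) p = dirDeriv b (dirDeriv a ψ) p := by
  rw [dirDeriv_dirDeriv h, dirDeriv_dirDeriv h]
  exact ((contDiffAt_infty.1 h 2).isSymmSndFDerivAt (by simp)).eq _ _

theorem hasDerivAt_line (h : DifferentiableAt ℝ ψ p) (a : P) :
    HasDerivAt (fun s : ℝ => ψ (p + s • a)) (dirDeriv a ψ p) 0 := by
  have h1 : HasFDerivAt ψ (fderiv ℝ ψ p) (p + (0 : ℝ) • a) := by simpa using h.hasFDerivAt
  exact h1.comp_hasDerivAt 0 (hasDerivAt_add_smul p a 0)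

end DirDeriv

/-! ### Derivatives of time slices as space-time directional derivatives -/

section Slices

variable {F : Type*} [NormedAddCommGroup F] [NormedSpace ℝ F] {u : F → ℝ → ℝ} {x e e' : F} {t : ℝ}

theorem fderiv_slice (h : DifferentiableAt ℝ (Function.uncurry u) (x, t)) :
    fderiv ℝ (fun y => u y t) x e = dirDeriv (e, 0) (Function.uncurry u) (x, t) := by
  have h1 : HasFDerivAt (fun y : F => (y, t)) (ContinuousLinearMap.inl ℝ F ℝ) x :=
    hasFDerivAt_prodMk_left x t
  have h2 := h.hasFDerivAt.comp x h1
  have h3 : fderiv ℝ (fun y => u y t) x =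
    (fderiv ℝ (Function.uncurry u) (x, t)).comp (ContinuousLinearMap.inl ℝ F ℝ) := h2.fderiv
  rw [h3]
  simp [dirDeriv]

theorem tendsto_slice {X : Type*} [TopologicalSpace X] (x : X) (t : ℝ) :
    Filter.Tendsto (fun y : X => (y, t)) (𝓝 x) (𝓝 (x, t)) :=
  (Continuous.prodMk_left t).tendsto x

theorem contDiffAt_slice_of_smooth (h : ContDiffAt ℝ ∞ (Function.uncurry u) (x, t)) :
    ContDiffAt ℝ ∞ (fun y => u y t) x :=
  ContDiffAt.comp (g := Function.uncurry u) (f := fun y => (y, t)) x h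
    (contDiffAt_id.prodMk contDiffAt_const)

theorem fderiv_fderiv_slice (h : SmoothNear (Function.uncurry u) (x, t)) :
    fderiv ℝ (fderiv ℝ fun y => u y t) x e e' =
      dirDeriv (e, 0) (dirDeriv (e', 0) (Function.uncurry u)) (x, t) := by
  have hs := contDiffAt_slice_of_smooth h.contDiffAt
  have h0 : fderiv ℝ (fderiv ℝ fun y => u y t) x e e' =
    dirDeriv e (dirDeriv e' fun y => u y t) x := (dirDeriv_dirDeriv hs).symm
  have h1 : (dirDeriv e' fun y => u y t) =ᶠ[𝓝 x]
      fun y => dirDeriv (e', 0) (Function.uncurry u) (y, t) := by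
    filter_upwards [(tendsto_slice x t).eventually h] with y hy
    exact fderiv_slice (differentiableAt_of_smooth hy)
  rw [h0, dirDeriv_congr h1]
  exact fderiv_slice (u := fun y t => dirDeriv (e', 0) (Function.uncurry u) (y, t))
    (h.dirDeriv _).differentiableAt

theorem deriv_time (h : DifferentiableAt ℝ (Function.uncurry u) (x, t)) :
    HasDerivAt (u x) (dirDeriv (0, 1) (Function.uncurry u) (x, t)) t := by
  have h1 : HasDerivAt (fun s : ℝ => (x, s)) ((0 : F), (1 : ℝ)) t :=
    (hasDerivAt_const t x).prodMk (hasDerivAt_id t)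
  exact h.hasFDerivAt.comp_hasDerivAt t h1

end Slices

/-! ### First variation of the curvature in a principal frame -/

section MatrixDeriv

variable {n : ℕ}

theorem hasDerivAt_mul_apply {X Y : ℝ → Matrix (Fin n) (Fin n) ℝ}
    {X' Y' : Matrix (Fin n) (Fin n) ℝ} {s : ℝ}
    (hX : ∀ i j, HasDerivAt (fun r => X r i j) (X' i j) s)
    (hY : ∀ i j, HasDerivAt (fun r => Y r i j) (Y' i j) s) (i j : Fin n) :
    HasDerivAt (fun r => (X r * Y r) i j) ((X' * Y s + X s * Y') i j) s := by
  simp only [Matrix.mul_apply, Matrix.add_apply, ← Finset.sum_add_distrib]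
  exact HasDerivAt.fun_sum fun k _ => (hX i k).mul (hY k j)

/-- Variation of the diagonal of `Γ A Γ` in an eigenbasis, where `Γ g Γ = 1`. -/
theorem hasDerivAt_diag_conj {G A g : ℝ → Matrix (Fin n) (Fin n) ℝ}
    {G' A' g' : Matrix (Fin n) (Fin n) ℝ}
    (hG : ∀ i j, HasDerivAt (fun r => G r i j) (G' i j) 0)
    (hA : ∀ i j, HasDerivAt (fun r => A r i j) (A' i j) 0)
    (hg : ∀ i j, HasDerivAt (fun r => g r i j) (g' i j) 0)
    (hsymm : (G 0)ᵀ = G 0) (hone : ∀ᶠ s in 𝓝 (0 : ℝ), G s * g s * G s = 1)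
    {Q : Matrix (Fin n) (Fin n) ℝ} (hQ : Qᵀ * Q = 1) {l : Fin n → ℝ}
    (hd : G 0 * A 0 * G 0 = Q * Matrix.diagonal l * Qᵀ) (i : Fin n) :
    HasDerivAt (fun s => (Qᵀ * (G s * A s * G s) * Q) i i)
      (((G 0 * Q)ᵀ * A' * (G 0 * Q)) i i - l i * ((G 0 * Q)ᵀ * g' * (G 0 * Q)) i i) 0 := by
  have h1 : G 0 * g 0 * G 0 = 1 := hone.self_of_nhds
  have hGAG := hasDerivAt_mul_apply (hasDerivAt_mul_apply hG hA) hG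
  have hGgG := hasDerivAt_mul_apply (hasDerivAt_mul_apply hG hg) hG
  -- Differentiating `Γ g Γ = 1` is what later eliminates the unknown derivative of `Γ`.
  have hzero : (G' * g 0 + G 0 * g') * G 0 + G 0 * g 0 * G' = 0 := by
    ext j k
    refine (hGgG j k).unique ((hasDerivAt_const (0 : ℝ)
      ((1 : Matrix (Fin n) (Fin n) ℝ) j k)).congr_of_eventuallyEq ?_)
    filter_upwards [hone] with s hs
    rw [hs]
  have hc : ∀ (C : Matrix (Fin n) (Fin n) ℝ) (j k : Fin n),
      HasDerivAt (fun _ : ℝ => C j k) ((0 : Matrix (Fin n) (Fin n) ℝ) j k) 0 :=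
    fun C j k => hasDerivAt_const _ _
  have hall := hasDerivAt_mul_apply (hasDerivAt_mul_apply (hc Qᵀ) hGAG) (hc Q) i i
  refine hall.congr_deriv ?_
  have e1 : g 0 * G 0 * G 0 = 1 := mul_eq_one_comm.1 (by rw [← Matrix.mul_assoc]; exact h1)
  have e2 : G 0 * (G 0 * g 0) = 1 := mul_eq_one_comm.1 h1
  -- The columns of `Γ Q` are eigenvectors of `A` relative to `g`; so both terms containing `G'`
  -- become `l i` times the corresponding terms of `hzero`.
  have e3 : A 0 * G 0 * Q = g 0 * G 0 * Q * Matrix.diagonal l := by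
    calc A 0 * G 0 * Q = (g 0 * G 0 * G 0) * (A 0 * G 0 * Q) := by rw [e1, Matrix.one_mul]
      _ = g 0 * G 0 * ((G 0 * A 0 * G 0) * Q) := by simp only [Matrix.mul_assoc]
      _ = g 0 * G 0 * (Q * Matrix.diagonal l * (Qᵀ * Q)) := by
        rw [hd]; simp only [Matrix.mul_assoc]
      _ = _ := by rw [hQ, Matrix.mul_one]; simp only [Matrix.mul_assoc]
  have e4 : Qᵀ * G 0 * A 0 = Matrix.diagonal l * (Qᵀ * G 0 * g 0) := by
    calc Qᵀ * G 0 * A 0 = (Qᵀ * G 0 * A 0) * (G 0 * (G 0 * g 0)) := by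
          rw [e2, Matrix.mul_one]
      _ = Qᵀ * (G 0 * A 0 * G 0) * (G 0 * g 0) := by simp only [Matrix.mul_assoc]
      _ = (Qᵀ * Q) * Matrix.diagonal l * Qᵀ * (G 0 * g 0) := by
        rw [hd]; simp only [Matrix.mul_assoc]
      _ = _ := by rw [hQ, Matrix.one_mul]; simp only [Matrix.mul_assoc]
  have e5 : Qᵀ * (G' * A 0 * G 0) * Q = (Qᵀ * G' * g 0 * G 0 * Q) * Matrix.diagonal l := by
    calc Qᵀ * (G' * A 0 * G 0) * Q = Qᵀ * G' * (A 0 * G 0 * Q) := by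
          simp only [Matrix.mul_assoc]
      _ = _ := by rw [e3]; simp only [Matrix.mul_assoc]
  have e6 : Qᵀ * (G 0 * A 0 * G') * Q = Matrix.diagonal l * (Qᵀ * G 0 * g 0 * G' * Q) := by
    calc Qᵀ * (G 0 * A 0 * G') * Q = (Qᵀ * G 0 * A 0) * G' * Q := by
          simp only [Matrix.mul_assoc]
      _ = _ := by rw [e4]; simp only [Matrix.mul_assoc]
  have e7 : Qᵀ * G' * g 0 * G 0 * Q + Qᵀ * G 0 * g 0 * G' * Q =
      -((G 0 * Q)ᵀ * g' * (G 0 * Q)) := by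
    have := congrArg (fun Z => Qᵀ * Z * Q) hzero
    simp only [Matrix.mul_add, Matrix.add_mul, Matrix.mul_zero, Matrix.zero_mul] at this
    rw [eq_neg_iff_add_eq_zero, ← this, Matrix.transpose_mul, hsymm]
    simp only [Matrix.mul_assoc]
    abel
  have e8 : (Qᵀ * G' * g 0 * G 0 * Q) i i + (Qᵀ * G 0 * g 0 * G' * Q) i i =
      -(((G 0 * Q)ᵀ * g' * (G 0 * Q)) i i) := congrFun (congrFun e7 i) i
  simp only [Matrix.zero_mul, Matrix.mul_zero, zero_add, Matrix.add_mul,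
    Matrix.mul_add, Matrix.add_apply, Matrix.zero_apply, add_zero]
  rw [e5, e6, Matrix.mul_diagonal, Matrix.diagonal_mul, Matrix.transpose_mul, hsymm]
  rw [Matrix.transpose_mul, hsymm] at e8
  have e9 : Qᵀ * (G 0 * A' * G 0) * Q = Qᵀ * G 0 * A' * (G 0 * Q) := by
    simp only [Matrix.mul_assoc]
  rw [e9]
  linear_combination l i * e8

end MatrixDeriv

/-! ### Principal frames and the first variation of `w f(κ)` -/

section Frame

variable {n : ℕ} {f : (Fin n → ℝ) → ℝ}

/-- The first fundamental form of the Euclidean graph as a function of space-time. -/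
def formG (ψ : EuclideanSpace ℝ (Fin n) × ℝ → ℝ) (e e' : EuclideanSpace ℝ (Fin n))
    (p : EuclideanSpace ℝ (Fin n) × ℝ) : ℝ :=
  inner ℝ e e' + dirDeriv (e, 0) ψ p * dirDeriv (e', 0) ψ p

/-- The bilinear form `δᵢⱼ + uᵢ uⱼ + u uᵢⱼ` as a function of space-time. -/
def formA (ψ : EuclideanSpace ℝ (Fin n) × ℝ → ℝ) (e e' : EuclideanSpace ℝ (Fin n))
    (p : EuclideanSpace ℝ (Fin n) × ℝ) : ℝ :=
  formG ψ e e' p + ψ p * dirDeriv (e, 0) (dirDeriv (e', 0) ψ) p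

theorem smoothNear_formG {ψ : EuclideanSpace ℝ (Fin n) × ℝ → ℝ}
    {p : EuclideanSpace ℝ (Fin n) × ℝ} (h : SmoothNear ψ p) (e e' : EuclideanSpace ℝ (Fin n)) :
    SmoothNear (formG ψ e e') p :=
  (SmoothNear.const _).add ((h.dirDeriv _).mul (h.dirDeriv _))

theorem smoothNear_formA {ψ : EuclideanSpace ℝ (Fin n) × ℝ → ℝ}
    {p : EuclideanSpace ℝ (Fin n) × ℝ} (h : SmoothNear ψ p) (e e' : EuclideanSpace ℝ (Fin n)) :
    SmoothNear (formA ψ e e') p :=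
  (smoothNear_formG h e e').add (h.mul ((h.dirDeriv _).dirDeriv _))

variable {u : EuclideanSpace ℝ (Fin n) → ℝ → ℝ}

theorem inner_toLp (y z : Fin n → ℝ) :
    inner ℝ (WithLp.toLp 2 y) (WithLp.toLp 2 z) = y ⬝ᵥ z := by
  rw [EuclideanSpace.inner_toLp_toLp, star_trivial, dotProduct_comm]

theorem dot_metric (p : EuclideanSpace ℝ (Fin n) × ℝ)
    (h : SmoothNear (Function.uncurry u) p) (y z : Fin n → ℝ) :
    y ⬝ᵥ ((1 + Matrix.vecMulVec (grad (fun y => u y p.2) p.1) (grad (fun y => u y p.2) p.1)) *ᵥ z)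
      = formG (Function.uncurry u) (WithLp.toLp 2 y) (WithLp.toLp 2 z) p := by
  have h1 := fun y => fderiv_slice (u := u) (x := p.1) (t := p.2) (e := WithLp.toLp 2 y)
    h.differentiableAt
  rw [formG, ← h1, ← h1, fderiv_toLp, fderiv_toLp, inner_toLp, Matrix.add_mulVec,
    Matrix.one_mulVec, dotProduct_add, Matrix.vecMulVec_mulVec, dotProduct_smul,
    dotProduct_comm y (grad _ _)]
  simp

theorem dot_convexForm (p : EuclideanSpace ℝ (Fin n) × ℝ)
    (h : SmoothNear (Function.uncurry u) p) (y z : Fin n → ℝ) :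
    y ⬝ᵥ (convexForm (fun y => u y p.2) p.1 *ᵥ z)
      = formA (Function.uncurry u) (WithLp.toLp 2 y) (WithLp.toLp 2 z) p := by
  have h2 := fderiv_fderiv_slice (u := u) (x := p.1) (t := p.2) (e := WithLp.toLp 2 y)
    (e' := WithLp.toLp 2 z) h
  rw [formA, ← dot_metric p h, ← h2, fderiv_fderiv_toLp, convexForm, Matrix.add_mulVec,
    dotProduct_add, Matrix.smul_mulVec, dotProduct_smul]
  rfl

theorem grad_slice (p : EuclideanSpace ℝ (Fin n) × ℝ)
    (h : SmoothNear (Function.uncurry u) p) (i : Fin n) :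
    grad (fun y => u y p.2) p.1 i =
      dirDeriv (EuclideanSpace.single i 1, 0) (Function.uncurry u) p :=
  fderiv_slice (u := u) (x := p.1) (t := p.2) h.differentiableAt

/-- The slope `w` as a function of space-time. -/
def stSlope (u : EuclideanSpace ℝ (Fin n) → ℝ → ℝ) (p : EuclideanSpace ℝ (Fin n) × ℝ) : ℝ :=
  slope (fun y => u y p.2) p.1

theorem smoothNear_stSlope {p : EuclideanSpace ℝ (Fin n) × ℝ}
    (h : SmoothNear (Function.uncurry u) p) : SmoothNear (stSlope u) p := by
  have h1 : SmoothNear (fun q => Real.sqrt (1 + ∑ i,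
      dirDeriv (EuclideanSpace.single i 1, 0) (Function.uncurry u) q *
      dirDeriv (EuclideanSpace.single i 1, 0) (Function.uncurry u) q)) p :=
    ((SmoothNear.const 1).add (SmoothNear.sum fun i _ => (h.dirDeriv _).mul (h.dirDeriv _))).sqrt
      fun q => add_pos_of_pos_of_nonneg one_pos (Finset.sum_nonneg fun i _ => mul_self_nonneg _)
  refine h1.congr ?_
  filter_upwards [h.eventually] with q hq
  simp only [stSlope, slope, grad_slice q hq, sq]

/-- Principal frame of the graph at a space-time point, with `B = w f(κ)` and its first
variation. Here `l = w κ` and `φ` is the gradient of `f`. -/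
structure IsPrincipalFrame (f : (Fin n → ℝ) → ℝ) (ψ B : EuclideanSpace ℝ (Fin n) × ℝ → ℝ)
    (p : EuclideanSpace ℝ (Fin n) × ℝ) (e : Fin n → EuclideanSpace ℝ (Fin n))
    (l φ : Fin n → ℝ) : Prop where
  mem : l ∈ posCone n
  partial_eq : ∀ i, φ i = fderiv ℝ f l (Pi.single i 1)
  metric : ∀ i, formG ψ (e i) (e i) p = 1
  expand : ∀ y, y = ∑ i, formG ψ (e i) y p • e i
  eigen : ∀ i y, formA ψ (e i) y p = l i * formG ψ (e i) y p
  value : B p = f l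
  variation : ∀ a, dirDeriv a B p = ∑ i, φ i *
    (dirDeriv a (formA ψ (e i) (e i)) p - l i * dirDeriv a (formG ψ (e i) (e i)) p)

/-- Only differentiability matters here: the derivative of `γ` drops out in `hasDerivAt_diag_conj`,
so it need not be computed. -/
theorem differentiableAt_gam_line {p : EuclideanSpace ℝ (Fin n) × ℝ}
    (h : SmoothNear (Function.uncurry u) p) (a : EuclideanSpace ℝ (Fin n) × ℝ) (i j : Fin n) :
    DifferentiableAt ℝ (fun s : ℝ => gam (fun y => u y (p + s • a).2) (p + s • a).1 i j) 0 := by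
  have ht : Filter.Tendsto (fun s : ℝ => p + s • a) (𝓝 0) (𝓝 p) := by
    have := (hasDerivAt_add_smul p a 0).continuousAt.tendsto
    simpa using this
  have hw := (hasDerivAt_line (smoothNear_stSlope h).differentiableAt a).differentiableAt
  have hz : ∀ i, DifferentiableAt ℝ (fun s : ℝ => dirDeriv (EuclideanSpace.single i 1, 0)
      (Function.uncurry u) (p + s • a)) 0 := fun i =>
    (hasDerivAt_line (h.dirDeriv _).differentiableAt a).differentiableAt
  have hne : stSlope u (p + (0 : ℝ) • a) * (1 + stSlope u (p + (0 : ℝ) • a)) ≠ 0 := by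
    have : 0 < stSlope u (p + (0 : ℝ) • a) := slope_pos _ _
    positivity
  have hd := (((hw.mul (hw.const_add 1)).inv hne).mul ((hz i).mul (hz j))).const_sub
    ((1 : Matrix (Fin n) (Fin n) ℝ) i j)
  refine hd.congr_of_eventuallyEq ?_
  filter_upwards [ht.eventually h.eventually] with s hs
  simp only [gam, Matrix.sub_apply, Matrix.smul_apply, smul_eq_mul, Matrix.vecMulVec_apply,
    grad_slice _ hs]
  rfl

theorem entry_eq_dot (M : Matrix (Fin n) (Fin n) ℝ) (i j : Fin n) :
    M i j = Pi.single i 1 ⬝ᵥ (M *ᵥ Pi.single j 1) := by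
  simp

theorem conj_apply_eq_dot (N M : Matrix (Fin n) (Fin n) ℝ) (i j : Fin n) :
    (Nᵀ * M * N) i j = Nᵀ i ⬝ᵥ (M *ᵥ Nᵀ j) := by
  rw [Matrix.mul_assoc]
  rfl

theorem eventually_line {P : Type*} [NormedAddCommGroup P] [NormedSpace ℝ P] {q : P → Prop}
    {p : P} (h : ∀ᶠ y in 𝓝 p, q y) (a : P) : ∀ᶠ s : ℝ in 𝓝 0, q (p + s • a) := by
  have := (hasDerivAt_add_smul p a 0).continuousAt.tendsto
  rw [zero_smul, add_zero] at this
  exact this.eventually h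

/-- Fix an orthonormal basis `Q` that diagonalises the curvature matrix at `p`. Near `p`, `f` of the
diagonal of `w` times the curvature matrix in this basis is at least `B`, with equality at `p`. Both
sides are differentiable along lines through `p`, so their derivatives agree at `p`; multiple
eigenvalues cause no trouble. -/
theorem IsCurvatureFunction.exists_principalFrame (hf : IsCurvatureFunction f)
    {B : EuclideanSpace ℝ (Fin n) × ℝ → ℝ} {p : EuclideanSpace ℝ (Fin n) × ℝ}
    (h : SmoothNear (Function.uncurry u) p) (hpos : ∀ᶠ q in 𝓝 p, 0 < Function.uncurry u q)
    (hB : DifferentiableAt ℝ B p)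
    (hBeq : ∀ᶠ q in 𝓝 p, B q =
      stSlope u q * f (principalCurvatures (fun y => u y q.2) q.1))
    (hcl : ∀ᶠ q in 𝓝 p, principalCurvatures (fun y => u y q.2) q.1 ∈ closure (posCone n))
    (hp : principalCurvatures (fun y => u y p.2) p.1 ∈ posCone n) :
    ∃ e l φ, IsPrincipalFrame f (Function.uncurry u) B p e l φ := by
  have hC2 : ∀ q, SmoothNear (Function.uncurry u) q → ContDiffAt ℝ 2 (fun y => u y q.2) q.1 :=
    fun q hq => contDiffAt_two_of_infty (contDiffAt_slice_of_smooth hq.contDiffAt)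
  have hp0 : 0 < u p.1 p.2 := hpos.self_of_nhds
  have hherm := curvMatrix_isHermitian (fun y => u y p.2) p.1 hp0 (hC2 p h)
  have hκ := principalCurvatures_eq (v := fun y => u y p.2) hp0 (hC2 p h)
  obtain ⟨Q, hQ, hQ', hdiag⟩ := exists_diagonalization hherm
  rw [← hκ] at hdiag
  set κ := principalCurvatures (fun y => u y p.2) p.1
  have hw : 0 < stSlope u p := slope_pos _ _
  set l : Fin n → ℝ := stSlope u p • κ with hl
  have hlmem : l ∈ posCone n := smul_mem_posCone hp hw
  set Γ := fun q : EuclideanSpace ℝ (Fin n) × ℝ => gam (fun y => u y q.2) q.1 with hΓ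
  set A := fun q : EuclideanSpace ℝ (Fin n) × ℝ => convexForm (fun y => u y q.2) q.1 with hA
  set g := fun q : EuclideanSpace ℝ (Fin n) × ℝ =>
    1 + Matrix.vecMulVec (grad (fun y => u y q.2) q.1) (grad (fun y => u y q.2) q.1) with hg
  have hΓsymm : ∀ q, (Γ q)ᵀ = Γ q := fun q => gam_transpose _ _
  have hone : ∀ q, Γ q * g q * Γ q = 1 := fun q => gam_sandwich _ _
  have hCeq : ∀ q, 0 < Function.uncurry u q →
      Γ q * A q * Γ q = stSlope u q • curvMatrix (fun y => u y q.2) q.1 := by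
    intro q hq
    rw [stSlope, curvMatrix_eq_conj (v := fun y => u y q.2) hq, smul_smul,
      mul_inv_cancel₀ (slope_pos _ _).ne', one_smul]
  have hconj : Γ p * A p * Γ p = Q * Matrix.diagonal l * Qᵀ := by
    rw [hCeq p hp0, hdiag, hl]
    have : Matrix.diagonal (stSlope u p • κ) = stSlope u p • Matrix.diagonal κ := by
      rw [Matrix.diagonal_smul]
    rw [this, mul_smul_comm, smul_mul_assoc]
  -- The frame vectors are the columns of `N`: orthonormal for the Euclidean induced metric `g`, and
  -- principal for `A` with eigenvalues `l = w κ`.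
  set N := Γ p * Q with hN
  have hNt : Nᵀ = Qᵀ * Γ p := by rw [hN, Matrix.transpose_mul, hΓsymm]
  have hNg : Nᵀ * g p * N = 1 := by
    calc Nᵀ * g p * N = Qᵀ * (Γ p * g p * Γ p) * Q := by
          rw [hNt, hN]; simp only [Matrix.mul_assoc]
      _ = 1 := by rw [hone, Matrix.mul_one, hQ]
  have hNA : Nᵀ * A p = Matrix.diagonal l * (Nᵀ * g p) := by
    have e2 : Γ p * (Γ p * g p) = 1 := mul_eq_one_comm.1 (hone p)
    calc Nᵀ * A p = (Qᵀ * Γ p * A p) * (Γ p * (Γ p * g p)) := by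
          rw [e2, Matrix.mul_one, hNt]
      _ = Qᵀ * (Γ p * A p * Γ p) * (Γ p * g p) := by simp only [Matrix.mul_assoc]
      _ = (Qᵀ * Q) * Matrix.diagonal l * Qᵀ * (Γ p * g p) := by
        rw [hconj]; simp only [Matrix.mul_assoc]
      _ = _ := by rw [hQ, Matrix.one_mul, hNt]; simp only [Matrix.mul_assoc]
  have hNN : N * (Nᵀ * g p) = 1 := by
    calc N * (Nᵀ * g p) = Γ p * (Q * Qᵀ) * (Γ p * g p) := by
          rw [hNt, hN]; simp only [Matrix.mul_assoc]
      _ = 1 := by rw [hQ', Matrix.mul_one]; exact mul_eq_one_comm.1 (hone p)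
  refine ⟨fun i => WithLp.toLp 2 (Nᵀ i), l, fun i => fderiv ℝ f l (Pi.single i 1),
    hlmem, fun i => rfl, fun i => ?_, fun y => ?_, fun i y => ?_, ?_, fun a => ?_⟩
  · rw [← dot_metric p h, ← conj_apply_eq_dot]
    change (Nᵀ * g p * N) i i = 1
    rw [hNg, Matrix.one_apply_eq]
  · have e1 : ∀ i, formG (Function.uncurry u) (WithLp.toLp 2 (Nᵀ i)) y p =
        ((Nᵀ * g p) *ᵥ WithLp.ofLp y) i := by
      intro i
      have := dot_metric p h (Nᵀ i) (WithLp.ofLp y)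
      rw [WithLp.toLp_ofLp] at this
      rw [← this, ← Matrix.mulVec_mulVec]
      rfl
    have e2 : N *ᵥ ((Nᵀ * g p) *ᵥ WithLp.ofLp y) = WithLp.ofLp y := by
      rw [Matrix.mulVec_mulVec, hNN, Matrix.one_mulVec]
    ext j
    have e3 := congrFun e2 j
    rw [← e3]
    simp only [e1, WithLp.ofLp_sum, WithLp.ofLp_smul, Finset.sum_apply, Pi.smul_apply,
      smul_eq_mul]
    simp only [Matrix.mulVec, dotProduct, Matrix.transpose_apply]
    exact Finset.sum_congr rfl fun i _ => mul_comm _ _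
  · have e1 := dot_metric p h (Nᵀ i) (WithLp.ofLp y)
    have e2 := dot_convexForm p h (Nᵀ i) (WithLp.ofLp y)
    rw [WithLp.toLp_ofLp] at e1 e2
    rw [← e1, ← e2]
    have e3 : (Nᵀ *ᵥ (A p *ᵥ WithLp.ofLp y)) i =
        (Matrix.diagonal l *ᵥ (Nᵀ *ᵥ (g p *ᵥ WithLp.ofLp y))) i := by
      rw [Matrix.mulVec_mulVec, hNA, Matrix.mulVec_mulVec, Matrix.mulVec_mulVec, Matrix.mul_assoc]
    rw [Matrix.mulVec_diagonal] at e3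
    exact e3
  · rw [hBeq.self_of_nhds, hl, hf.homogeneous κ hp _ hw]
  · have hG := fun i j => (differentiableAt_gam_line h a i j).hasDerivAt
    have hAd := fun i j => hasDerivAt_line (smoothNear_formA h (WithLp.toLp 2 (Pi.single i 1))
      (WithLp.toLp 2 (Pi.single j 1))).differentiableAt a
    have hgd := fun i j => hasDerivAt_line (smoothNear_formG h (WithLp.toLp 2 (Pi.single i 1))
      (WithLp.toLp 2 (Pi.single j 1))).differentiableAt a
    have hev := eventually_line h.eventually a
    have hAe : ∀ i j, HasDerivAt (fun s : ℝ => A (p + s • a) i j) _ 0 := fun i j =>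
      (hAd i j).congr_of_eventuallyEq (by
        filter_upwards [hev] with s hs
        exact (entry_eq_dot (A (p + s • a)) i j).trans (dot_convexForm _ hs _ _))
    have hge : ∀ i j, HasDerivAt (fun s : ℝ => g (p + s • a) i j) _ 0 := fun i j =>
      (hgd i j).congr_of_eventuallyEq (by
        filter_upwards [hev] with s hs
        exact (entry_eq_dot (g (p + s • a)) i j).trans (dot_metric _ hs _ _))
    have hz : p + (0 : ℝ) • a = p := by simp
    set A' : Matrix (Fin n) (Fin n) ℝ := Matrix.of fun i j =>
      dirDeriv a (formA (Function.uncurry u) (WithLp.toLp 2 (Pi.single i 1))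
        (WithLp.toLp 2 (Pi.single j 1))) p
    set g' : Matrix (Fin n) (Fin n) ℝ := Matrix.of fun i j =>
      dirDeriv a (formG (Function.uncurry u) (WithLp.toLp 2 (Pi.single i 1))
        (WithLp.toLp 2 (Pi.single j 1))) p
    have hvar := hasDerivAt_diag_conj (G := fun s => Γ (p + s • a)) (A := fun s => A (p + s • a))
      (g := fun s => g (p + s • a)) (G' := Matrix.of fun i j => _)
      (A' := A') (g' := g') hG hAe hge
      (hΓsymm _) (Filter.Eventually.of_forall fun s => hone _) hQ (l := l)
      (by rw [hz]; exact hconj)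
    have hquad : ∀ {M : ℝ → Matrix (Fin n) (Fin n) ℝ} {M' : Matrix (Fin n) (Fin n) ℝ},
        (∀ i j, HasDerivAt (fun s => M s i j) (M' i j) 0) → ∀ i,
        HasDerivAt (fun s => (Nᵀ * M s * N) i i) ((Nᵀ * M' * N) i i) 0 := by
      intro M M' hM i
      have hc : ∀ (C : Matrix (Fin n) (Fin n) ℝ) (j k : Fin n),
          HasDerivAt (fun _ : ℝ => C j k) ((0 : Matrix (Fin n) (Fin n) ℝ) j k) 0 :=
        fun C j k => hasDerivAt_const _ _
      refine (hasDerivAt_mul_apply (hasDerivAt_mul_apply (hc Nᵀ) hM) (hc N) i i).congr_deriv ?_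
      simp
    have hA1 : ∀ i, dirDeriv a (formA (Function.uncurry u) (WithLp.toLp 2 (Nᵀ i))
        (WithLp.toLp 2 (Nᵀ i))) p = (Nᵀ * A' * N) i i := fun i =>
      (hasDerivAt_line (smoothNear_formA h _ _).differentiableAt a).unique
        ((hquad (M' := A') hAe i).congr_of_eventuallyEq (by
          filter_upwards [hev] with s hs
          rw [conj_apply_eq_dot]
          exact (dot_convexForm _ hs _ _).symm))
    have hg1 : ∀ i, dirDeriv a (formG (Function.uncurry u) (WithLp.toLp 2 (Nᵀ i))
        (WithLp.toLp 2 (Nᵀ i))) p = (Nᵀ * g' * N) i i := fun i =>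
      (hasDerivAt_line (smoothNear_formG h _ _).differentiableAt a).unique
        ((hquad (M' := g') hge i).congr_of_eventuallyEq (by
          filter_upwards [hev] with s hs
          rw [conj_apply_eq_dot]
          exact (dot_metric _ hs _ _).symm))
    simp only [hz, ← hN, ← hA1, ← hg1] at hvar
    set m : ℝ → Fin n → ℝ := fun s i => (Qᵀ * (Γ (p + s • a) * A (p + s • a) *
      Γ (p + s • a)) * Q) i i with hm
    have hmd : HasDerivAt m _ 0 := hasDerivAt_pi.2 hvar
    have hm0 : m 0 = l := by
      funext i
      simp only [hm, hz, hconj]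
      rw [show Qᵀ * (Q * Matrix.diagonal l * Qᵀ) * Q =
        (Qᵀ * Q) * Matrix.diagonal l * (Qᵀ * Q) by simp only [Matrix.mul_assoc], hQ,
        Matrix.one_mul, Matrix.mul_one, Matrix.diagonal_apply_eq]
    have hfd : HasFDerivAt f (fderiv ℝ f l) (m 0) := by rw [hm0]; exact hf.hasFDerivAt hlmem
    have hd := (hfd.comp_hasDerivAt 0 hmd).sub (hasDerivAt_line hB a)
    -- Schur's inequality along the line, with equality at `s = 0`.
    have hmin : IsLocalMin (fun s : ℝ => f (m s) - B (p + s • a)) 0 := by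
      have hmem : ∀ᶠ s in 𝓝 (0 : ℝ), m s ∈ posCone n :=
        hmd.continuousAt.eventually (isOpen_posCone.mem_nhds (by rw [hm0]; exact hlmem))
      filter_upwards [hmem, hev, eventually_line hpos a, eventually_line hBeq a,
        eventually_line hcl a] with s h1 h2 h3 h4 h5
      have hB0 : B p = f l := by
        rw [hBeq.self_of_nhds, hl, hf.homogeneous κ hp _ hw]
      rw [hm0, hz, hB0, sub_self, sub_nonneg, h4]
      set κs := principalCurvatures (fun y => u y (p + s • a).2) (p + s • a).1 with hκs
      have hws : 0 < stSlope u (p + s • a) := slope_pos _ _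
      by_cases hk : κs ∈ posCone n
      · have hks := principalCurvatures_eq (v := fun y => u y (p + s • a).2) h3
          (hC2 _ h2)
        have hle := hf.eigenvalues_le_diag (curvMatrix_isHermitian _ _ h3 (hC2 _ h2))
          (by rw [← hks]; exact hk) hQ
        rw [← hks] at hle
        have hmeq : m s = stSlope u (p + s • a) • fun i => (Qᵀ *
            curvMatrix (fun y => u y (p + s • a).2) (p + s • a).1 * Q) i i := by
          funext i
          simp only [hm]
          rw [hCeq _ h3, mul_smul_comm, smul_mul_assoc]
          rfl
        have hdm : (fun i => (Qᵀ * curvMatrix (fun y => u y (p + s • a).2)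
            (p + s • a).1 * Q) i i) ∈ posCone n := by
          intro i
          have := h1 i
          rw [hmeq] at this
          exact pos_of_mul_pos_right this hws.le
        rw [hmeq, hf.homogeneous _ hdm _ hws]
        exact mul_le_mul_of_nonneg_left hle hws.le
      -- The nearby curvatures are only known to lie in the closed cone; on its boundary `B = 0` and
      -- the inequality is trivial.
      · have : f κs = 0 := by
          refine le_antisymm (not_lt.1 fun hlt => hk (hf.mem_posCone h5 hlt)) (hf.nonneg h5)
        rw [this, mul_zero]
        exact (hf.pos _ h1).le
    have hzero := hmin.hasDerivAt_eq_zero hd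
    rw [← sub_eq_zero.1 hzero, linearMap_apply_eq_sum]

end Frame

section Cylinder

variable {n : ℕ} {f : (Fin n → ℝ) → ℝ} {σ ε : ℝ} {T : EReal}
  {Ω : Set (EuclideanSpace ℝ (Fin n))} {u₀ : EuclideanSpace ℝ (Fin n) → ℝ}
  {u : EuclideanSpace ℝ (Fin n) → ℝ → ℝ}

/-! ### Regularity of solutions in the interior of the parabolic domain -/

theorem convex_timeInterval : Convex ℝ (timeInterval T) := by
  refine Set.OrdConnected.convex ⟨fun a ha b hb c hc => ?_⟩
  exact mem_timeInterval_of_le hb (ha.1.trans hc.1) hc.2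

theorem uniqueDiffOn_timeInterval {t : ℝ} (ht : t ∈ timeInterval T) :
    UniqueDiffOn ℝ (timeInterval T) := by
  obtain ⟨t', ht', hlt⟩ := exists_gt_mem_timeInterval ht
  refine uniqueDiffOn_convex convex_timeInterval ⟨t' / 2, ?_⟩
  have h0 : 0 < t' := ht.1.trans_lt hlt
  exact interior_maximal (s := timeInterval T) (t := Set.Ioo 0 t')
    (fun s hs => mem_timeInterval_of_le ht' hs.1.le hs.2.le) isOpen_Ioo
    ⟨by positivity, by linarith⟩

theorem uniqueDiffOn_cylinder (hΩ : IsOpen Ω) {t : ℝ} (ht : t ∈ timeInterval T) :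
    UniqueDiffOn ℝ (Ω ×ˢ timeInterval T) :=
  hΩ.uniqueDiffOn.prod (uniqueDiffOn_timeInterval ht)

theorem cylinder_mem_nhds (hΩ : IsOpen Ω) {x : EuclideanSpace ℝ (Fin n)} (hx : x ∈ Ω) {t : ℝ}
    (ht : t ∈ timeInterval T) (ht0 : 0 < t) : Ω ×ˢ timeInterval T ∈ 𝓝 (x, t) := by
  obtain ⟨t', ht', hlt⟩ := exists_gt_mem_timeInterval ht
  refine prod_mem_nhds (hΩ.mem_nhds hx) (Filter.mem_of_superset (Ioo_mem_nhds ht0 hlt) ?_)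
  exact fun s hs => mem_timeInterval_of_le ht' hs.1.le hs.2.le

theorem eventually_pos_time {x : EuclideanSpace ℝ (Fin n)} {t : ℝ} (ht0 : 0 < t) :
    ∀ᶠ q : EuclideanSpace ℝ (Fin n) × ℝ in 𝓝 (x, t), 0 < q.2 :=
  continuous_snd.continuousAt.eventually (lt_mem_nhds ht0)

theorem IsSolution.smoothNear (hu : IsSolution f σ ε T Ω u₀ u) (hΩ : IsOpen Ω)
    {x : EuclideanSpace ℝ (Fin n)} (hx : x ∈ Ω) {t : ℝ} (ht : t ∈ timeInterval T)
    (ht0 : 0 < t) : SmoothNear (Function.uncurry u) (x, t) := by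
  filter_upwards [cylinder_mem_nhds hΩ hx ht ht0, eventually_pos_time ht0] with q hq hq0
  exact (hu.contDiffOn_interior hΩ).contDiffAt (cylinder_mem_nhds hΩ hq.1 hq.2 hq0)

/-- The function `u_t / u + σ w`, equal to `w f(κ)` for solutions. -/
def speed (σ : ℝ) (u : EuclideanSpace ℝ (Fin n) → ℝ → ℝ)
    (p : EuclideanSpace ℝ (Fin n) × ℝ) : ℝ :=
  dirDeriv (0, 1) (Function.uncurry u) p * (Function.uncurry u p)⁻¹ + σ * stSlope u p

/-- Written through `u_t`, `u` and `w`, the speed is smooth although `f` need not be. -/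
theorem smoothNear_speed {p : EuclideanSpace ℝ (Fin n) × ℝ}
    (h : SmoothNear (Function.uncurry u) p) (hpos : ∀ᶠ q in 𝓝 p, 0 < Function.uncurry u q) :
    SmoothNear (speed σ u) p := by
  have h1 : SmoothNear (fun q => (Function.uncurry u q)⁻¹) p := by
    filter_upwards [h, hpos] with q hq hq' using hq.inv hq'.ne'
  exact ((h.dirDeriv _).mul h1).add ((SmoothNear.const σ).mul (smoothNear_stSlope h))

theorem IsSolution.eventually_pos (hu : IsSolution f σ ε T Ω u₀ u) (hΩ : IsOpen Ω)
    {x : EuclideanSpace ℝ (Fin n)} (hx : x ∈ Ω) {t : ℝ} (ht : t ∈ timeInterval T)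
    (ht0 : 0 < t) : ∀ᶠ q in 𝓝 (x, t), 0 < Function.uncurry u q := by
  filter_upwards [cylinder_mem_nhds hΩ hx ht ht0] with q hq
  exact hu.pos _ (subset_closure hq.1) _ hq.2

theorem IsSolution.dirDeriv_time (hu : IsSolution f σ ε T Ω u₀ u) (hΩ : IsOpen Ω)
    {x : EuclideanSpace ℝ (Fin n)} (hx : x ∈ Ω) {t : ℝ} (ht : t ∈ timeInterval T)
    (ht0 : 0 < t) : dirDeriv (0, 1) (Function.uncurry u) (x, t) =
      u x t * slope (fun y => u y t) x * (f (principalCurvatures (fun y => u y t) x) - σ) := by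
  have h1 := (deriv_time (u := u) (hu.smoothNear hΩ hx ht ht0).differentiableAt)
  exact (uniqueDiffOn_timeInterval ht t ht).eq_deriv _ h1.hasDerivWithinAt
    (hu.evolution x hx t ht)

theorem IsSolution.speed_eq (hu : IsSolution f σ ε T Ω u₀ u) (hΩ : IsOpen Ω)
    {x : EuclideanSpace ℝ (Fin n)} (hx : x ∈ Ω) {t : ℝ} (ht : t ∈ timeInterval T)
    (ht0 : 0 < t) : speed σ u (x, t) =
      stSlope u (x, t) * f (principalCurvatures (fun y => u y t) x) := by
  have h0 : u x t ≠ 0 := (hu.pos x (subset_closure hx) t ht).ne'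
  rw [speed, hu.dirDeriv_time hΩ hx ht ht0]
  simp only [stSlope, Function.uncurry]
  field_simp
  ring

theorem IsSolution.exists_principalFrame (hf : IsCurvatureFunction f)
    (hu : IsSolution f σ ε T Ω u₀ u) (hΩ : IsOpen Ω)
    {x : EuclideanSpace ℝ (Fin n)} (hx : x ∈ Ω) {t : ℝ} (ht : t ∈ timeInterval T)
    (ht0 : 0 < t) (hp : 0 < f (principalCurvatures (fun y => u y t) x)) :
    ∃ e l φ, IsPrincipalFrame f (Function.uncurry u) (speed σ u) (x, t) e l φ := by
  have hs := hu.smoothNear hΩ hx ht ht0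
  have hpos := hu.eventually_pos hΩ hx ht ht0
  refine hf.exists_principalFrame hs hpos (smoothNear_speed hs hpos).differentiableAt ?_ ?_
    (hf.mem_posCone (hu.curvature_mem x hx t ht) hp)
  · filter_upwards [cylinder_mem_nhds hΩ hx ht ht0, eventually_pos_time ht0] with q hq hq0
    exact hu.speed_eq hΩ hq.1 hq.2 hq0
  · filter_upwards [cylinder_mem_nhds hΩ hx ht ht0] with q hq
    exact hu.curvature_mem _ hq.1 _ hq.2

theorem IsSolution.continuousOn_fderivWithin (hu : IsSolution f σ ε T Ω u₀ u) (hΩ : IsOpen Ω)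
    {t : ℝ} (ht : t ∈ timeInterval T) :
    ContinuousOn (fderivWithin ℝ (Function.uncurry u) (Ω ×ˢ timeInterval T))
      (Ω ×ˢ timeInterval T) :=
  (hu.contDiffOn_interior hΩ).continuousOn_fderivWithin (uniqueDiffOn_cylinder hΩ ht) (by simp)

/-- Covers `t = 0`, where `u` has only one-sided time derivatives; this gives continuity of the
slope up to the initial time. -/
theorem IsSolution.grad_eq_fderivWithin (hu : IsSolution f σ ε T Ω u₀ u) (hΩ : IsOpen Ω)
    {x : EuclideanSpace ℝ (Fin n)} (hx : x ∈ Ω) {t : ℝ} (ht : t ∈ timeInterval T) (i : Fin n) :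
    grad (fun y => u y t) x i = fderivWithin ℝ (Function.uncurry u) (Ω ×ˢ timeInterval T) (x, t)
      (EuclideanSpace.single i 1, 0) := by
  have hd : HasFDerivWithinAt (Function.uncurry u) _ (Ω ×ˢ timeInterval T) (x, t) :=
    ((hu.contDiffOn_interior hΩ).differentiableOn (by simp) (x, t) ⟨hx, ht⟩).hasFDerivWithinAt
  have h1 : HasFDerivAt (fun y : EuclideanSpace ℝ (Fin n) => (y, t))
    (ContinuousLinearMap.inl ℝ (EuclideanSpace ℝ (Fin n)) ℝ) x := hasFDerivAt_prodMk_left x t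
  have hm : Set.MapsTo (fun y : EuclideanSpace ℝ (Fin n) => (y, t)) Ω (Ω ×ˢ timeInterval T) :=
    fun y hy => ⟨hy, ht⟩
  have h2 := (hd.comp x (h1.hasFDerivWithinAt (s := Ω)) hm).hasFDerivAt (hΩ.mem_nhds hx)
  have h3 : fderiv ℝ (fun y => u y t) x = _ := h2.fderiv
  rw [grad, h3]
  simp

theorem IsSolution.continuousOn_stSlope (hu : IsSolution f σ ε T Ω u₀ u) (hΩ : IsOpen Ω) :
    ContinuousOn (stSlope u) (Ω ×ˢ timeInterval T) := by
  intro p hp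
  have hc := hu.continuousOn_fderivWithin hΩ hp.2
  have h1 : ContinuousOn (fun q => Real.sqrt (1 + ∑ i, fderivWithin ℝ (Function.uncurry u)
      (Ω ×ˢ timeInterval T) q (EuclideanSpace.single i 1, 0) ^ 2)) (Ω ×ˢ timeInterval T) := by
    refine Real.continuous_sqrt.comp_continuousOn (continuousOn_const.add ?_)
    exact continuousOn_finsetSum _ fun i _ => (hc.clm_apply continuousOn_const).pow 2
  refine (h1.congr fun q hq => ?_) p hp
  simp only [stSlope, slope, hu.grad_eq_fderivWithin hΩ hq.1 hq.2]

/-- Continuity of the curvature up to the initial time. -/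
theorem IsSolution.continuousOn_curvature (hu : IsSolution f σ ε T Ω u₀ u) (hΩ : IsOpen Ω) :
    ContinuousOn (fun p : EuclideanSpace ℝ (Fin n) × ℝ =>
      f (principalCurvatures (fun y => u y p.2) p.1)) (Ω ×ˢ timeInterval T) := by
  intro p hp
  have hc := hu.continuousOn_fderivWithin hΩ hp.2
  have hcu : ContinuousOn (Function.uncurry u) (Ω ×ˢ timeInterval T) :=
    (hu.contDiffOn_interior hΩ).continuousOn
  -- The curvature is recovered by solving the flow equation for `f(κ)`, which replaces any
  -- continuity statement about eigenvalues.
  have h1 : ContinuousOn (fun q => fderivWithin ℝ (Function.uncurry u)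
      (Ω ×ˢ timeInterval T) q (0, 1) / (Function.uncurry u q * stSlope u q) + σ)
      (Ω ×ˢ timeInterval T) := by
    refine ((hc.clm_apply continuousOn_const).div (hcu.mul (hu.continuousOn_stSlope hΩ))
      fun q hq => ?_).add continuousOn_const
    exact (mul_pos (hu.pos _ (subset_closure hq.1) _ hq.2) (slope_pos _ _)).ne'
  refine (h1.congr fun q hq => ?_) p hp
  obtain ⟨x, t⟩ := q
  obtain ⟨hx, ht⟩ := hq
  have hd : HasFDerivWithinAt (Function.uncurry u) _ (Ω ×ˢ timeInterval T) (x, t) :=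
    ((hu.contDiffOn_interior hΩ).differentiableOn (by simp) (x, t) ⟨hx, ht⟩).hasFDerivWithinAt
  have h2 : HasDerivWithinAt (fun s : ℝ => (x, s)) ((0 : EuclideanSpace ℝ (Fin n)), (1 : ℝ))
      (timeInterval T) t :=
    ((hasDerivAt_const t x).prodMk (hasDerivAt_id t)).hasDerivWithinAt
  have h3 := hd.comp_hasDerivWithinAt t h2 fun s hs => ⟨hx, hs⟩
  have h4 := (uniqueDiffOn_timeInterval ht t ht).eq_deriv _ h3 (hu.evolution x hx t ht)
  have hpos := hu.pos x (subset_closure hx) t ht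
  have hw := slope_pos (fun y => u y t) x
  simp only [stSlope, Function.uncurry_apply_pair]
  rw [h4]
  field_simp
  ring

/-- Uniform bounds for the derivatives on compact subsets of `Ω × [0, T)`. -/
theorem IsSolution.exists_derivative_bounds (hu : IsSolution f σ ε T Ω u₀ u) (hΩ : IsOpen Ω)
    {K : Set (EuclideanSpace ℝ (Fin n))} (hK : IsCompact K) (hKΩ : K ⊆ Ω) {τ : ℝ}
    (hτ : τ ∈ timeInterval T) :
    ∃ M, 1 ≤ M ∧ ∀ x ∈ K, ∀ t ∈ Set.Ioc 0 τ, u x t ≤ M ∧ (u x t)⁻¹ ≤ M ∧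
      stSlope u (x, t) ≤ M ∧ |dirDeriv (0, 1) (Function.uncurry u) (x, t)| ≤ M ∧
      ∀ e : EuclideanSpace ℝ (Fin n), ‖e‖ ≤ 1 →
        |dirDeriv (e, 0) (dirDeriv (e, 0) (Function.uncurry u)) (x, t)| ≤ M := by
  set D := Ω ×ˢ timeInterval T with hD
  have hsub : K ×ˢ Set.Icc 0 τ ⊆ D := Set.prod_mono hKΩ (Icc_subset_timeInterval hτ)
  have hcomp : IsCompact (K ×ˢ Set.Icc 0 τ) := hK.prod isCompact_Icc
  have hud : UniqueDiffOn ℝ D := uniqueDiffOn_cylinder hΩ hτ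
  have hsm := hu.contDiffOn_interior hΩ
  have hc1 := hu.continuousOn_fderivWithin hΩ hτ
  have hsm1 : ContDiffOn ℝ ∞ (fderivWithin ℝ (Function.uncurry u) D) D :=
    hsm.fderivWithin hud (by simp)
  have hc2 : ContinuousOn (fderivWithin ℝ (fderivWithin ℝ (Function.uncurry u) D) D) D :=
    hsm1.continuousOn_fderivWithin hud (by simp)
  have hcu : ContinuousOn (Function.uncurry u) D := hsm.continuousOn
  obtain ⟨M₁, h₁⟩ := hcomp.exists_bound_of_continuousOn (hcu.mono hsub)
  obtain ⟨M₂, h₂⟩ := hcomp.exists_bound_of_continuousOn ((hcu.inv₀ fun q hq =>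
    (hu.pos _ (subset_closure hq.1) _ hq.2).ne').mono hsub)
  obtain ⟨M₃, h₃⟩ := hcomp.exists_bound_of_continuousOn ((hu.continuousOn_stSlope hΩ).mono hsub)
  obtain ⟨M₄, h₄⟩ := hcomp.exists_bound_of_continuousOn
    ((hc1.clm_apply (continuousOn_const (c := ((0 : EuclideanSpace ℝ (Fin n)), (1 : ℝ))))).mono
      hsub)
  obtain ⟨M₅, h₅⟩ := hcomp.exists_bound_of_continuousOn
    (E := EuclideanSpace ℝ (Fin n) × ℝ →L[ℝ] EuclideanSpace ℝ (Fin n) × ℝ →L[ℝ] ℝ)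
    (hc2.mono hsub)
  refine ⟨max 1 (max M₁ (max M₂ (max M₃ (max M₄ M₅)))), le_max_left _ _, fun x hx t ht => ?_⟩
  have hp : (x, t) ∈ K ×ˢ Set.Icc 0 τ := ⟨hx, ht.1.le, ht.2⟩
  have hnhds : D ∈ 𝓝 (x, t) :=
    cylinder_mem_nhds hΩ (hKΩ hx) (Icc_subset_timeInterval hτ hp.2) ht.1
  have hs := hu.smoothNear hΩ (hKΩ hx) (Icc_subset_timeInterval hτ hp.2) ht.1
  refine ⟨?_, ?_, ?_, ?_, fun e he => ?_⟩
  · exact ((le_abs_self _).trans (h₁ _ hp)).trans (by simp)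
  · exact ((le_abs_self _).trans (h₂ _ hp)).trans (by simp)
  · exact ((le_abs_self _).trans (h₃ _ hp)).trans (by simp)
  · have := h₄ _ hp
    rw [fderivWithin_of_mem_nhds hnhds] at this
    exact this.trans (by simp)
  · have h6 := h₅ _ hp
    have h7 : fderivWithin ℝ (Function.uncurry u) D =ᶠ[𝓝 (x, t)] fderiv ℝ (Function.uncurry u) := by
      filter_upwards [eventually_mem_nhds_iff.2 hnhds] with q hq
      exact fderivWithin_of_mem_nhds hq
    rw [fderivWithin_of_mem_nhds hnhds, h7.fderiv_eq] at h6
    rw [dirDeriv_dirDeriv hs.contDiffAt]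
    have hn : ‖(e, (0 : ℝ))‖ ≤ 1 := by simpa [Prod.norm_def] using he
    have h8 := (fderiv ℝ (fderiv ℝ (Function.uncurry u)) (x, t)).le_opNorm₂ (e, 0) (e, 0)
    have h9 : ‖fderiv ℝ (fderiv ℝ (Function.uncurry u)) (x, t)‖ * ‖(e, (0 : ℝ))‖ * ‖(e, (0 : ℝ))‖
        ≤ ‖fderiv ℝ (fderiv ℝ (Function.uncurry u)) (x, t)‖ * 1 * 1 := by gcongr
    rw [mul_one, mul_one] at h9
    exact ((h8.trans h9).trans h6).trans (by simp)

end Cylinder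

/-! ### Evolution of the speed in a principal frame -/

section Evolution

variable {n : ℕ} {f : (Fin n → ℝ) → ℝ} {σ : ℝ} {u : EuclideanSpace ℝ (Fin n) → ℝ → ℝ}
  {B χ : EuclideanSpace ℝ (Fin n) × ℝ → ℝ} {p a : EuclideanSpace ℝ (Fin n) × ℝ}
  {e : Fin n → EuclideanSpace ℝ (Fin n)} {l φ : Fin n → ℝ}

/-- The spatial gradient as a vector. -/
def gradVec (u : EuclideanSpace ℝ (Fin n) → ℝ → ℝ) (p : EuclideanSpace ℝ (Fin n) × ℝ) :
    EuclideanSpace ℝ (Fin n) := WithLp.toLp 2 (grad (fun y => u y p.2) p.1)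

theorem dirDeriv_toLp (c : Fin n → ℝ) :
    dirDeriv (WithLp.toLp 2 c, 0) χ p =
      ∑ k, c k * dirDeriv (EuclideanSpace.single k 1, 0) χ p := by
  have h1 : ((WithLp.toLp 2 c : EuclideanSpace ℝ (Fin n)), (0 : ℝ)) =
      ∑ k, c k • ((EuclideanSpace.single k (1 : ℝ) : EuclideanSpace ℝ (Fin n)), (0 : ℝ)) := by
    ext j
    · simp [Prod.fst_sum, Finset.sum_apply, Pi.single_apply]
    · simp [Prod.snd_sum]
  simp only [dirDeriv, h1, map_sum, map_smul, smul_eq_mul]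

theorem inner_toLp_dirDeriv (c : Fin n → ℝ) (y : EuclideanSpace ℝ (Fin n)) :
    inner ℝ (WithLp.toLp 2 c) y = ∑ k, c k * y k := by
  have := inner_toLp c (WithLp.ofLp y)
  rwa [WithLp.toLp_ofLp] at this

theorem dirDeriv_gradVec (h : SmoothNear (Function.uncurry u) p) :
    dirDeriv (gradVec u p, 0) χ p = ∑ k, dirDeriv (EuclideanSpace.single k 1, 0)
      (Function.uncurry u) p * dirDeriv (EuclideanSpace.single k 1, 0) χ p := by
  rw [gradVec, dirDeriv_toLp]
  simp only [grad_slice p h]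

theorem inner_gradVec (h : SmoothNear (Function.uncurry u) p) (y : EuclideanSpace ℝ (Fin n)) :
    inner ℝ y (gradVec u p) = dirDeriv (y, 0) (Function.uncurry u) p := by
  have h1 := dirDeriv_toLp (χ := Function.uncurry u) (p := p) (WithLp.ofLp y)
  rw [WithLp.toLp_ofLp] at h1
  rw [real_inner_comm, gradVec, inner_toLp_dirDeriv, h1]
  simp only [grad_slice p h, mul_comm]

theorem dirDeriv_gradVec_self (h : SmoothNear (Function.uncurry u) p) :
    dirDeriv (gradVec u p, 0) (Function.uncurry u) p = stSlope u p ^ 2 - 1 := by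
  have h1 := slope_sq (fun y => u y p.2) p.1
  rw [dirDeriv_gradVec h, stSlope, ← h1, dotProduct]
  simp only [grad_slice p h]

theorem stSlope_pos : 0 < stSlope u p := slope_pos _ _

theorem one_le_stSlope : 1 ≤ stSlope u p := by
  rw [stSlope, slope, Real.one_le_sqrt]
  have : 0 ≤ ∑ i, grad (fun y => u y p.2) p.1 i ^ 2 := Finset.sum_nonneg fun i _ => sq_nonneg _
  linarith

theorem stSlope_mul_self (h : SmoothNear (Function.uncurry u) p) :
    stSlope u p * stSlope u p = 1 + ∑ k, dirDeriv (EuclideanSpace.single k 1, 0)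
      (Function.uncurry u) p * dirDeriv (EuclideanSpace.single k 1, 0) (Function.uncurry u) p := by
  have := dirDeriv_gradVec_self h
  rw [dirDeriv_gradVec h] at this
  rw [this]
  ring

theorem dirDeriv_sum_mul {ι : Type*} {s : Finset ι}
    {χ ϑ : ι → EuclideanSpace ℝ (Fin n) × ℝ → ℝ} (hχ : ∀ k, DifferentiableAt ℝ (χ k) p)
    (hϑ : ∀ k, DifferentiableAt ℝ (ϑ k) p) :
    dirDeriv a (fun q => ∑ k ∈ s, χ k q * ϑ k q) p =
      ∑ k ∈ s, (dirDeriv a (χ k) p * ϑ k p + χ k p * dirDeriv a (ϑ k) p) := by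
  rw [dirDeriv, fderiv_fun_sum fun k _ => (hχ k).fun_mul (hϑ k), sum_apply]
  exact Finset.sum_congr rfl fun k _ => dirDeriv_mul (hχ k) (hϑ k)

/-- Obtained by differentiating `w² = 1 + |Du|²` instead of the square root; `stSlope_second`
differentiates the result once more. -/
theorem stSlope_mul_dirDeriv_sum (h : SmoothNear (Function.uncurry u) p) :
    stSlope u p * dirDeriv a (stSlope u) p = ∑ k, dirDeriv (EuclideanSpace.single k 1, 0)
      (Function.uncurry u) p *
        dirDeriv a (dirDeriv (EuclideanSpace.single k 1, 0) (Function.uncurry u)) p := by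
  have hw := (smoothNear_stSlope h).differentiableAt
  have h1 : dirDeriv a (fun q => stSlope u q * stSlope u q) p = _ :=
    dirDeriv_congr (h.eventually.mono fun q hq => stSlope_mul_self hq)
  have hk : ∀ k : Fin n, DifferentiableAt ℝ (dirDeriv ((EuclideanSpace.single k (1 : ℝ) :
      EuclideanSpace ℝ (Fin n)), (0 : ℝ)) (Function.uncurry u)) p := fun k =>
    (h.dirDeriv _).differentiableAt
  rw [dirDeriv_mul hw hw, dirDeriv_add (differentiableAt_const _)
    (DifferentiableAt.fun_sum fun k _ => (hk k).fun_mul (hk k)), dirDeriv_const,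
    dirDeriv_sum_mul hk hk, Finset.sum_add_distrib] at h1
  simp only [mul_comm (dirDeriv a _ p)] at h1
  linarith

theorem stSlope_mul_dirDeriv (h : SmoothNear (Function.uncurry u) p) :
    stSlope u p * dirDeriv a (stSlope u) p =
      dirDeriv (gradVec u p, 0) (dirDeriv a (Function.uncurry u)) p := by
  rw [stSlope_mul_dirDeriv_sum h, dirDeriv_gradVec h]
  exact Finset.sum_congr rfl fun k _ => by rw [dirDeriv_comm h.contDiffAt]

theorem stSlope_second (h : SmoothNear (Function.uncurry u) p) :
    dirDeriv a (stSlope u) p ^ 2 + stSlope u p * dirDeriv a (dirDeriv a (stSlope u)) p =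
      ∑ k, dirDeriv (EuclideanSpace.single k 1, 0) (dirDeriv a (Function.uncurry u)) p ^ 2 +
      dirDeriv (gradVec u p, 0) (dirDeriv a (dirDeriv a (Function.uncurry u))) p := by
  have hw := smoothNear_stSlope h
  have h1 : dirDeriv a (fun q => stSlope u q * dirDeriv a (stSlope u) q) p = _ :=
    dirDeriv_congr (h.eventually.mono fun q hq => stSlope_mul_dirDeriv_sum hq)
  have hk : ∀ k : Fin n, SmoothNear (dirDeriv ((EuclideanSpace.single k (1 : ℝ) :
      EuclideanSpace ℝ (Fin n)), (0 : ℝ)) (Function.uncurry u)) p := fun k => h.dirDeriv _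
  rw [dirDeriv_mul hw.differentiableAt (hw.dirDeriv a).differentiableAt,
    dirDeriv_sum_mul (fun k => (hk k).differentiableAt)
      fun k => ((hk k).dirDeriv a).differentiableAt] at h1
  rw [sq, h1, dirDeriv_gradVec h, ← Finset.sum_add_distrib]
  refine Finset.sum_congr rfl fun k _ => ?_
  rw [dirDeriv_comm h.contDiffAt (a := a)]
  have h2 : dirDeriv a (dirDeriv (EuclideanSpace.single k 1, 0) (Function.uncurry u)) =ᶠ[𝓝 p]
      dirDeriv (EuclideanSpace.single k 1, 0) (dirDeriv a (Function.uncurry u)) :=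
    h.mono fun q hq => dirDeriv_comm hq
  rw [dirDeriv_congr h2, dirDeriv_comm (h.dirDeriv a).contDiffAt (a := a)]
  ring

namespace IsPrincipalFrame

theorem norm_sq (F : IsPrincipalFrame f (Function.uncurry u) B p e l φ) (i : Fin n) :
    ‖e i‖ ^ 2 = 1 - dirDeriv (e i, 0) (Function.uncurry u) p ^ 2 := by
  have := F.metric i
  rw [formG, real_inner_self_eq_norm_sq] at this
  linarith

theorem formG_gradVec (h : SmoothNear (Function.uncurry u) p) (y : EuclideanSpace ℝ (Fin n)) :
    formG (Function.uncurry u) y (gradVec u p) p =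
      stSlope u p ^ 2 * dirDeriv (y, 0) (Function.uncurry u) p := by
  rw [formG, inner_gradVec h, dirDeriv_gradVec_self h]
  ring

/-- Second derivatives of the height along a frame vector. -/
theorem height_second (F : IsPrincipalFrame f (Function.uncurry u) B p e l φ)
    (h : SmoothNear (Function.uncurry u) p) (i : Fin n) (y : EuclideanSpace ℝ (Fin n)) :
    Function.uncurry u p * dirDeriv (y, 0) (dirDeriv (e i, 0) (Function.uncurry u)) p =
      (l i - 1) * formG (Function.uncurry u) (e i) y p := by
  have := F.eigen i y
  rw [formA, dirDeriv_comm h.contDiffAt] at this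
  linarith

theorem height_second_self (F : IsPrincipalFrame f (Function.uncurry u) B p e l φ)
    (h : SmoothNear (Function.uncurry u) p) (i : Fin n) :
    Function.uncurry u p * dirDeriv (e i, 0) (dirDeriv (e i, 0) (Function.uncurry u)) p =
      l i - 1 := by
  rw [F.height_second h, F.metric, mul_one]

theorem height_second_gradVec (F : IsPrincipalFrame f (Function.uncurry u) B p e l φ)
    (h : SmoothNear (Function.uncurry u) p) (i : Fin n) :
    Function.uncurry u p *
        dirDeriv (gradVec u p, 0) (dirDeriv (e i, 0) (Function.uncurry u)) p =
      (l i - 1) * (stSlope u p ^ 2 * dirDeriv (e i, 0) (Function.uncurry u) p) := by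
  rw [F.height_second h, formG_gradVec h]

/-- Apply `height_second` to the Euclidean gradient of the derivative of `u` along `e i`; the two
terms of `formG` then reduce to `height_second_self` and `height_second_gradVec`. -/
theorem sum_height_second_sq (F : IsPrincipalFrame f (Function.uncurry u) B p e l φ)
    (h : SmoothNear (Function.uncurry u) p) (i : Fin n) :
    Function.uncurry u p ^ 2 * ∑ k, dirDeriv (EuclideanSpace.single k 1, 0)
        (dirDeriv (e i, 0) (Function.uncurry u)) p ^ 2 =
      (l i - 1) ^ 2 * (1 + stSlope u p ^ 2 * dirDeriv (e i, 0) (Function.uncurry u) p ^ 2) := by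
  set c : Fin n → ℝ := fun k => dirDeriv (EuclideanSpace.single k 1, 0)
    (dirDeriv (e i, 0) (Function.uncurry u)) p with hc
  have h1 := dirDeriv_toLp (χ := dirDeriv (e i, 0) (Function.uncurry u)) (p := p) c
  have h2 := F.height_second h i (WithLp.toLp 2 c)
  have h3 : inner ℝ (e i) (WithLp.toLp 2 c) =
      dirDeriv (e i, 0) (dirDeriv (e i, 0) (Function.uncurry u)) p := by
    have := dirDeriv_toLp (χ := dirDeriv (e i, 0) (Function.uncurry u)) (p := p)
      (WithLp.ofLp (e i))
    rw [WithLp.toLp_ofLp] at this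
    rw [real_inner_comm, inner_toLp_dirDeriv, this]
    exact Finset.sum_congr rfl fun k _ => mul_comm _ _
  have h4 : dirDeriv (WithLp.toLp 2 c, 0) (Function.uncurry u) p =
      dirDeriv (gradVec u p, 0) (dirDeriv (e i, 0) (Function.uncurry u)) p := by
    rw [dirDeriv_toLp, dirDeriv_gradVec h]
    exact Finset.sum_congr rfl fun k _ => mul_comm _ _
  have h5 : ∑ k, c k ^ 2 = ∑ k, c k * c k := Finset.sum_congr rfl fun k _ => sq _
  rw [h5]
  have h1' : dirDeriv (WithLp.toLp 2 c, 0) (dirDeriv (e i, 0) (Function.uncurry u)) p =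
    ∑ k, c k * c k := h1
  rw [h1', formG, h3, h4] at h2
  linear_combination Function.uncurry u p * h2 + (l i - 1) * F.height_second_self h i +
    (l i - 1) * dirDeriv (e i, 0) (Function.uncurry u) p * F.height_second_gradVec h i

/-- Time derivative of the speed in terms of the velocity `u_t`. -/
theorem time_variation (F : IsPrincipalFrame f (Function.uncurry u) B p e l φ)
    (h : SmoothNear (Function.uncurry u) p) {v : EuclideanSpace ℝ (Fin n) × ℝ → ℝ}
    (hv : v =ᶠ[𝓝 p] dirDeriv (0, 1) (Function.uncurry u)) :
    dirDeriv (0, 1) B p = ∑ i, φ i *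
      (2 * (1 - l i) * dirDeriv (e i, 0) (Function.uncurry u) p * dirDeriv (e i, 0) v p +
        v p * dirDeriv (e i, 0) (dirDeriv (e i, 0) (Function.uncurry u)) p +
        Function.uncurry u p * dirDeriv (e i, 0) (dirDeriv (e i, 0) v) p) := by
  rw [F.variation]
  refine Finset.sum_congr rfl fun i _ => ?_
  have h0 := h.differentiableAt
  have h1 := (h.dirDeriv (e i, 0)).differentiableAt
  have h2 := ((h.dirDeriv (e i, 0)).dirDeriv (e i, 0)).differentiableAt
  have c1 : dirDeriv (0, 1) (dirDeriv (e i, 0) (Function.uncurry u)) =ᶠ[𝓝 p]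
      dirDeriv (e i, 0) v := by
    filter_upwards [h, dirDeriv_eventuallyEq (a := (e i, 0)) hv] with q hq hq'
    rw [hq', dirDeriv_comm hq]
  have c2 : dirDeriv (0, 1) (dirDeriv (e i, 0) (dirDeriv (e i, 0) (Function.uncurry u))) p =
      dirDeriv (e i, 0) (dirDeriv (e i, 0) v) p := by
    rw [dirDeriv_comm (h.dirDeriv _).contDiffAt, dirDeriv_congr c1]
  have hG : dirDeriv (0, 1) (formG (Function.uncurry u) (e i) (e i)) p =
      2 * dirDeriv (e i, 0) (Function.uncurry u) p * dirDeriv (e i, 0) v p := by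
    change dirDeriv (0, 1) (fun q => inner ℝ (e i) (e i) +
      dirDeriv (e i, 0) (Function.uncurry u) q * dirDeriv (e i, 0) (Function.uncurry u) q) p = _
    rw [dirDeriv_add (differentiableAt_const _) (h1.fun_mul h1), dirDeriv_const,
      dirDeriv_mul h1 h1, c1.self_of_nhds]
    ring
  have hA : dirDeriv (0, 1) (formA (Function.uncurry u) (e i) (e i)) p =
      dirDeriv (0, 1) (formG (Function.uncurry u) (e i) (e i)) p +
      (v p * dirDeriv (e i, 0) (dirDeriv (e i, 0) (Function.uncurry u)) p +
        Function.uncurry u p * dirDeriv (e i, 0) (dirDeriv (e i, 0) v) p) := by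
    change dirDeriv (0, 1) (fun q => formG (Function.uncurry u) (e i) (e i) q +
      Function.uncurry u q * dirDeriv (e i, 0) (dirDeriv (e i, 0) (Function.uncurry u)) q) p = _
    rw [dirDeriv_add (smoothNear_formG h _ _).differentiableAt (h0.fun_mul h2),
      dirDeriv_mul h0 h2, c2, hv.self_of_nhds]
  rw [hA, hG]
  ring

/-- Derivative of the speed along the gradient. -/
theorem gradVec_variation (F : IsPrincipalFrame f (Function.uncurry u) B p e l φ)
    (h : SmoothNear (Function.uncurry u) p) :
    dirDeriv (gradVec u p, 0) B p = ∑ i, φ i *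
      (2 * (1 - l i) * dirDeriv (e i, 0) (Function.uncurry u) p *
          dirDeriv (gradVec u p, 0) (dirDeriv (e i, 0) (Function.uncurry u)) p +
        (stSlope u p ^ 2 - 1) * dirDeriv (e i, 0) (dirDeriv (e i, 0) (Function.uncurry u)) p +
        Function.uncurry u p *
          dirDeriv (gradVec u p, 0) (dirDeriv (e i, 0) (dirDeriv (e i, 0) (Function.uncurry u))) p)
      := by
  rw [F.variation]
  refine Finset.sum_congr rfl fun i _ => ?_
  have h0 := h.differentiableAt
  have h1 := (h.dirDeriv (e i, 0)).differentiableAt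
  have h2 := ((h.dirDeriv (e i, 0)).dirDeriv (e i, 0)).differentiableAt
  have hG : dirDeriv (gradVec u p, 0) (formG (Function.uncurry u) (e i) (e i)) p =
      2 * dirDeriv (e i, 0) (Function.uncurry u) p *
        dirDeriv (gradVec u p, 0) (dirDeriv (e i, 0) (Function.uncurry u)) p := by
    change dirDeriv (gradVec u p, 0) (fun q => inner ℝ (e i) (e i) +
      dirDeriv (e i, 0) (Function.uncurry u) q * dirDeriv (e i, 0) (Function.uncurry u) q) p = _
    rw [dirDeriv_add (differentiableAt_const _) (h1.fun_mul h1), dirDeriv_const,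
      dirDeriv_mul h1 h1]
    ring
  have hA : dirDeriv (gradVec u p, 0) (formA (Function.uncurry u) (e i) (e i)) p =
      dirDeriv (gradVec u p, 0) (formG (Function.uncurry u) (e i) (e i)) p +
      ((stSlope u p ^ 2 - 1) * dirDeriv (e i, 0) (dirDeriv (e i, 0) (Function.uncurry u)) p +
        Function.uncurry u p *
          dirDeriv (gradVec u p, 0) (dirDeriv (e i, 0) (dirDeriv (e i, 0) (Function.uncurry u))) p)
      := by
    change dirDeriv (gradVec u p, 0) (fun q => formG (Function.uncurry u) (e i) (e i) q +
      Function.uncurry u q * dirDeriv (e i, 0) (dirDeriv (e i, 0) (Function.uncurry u)) q) p = _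
    rw [dirDeriv_add (smoothNear_formG h _ _).differentiableAt (h0.fun_mul h2),
      dirDeriv_mul h0 h2, dirDeriv_gradVec_self h]
  rw [hA, hG]
  ring

/-- The contribution of one frame vector: `ψ, ψ₂` stand for `u` and its second derivative, `g` for
its first, `z₁` for the derivative of `g` along `Du`, and indexed `w`, `B` for their derivatives.
The third derivative `X` of `u` enters through the second derivative of `w`. The last bracket on the
right is the corresponding summand of the derivative of `B` along `Du`, so summing over the frame
removes `X`. -/
theorem evolution_algebra {ψ w σ g l B B₁ B₂ w₁ w₂ ψ₂ z₁ S X : ℝ} (hψ : ψ ≠ 0) (hw : w ≠ 0)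
    (k1 : ψ * ψ₂ = l - 1) (k2 : ψ * z₁ = (l - 1) * (w ^ 2 * g))
    (k3 : ψ ^ 2 * S = (l - 1) ^ 2 * (1 + w ^ 2 * g ^ 2)) (k4 : w * w₁ = z₁)
    (k5 : w₁ ^ 2 + w * w₂ = S + X) :
    2 * (1 - l) * g * (g * (B - σ * w) + ψ * (B₁ - σ * w₁)) + ψ * (B - σ * w) * ψ₂ +
        ψ * (ψ₂ * (B - σ * w) + 2 * g * (B₁ - σ * w₁) + ψ * (B₂ - σ * w₂)) =
      ψ ^ 2 * B₂ + (4 - 2 * l) * ψ * g * B₁ +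
        (1 - l) * (σ * (w + l / w) - 2 * B * (1 - g ^ 2)) -
        σ * ψ * (2 * (1 - l) * g * z₁ + (w ^ 2 - 1) * ψ₂ + ψ * X) / w := by
  have e1 : ψ₂ = (l - 1) / ψ := by rw [eq_div_iff hψ]; linarith
  have e2 : z₁ = (l - 1) * (w ^ 2 * g) / ψ := by rw [eq_div_iff hψ]; linarith
  have e3 : S = (l - 1) ^ 2 * (1 + w ^ 2 * g ^ 2) / ψ ^ 2 := by
    rw [eq_div_iff (pow_ne_zero 2 hψ)]; linarith
  have e4 : w₁ = z₁ / w := by rw [eq_div_iff hw]; linarith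
  have e5 : w₂ = (S + X - w₁ ^ 2) / w := by rw [eq_div_iff hw]; linarith
  rw [e5, e4, e3, e2, e1]
  field_simp
  ring

/-- The evolution equation of the speed `w f(κ)`. -/
theorem speed_evolution (F : IsPrincipalFrame f (Function.uncurry u) (speed σ u) p e l φ)
    (h : SmoothNear (Function.uncurry u) p) (hpos : ∀ᶠ q in 𝓝 p, 0 < Function.uncurry u q) :
    dirDeriv (0, 1) (speed σ u) p =
      ∑ i, φ i * (Function.uncurry u p ^ 2 *
            dirDeriv (e i, 0) (dirDeriv (e i, 0) (speed σ u)) p +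
          (4 - 2 * l i) * Function.uncurry u p * dirDeriv (e i, 0) (Function.uncurry u) p *
            dirDeriv (e i, 0) (speed σ u) p +
          (1 - l i) * (σ * (stSlope u p + l i / stSlope u p) -
            2 * speed σ u p * (1 - dirDeriv (e i, 0) (Function.uncurry u) p ^ 2))) -
        σ * Function.uncurry u p * dirDeriv (gradVec u p, 0) (speed σ u) p / stSlope u p := by
  have hB := smoothNear_speed (σ := σ) h hpos
  have hw := smoothNear_stSlope h
  have hD : SmoothNear (fun q => speed σ u q - σ * stSlope u q) p :=
    hB.sub ((SmoothNear.const σ).mul hw)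
  -- Writing `u_t = u (B - σ w)` turns the variation formula into an equation for `B` alone.
  have hv : (fun q => Function.uncurry u q * (speed σ u q - σ * stSlope u q)) =ᶠ[𝓝 p]
      dirDeriv (0, 1) (Function.uncurry u) := by
    filter_upwards [hpos] with q hq
    rw [speed, add_sub_cancel_right]
    field_simp
  have d0 : ∀ {a q}, SmoothNear (Function.uncurry u) q → SmoothNear (speed σ u) q →
      dirDeriv a (fun q => speed σ u q - σ * stSlope u q) q =
      dirDeriv a (speed σ u) q - σ * dirDeriv a (stSlope u) q := by
    intro a q hq hq'
    have hw := (smoothNear_stSlope hq).differentiableAt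
    rw [dirDeriv_sub hq'.differentiableAt ((differentiableAt_const σ).fun_mul hw),
      dirDeriv_mul (differentiableAt_const _) hw, dirDeriv_const]
    ring
  have d1 : ∀ a q, SmoothNear (Function.uncurry u) q → SmoothNear (speed σ u) q →
      dirDeriv a (fun q => Function.uncurry u q * (speed σ u q - σ * stSlope u q)) q =
      dirDeriv a (Function.uncurry u) q * (speed σ u q - σ * stSlope u q) + Function.uncurry u q *
        (dirDeriv a (speed σ u) q - σ * dirDeriv a (stSlope u) q) := by
    intro a q hq hq'
    rw [dirDeriv_mul hq.differentiableAt (hq'.sub ((SmoothNear.const σ).mul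
      (smoothNear_stSlope hq))).differentiableAt, d0 hq hq']
  have d2 : ∀ a, dirDeriv a (dirDeriv a
        (fun q => Function.uncurry u q * (speed σ u q - σ * stSlope u q))) p =
      dirDeriv a (dirDeriv a (Function.uncurry u)) p * (speed σ u p - σ * stSlope u p) +
      2 * dirDeriv a (Function.uncurry u) p *
        (dirDeriv a (speed σ u) p - σ * dirDeriv a (stSlope u) p) + Function.uncurry u p *
        (dirDeriv a (dirDeriv a (speed σ u)) p - σ * dirDeriv a (dirDeriv a (stSlope u)) p) := by
    intro a
    have hE : SmoothNear (fun q => dirDeriv a (speed σ u) q - σ * dirDeriv a (stSlope u) q) p :=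
      (hB.dirDeriv a).sub ((SmoothNear.const σ).mul (hw.dirDeriv a))
    rw [dirDeriv_congr (h.eventually.and hB.eventually |>.mono fun q hq => d1 a q hq.1 hq.2),
      dirDeriv_add ((h.dirDeriv a).mul hD).differentiableAt (h.mul hE).differentiableAt,
      dirDeriv_mul (h.dirDeriv a).differentiableAt hD.differentiableAt,
      dirDeriv_mul h.differentiableAt hE.differentiableAt, d0 h hB,
      dirDeriv_sub (hB.dirDeriv a).differentiableAt
        ((SmoothNear.const σ).mul (hw.dirDeriv a)).differentiableAt,
      dirDeriv_mul (differentiableAt_const _) (hw.dirDeriv a).differentiableAt, dirDeriv_const]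
    ring
  rw [F.time_variation h hv, F.gradVec_variation h, Finset.mul_sum, Finset.sum_div,
    ← Finset.sum_sub_distrib]
  refine Finset.sum_congr rfl fun i _ => ?_
  rw [d1 _ _ h hB, d2]
  have hu0 : Function.uncurry u p ≠ 0 := hpos.self_of_nhds.ne'
  have hw0 : stSlope u p ≠ 0 := stSlope_pos.ne'
  linear_combination φ i * evolution_algebra (σ := σ) (B := speed σ u p)
    (B₁ := dirDeriv (e i, 0) (speed σ u) p)
    (B₂ := dirDeriv (e i, 0) (dirDeriv (e i, 0) (speed σ u)) p) hu0 hw0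
    (F.height_second_self h i) (F.height_second_gradVec h i) (F.sum_height_second_sq h i)
    (stSlope_mul_dirDeriv (a := (e i, 0)) h) (stSlope_second (a := (e i, 0)) h)

end IsPrincipalFrame

end Evolution

/-! ### Preservation of strict local convexity -/

section Convexity

variable {n : ℕ} {f : (Fin n → ℝ) → ℝ} {σ ε : ℝ} {T : EReal}
  {Ω : Set (EuclideanSpace ℝ (Fin n))} {u₀ : EuclideanSpace ℝ (Fin n) → ℝ}
  {u : EuclideanSpace ℝ (Fin n) → ℝ → ℝ}
  {B : EuclideanSpace ℝ (Fin n) × ℝ → ℝ} {p : EuclideanSpace ℝ (Fin n) × ℝ}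
  {e : Fin n → EuclideanSpace ℝ (Fin n)} {l φ : Fin n → ℝ}

theorem slice_min {χ : EuclideanSpace ℝ (Fin n) × ℝ → ℝ} {x : EuclideanSpace ℝ (Fin n)} {t : ℝ}
    (h : SmoothNear χ (x, t)) (hmin : IsLocalMin (fun y => χ (y, t)) x)
    (y : EuclideanSpace ℝ (Fin n)) :
    dirDeriv (y, 0) χ (x, t) = 0 ∧ 0 ≤ dirDeriv (y, 0) (dirDeriv (y, 0) χ) (x, t) := by
  have h1 := fderiv_slice (u := fun y t => χ (y, t)) (x := x) (t := t) (e := y) h.differentiableAt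
  have h2 := fderiv_fderiv_slice (u := fun y t => χ (y, t)) (x := x) (t := t) (e := y) (e' := y) h
  have h3 := contDiffAt_slice_of_smooth (u := fun y t => χ (y, t)) h.contDiffAt
  refine ⟨?_, ?_⟩
  · exact h1.symm.trans (by rw [hmin.fderiv_eq_zero]; rfl)
  · exact (IsLocalMin.fderiv_fderiv_nonneg hmin (contDiffAt_two_of_infty h3) y).trans h2.le

/-- The barrier `r² - |x - x₀|²` on space-time. -/
def ballBarrier (x₀ : EuclideanSpace ℝ (Fin n)) (r : ℝ) (q : EuclideanSpace ℝ (Fin n) × ℝ) : ℝ :=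
  r ^ 2 - ‖q.1 - x₀‖ ^ 2

section Barrier

variable {x₀ y : EuclideanSpace ℝ (Fin n)} {r : ℝ}

theorem contDiff_ballBarrier : ContDiff ℝ ∞ (ballBarrier x₀ r) :=
  contDiff_const.sub ((contDiff_fst.sub contDiff_const).norm_sq ℝ)

theorem smoothNear_ballBarrier : SmoothNear (ballBarrier x₀ r) p :=
  Filter.Eventually.of_forall fun _ => contDiff_ballBarrier.contDiffAt

theorem dirDeriv_ballBarrier (a : EuclideanSpace ℝ (Fin n) × ℝ) :
    dirDeriv a (ballBarrier x₀ r) p = -2 * inner ℝ (p.1 - x₀) a.1 := by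
  have h1 : HasFDerivAt (fun q : EuclideanSpace ℝ (Fin n) × ℝ => q.1 - x₀)
      (ContinuousLinearMap.fst ℝ (EuclideanSpace ℝ (Fin n)) ℝ) p :=
    hasFDerivAt_fst.sub_const x₀
  have h2 : HasFDerivAt (ballBarrier x₀ r) _ p := h1.norm_sq.const_sub (r ^ 2)
  rw [dirDeriv, h2.fderiv]
  simp [inner_sub_left]

theorem dirDeriv_dirDeriv_ballBarrier (a : EuclideanSpace ℝ (Fin n) × ℝ) :
    dirDeriv a (dirDeriv a (ballBarrier x₀ r)) p = -2 * ‖a.1‖ ^ 2 := by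
  have h0 : dirDeriv a (ballBarrier x₀ r) = fun q => -2 * inner ℝ (q.1 - x₀) a.1 :=
    funext fun q => dirDeriv_ballBarrier a
  have h1 : HasFDerivAt (fun q : EuclideanSpace ℝ (Fin n) × ℝ => q.1 - x₀)
      (ContinuousLinearMap.fst ℝ (EuclideanSpace ℝ (Fin n)) ℝ) p :=
    hasFDerivAt_fst.sub_const x₀
  have h2 : HasFDerivAt (fun q : EuclideanSpace ℝ (Fin n) × ℝ => -2 * inner ℝ (q.1 - x₀) a.1) _ p :=
    (h1.inner ℝ (hasFDerivAt_const a.1 p)).const_mul (-2)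
  rw [h0, dirDeriv, h2.fderiv]
  simp

end Barrier

theorem IsPrincipalFrame.norm_le_one (F : IsPrincipalFrame f (Function.uncurry u) B p e l φ)
    (i : Fin n) : ‖e i‖ ≤ 1 := by
  have := F.norm_sq i
  exact (sq_le_one_iff₀ (norm_nonneg _)).1 (by
    nlinarith [sq_nonneg (dirDeriv (e i, 0) (Function.uncurry u) p)])

theorem IsPrincipalFrame.abs_slope_le_one (F : IsPrincipalFrame f (Function.uncurry u) B p e l φ)
    (i : Fin n) : |dirDeriv (e i, 0) (Function.uncurry u) p| ≤ 1 := by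
  have := F.norm_sq i
  exact (sq_le_one_iff_abs_le_one _).1 (by nlinarith [sq_nonneg ‖e i‖])

theorem norm_gradVec_le (h : SmoothNear (Function.uncurry u) p) :
    ‖gradVec u p‖ ≤ stSlope u p := by
  have h1 := inner_gradVec h (gradVec u p)
  rw [real_inner_self_eq_norm_sq, dirDeriv_gradVec_self h] at h1
  exact abs_le_of_sq_le_sq' (by linarith) stSlope_pos.le |>.2

theorem IsPrincipalFrame.partial_pos (F : IsPrincipalFrame f (Function.uncurry u) B p e l φ)
    (hf : IsCurvatureFunction f) (i : Fin n) : 0 < φ i := by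
  rw [F.partial_eq]
  exact hf.partial_pos l F.mem i

theorem IsPrincipalFrame.sum_partial_mul (F : IsPrincipalFrame f (Function.uncurry u) B p e l φ)
    (hf : IsCurvatureFunction f) : ∑ i, φ i * l i = B p := by
  simp only [F.partial_eq, hf.sum_partial_mul F.mem, F.value]

theorem IsPrincipalFrame.one_le_sum_partial
    (F : IsPrincipalFrame f (Function.uncurry u) B p e l φ)
    (hf : IsCurvatureFunction f) : 1 ≤ ∑ i, φ i := by
  simp only [F.partial_eq]
  exact hf.one_le_sum_partial F.mem

/-- Along a principal vector `l i - 1` is `u` times the second derivative of `u`, and frame vectors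
have Euclidean length at most one. -/
theorem IsPrincipalFrame.curvature_le (F : IsPrincipalFrame f (Function.uncurry u) B p e l φ)
    (h : SmoothNear (Function.uncurry u) p) (h0 : 0 < Function.uncurry u p) {M : ℝ}
    (hM : Function.uncurry u p ≤ M) (h2 : ∀ y : EuclideanSpace ℝ (Fin n), ‖y‖ ≤ 1 →
      |dirDeriv (y, 0) (dirDeriv (y, 0) (Function.uncurry u)) p| ≤ M) (i : Fin n) :
    l i ≤ 1 + M ^ 2 := by
  have h1 := F.height_second_self h i
  have h3 := (le_abs_self _).trans (h2 (e i) (F.norm_le_one i))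
  have h4 := mul_le_mul_of_nonneg_left h3 h0.le
  have h5 := mul_le_mul_of_nonneg_right hM ((abs_nonneg _).trans (h2 (e i) (F.norm_le_one i)))
  nlinarith

/-- The constant in the barrier estimate for the speed. -/
def barrierConst (σ M r : ℝ) : ℝ :=
  2 * M ^ 2 + (4 + 2 * (1 + M ^ 2)) * M * (2 * r) + 2 * r ^ 2 +
    (σ * (M + (1 + M ^ 2)) * r ^ 2 + σ * M * (2 * r))

/-- Where the speed touches a small multiple of a barrier from above, it is non-decreasing. -/
theorem IsPrincipalFrame.speed_time_nonneg (hf : IsCurvatureFunction f)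
    (F : IsPrincipalFrame f (Function.uncurry u) (speed σ u) p e l φ)
    (h : SmoothNear (Function.uncurry u) p) (hpos : ∀ᶠ q in 𝓝 p, 0 < Function.uncurry u q)
    (hσ : 0 < σ) {M r η : ℝ} (hM : Function.uncurry u p ≤ M) (hw : stSlope u p ≤ M)
    (h2 : ∀ y : EuclideanSpace ℝ (Fin n), ‖y‖ ≤ 1 →
      |dirDeriv (y, 0) (dirDeriv (y, 0) (Function.uncurry u)) p| ≤ M)
    (hr : 0 ≤ r) (hη : 0 ≤ η) (hB : speed σ u p ≤ η * r ^ 2)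
    (hB1 : ∀ y : EuclideanSpace ℝ (Fin n), |dirDeriv (y, 0) (speed σ u) p| ≤ η * (2 * r) * ‖y‖)
    (hB2 : ∀ y : EuclideanSpace ℝ (Fin n), ‖y‖ ≤ 1 →
      -(2 * η) ≤ dirDeriv (y, 0) (dirDeriv (y, 0) (speed σ u)) p)
    (hsmall : η * barrierConst σ M r ≤ σ) : 0 ≤ dirDeriv (0, 1) (speed σ u) p := by
  have h0 : 0 < Function.uncurry u p := hpos.self_of_nhds
  have hw1 : 1 ≤ stSlope u p := one_le_stSlope
  have hM1 : 1 ≤ M := hw1.trans hw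
  have hM0 : 0 ≤ M := by linarith
  have hw0 : 0 < stSlope u p := stSlope_pos
  have hB0 : 0 ≤ speed σ u p := by rw [F.value]; exact (hf.pos l F.mem).le
  rw [F.speed_evolution h hpos]
  set ψ := Function.uncurry u p
  set w := stSlope u p
  set b := speed σ u p
  have hterm : ∀ i, φ i * (σ - η * (2 * M ^ 2 + (4 + 2 * (1 + M ^ 2)) * M * (2 * r) + 2 * r ^ 2))
      - φ i * l i * (σ * (M + (1 + M ^ 2))) ≤
      φ i * (ψ ^ 2 * dirDeriv (e i, 0) (dirDeriv (e i, 0) (speed σ u)) p +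
          (4 - 2 * l i) * ψ * dirDeriv (e i, 0) (Function.uncurry u) p *
            dirDeriv (e i, 0) (speed σ u) p +
          (1 - l i) * (σ * (w + l i / w) -
            2 * b * (1 - dirDeriv (e i, 0) (Function.uncurry u) p ^ 2))) := by
    intro i
    have hφ := F.partial_pos hf i
    have hl0 : 0 < l i := F.mem i
    have hl : l i ≤ 1 + M ^ 2 := F.curvature_le h h0 hM h2 i
    have he := F.norm_le_one i
    have hg := F.abs_slope_le_one i
    set g := dirDeriv (e i, 0) (Function.uncurry u) p
    have hg2 : g ^ 2 ≤ 1 := (sq_le_one_iff_abs_le_one _).2 hg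
    have t1 : -(2 * η) * M ^ 2 ≤ ψ ^ 2 * dirDeriv (e i, 0) (dirDeriv (e i, 0) (speed σ u)) p := by
      have a1 := mul_le_mul_of_nonneg_left (hB2 (e i) he) (sq_nonneg ψ)
      have a2 : ψ ^ 2 ≤ M ^ 2 := by gcongr
      nlinarith [mul_le_mul_of_nonneg_right a2 hη]
    have t2 : -((4 + 2 * (1 + M ^ 2)) * M * (η * (2 * r))) ≤
        (4 - 2 * l i) * ψ * g * dirDeriv (e i, 0) (speed σ u) p := by
      refine neg_le_of_abs_le ?_
      have a1 : |4 - 2 * l i| ≤ 4 + 2 * (1 + M ^ 2) := by rw [abs_le]; constructor <;> nlinarith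
      have a2 : |dirDeriv (e i, 0) (speed σ u) p| ≤ η * (2 * r) :=
        (hB1 (e i)).trans (mul_le_of_le_one_right (by positivity) he)
      rw [abs_mul, abs_mul, abs_mul, abs_of_pos h0]
      calc |4 - 2 * l i| * ψ * |g| * |dirDeriv (e i, 0) (speed σ u) p| ≤
            (4 + 2 * (1 + M ^ 2)) * M * 1 * (η * (2 * r)) := by gcongr
        _ = _ := by ring
    -- The source of positivity: `w ≥ 1` leaves a full `σ`, and the negative part is proportional to
    -- `l i`, so that after weighting by `φ i` it sums to a multiple of `B`.
    have t3 : σ - l i * (σ * (M + (1 + M ^ 2))) ≤ (1 - l i) * (σ * (w + l i / w)) := by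
      have a1 : l i / w ≤ 1 + M ^ 2 := (div_le_self hl0.le hw1).trans hl
      have a2 : 0 ≤ l i / w := by positivity
      have a3 : 1 - l i * (M + (1 + M ^ 2)) ≤ (1 - l i) * (w + l i / w) := by
        nlinarith [mul_le_mul_of_nonneg_left (add_le_add hw a1) hl0.le]
      nlinarith [mul_le_mul_of_nonneg_left a3 hσ.le]
    have t4 : -(2 * (η * r ^ 2)) ≤ -((1 - l i) * (2 * b * (1 - g ^ 2))) := by
      have a1 : 0 ≤ b * (1 - g ^ 2) := mul_nonneg hB0 (by linarith)
      have a2 : b * (1 - g ^ 2) ≤ b := mul_le_of_le_one_right hB0 (by nlinarith)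
      nlinarith [mul_nonneg hl0.le a1]
    have := mul_le_mul_of_nonneg_left (add_le_add (add_le_add (add_le_add t1 t2) t3) t4) hφ.le
    refine le_trans (le_of_eq ?_) (this.trans (le_of_eq ?_)) <;> ring
  have hsum := Finset.sum_le_sum fun i (_ : i ∈ Finset.univ) => hterm i
  rw [Finset.sum_sub_distrib, ← Finset.sum_mul, ← Finset.sum_mul, F.sum_partial_mul hf] at hsum
  have hz : σ * ψ * dirDeriv (gradVec u p, 0) (speed σ u) p / w ≤ σ * M * (η * (2 * r)) := by
    rw [div_le_iff₀ hw0]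
    have a1 := (le_abs_self _).trans (hB1 (gradVec u p))
    have a2 : dirDeriv (gradVec u p, 0) (speed σ u) p ≤ η * (2 * r) * w :=
      a1.trans (mul_le_mul_of_nonneg_left (norm_gradVec_le h) (by positivity))
    calc σ * ψ * dirDeriv (gradVec u p, 0) (speed σ u) p ≤ σ * ψ * (η * (2 * r) * w) := by gcongr
      _ ≤ σ * M * (η * (2 * r) * w) := by gcongr
      _ = _ := by ring
  have hT := F.one_le_sum_partial hf
  have hbb : b * (σ * (M + (1 + M ^ 2))) ≤ η * r ^ 2 * (σ * (M + (1 + M ^ 2))) := by gcongr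
  have hC : 0 ≤ σ - η * (2 * M ^ 2 + (4 + 2 * (1 + M ^ 2)) * M * (2 * r) + 2 * r ^ 2) -
      η * (σ * (M + (1 + M ^ 2)) * r ^ 2 + σ * M * (2 * r)) := by
    rw [barrierConst] at hsmall
    linarith
  have hC' : 0 ≤ η * (σ * (M + (1 + M ^ 2)) * r ^ 2 + σ * M * (2 * r)) := by positivity
  -- The good term is multiplied by `∑ φ i`, while the errors from Euler's identity and from the
  -- derivative along `Du` are not; `∑ φ i ≥ 1` lets the former dominate.
  have hTC := mul_le_mul_of_nonneg_right hT (sub_nonneg.1 hC |> hC'.trans)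
  linarith

end Convexity

/-! ### Local barrier argument for the speed -/

section ConvexityPreserved

variable {n : ℕ} {f : (Fin n → ℝ) → ℝ} {σ ε : ℝ} {T : EReal}
  {Ω : Set (EuclideanSpace ℝ (Fin n))} {u₀ : EuclideanSpace ℝ (Fin n) → ℝ}
  {u : EuclideanSpace ℝ (Fin n) → ℝ → ℝ}

theorem IsSolution.speed_nonneg (hf : IsCurvatureFunction f) (hu : IsSolution f σ ε T Ω u₀ u)
    {x : EuclideanSpace ℝ (Fin n)} (hx : x ∈ Ω) {t : ℝ} (ht : t ∈ timeInterval T) :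
    0 ≤ stSlope u (x, t) * f (principalCurvatures (fun y => u y t) x) :=
  mul_nonneg stSlope_pos.le (hf.nonneg (hu.curvature_mem x hx t ht))

theorem IsSolution.continuousOn_speed (hu : IsSolution f σ ε T Ω u₀ u) (hΩ : IsOpen Ω) :
    ContinuousOn (fun p : EuclideanSpace ℝ (Fin n) × ℝ =>
      stSlope u p * f (principalCurvatures (fun y => u y p.2) p.1)) (Ω ×ˢ timeInterval T) :=
  (hu.continuousOn_stSlope hΩ).mul (hu.continuousOn_curvature hΩ)

/-- The curvatures already lie in the closed cone, on whose boundary `f` vanishes, so positivity of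
`f` excludes exactly the degenerate points. -/
theorem IsSolution.strictlyConvexAt_iff (hf : IsCurvatureFunction f)
    (hu : IsSolution f σ ε T Ω u₀ u) (hΩ : IsOpen Ω) {x : EuclideanSpace ℝ (Fin n)} (hx : x ∈ Ω)
    {t : ℝ} (ht : t ∈ timeInterval T) :
    StrictlyConvexAt (fun y => u y t) x ↔ 0 < f (principalCurvatures (fun y => u y t) x) := by
  rw [HypFlow.strictlyConvexAt_iff (hu.pos x (subset_closure hx) t ht)
    (contDiffAt_two_of_infty (hu.contDiffAt_slice hΩ hx ht))]
  exact ⟨hf.pos _, hf.mem_posCone (hu.curvature_mem x hx t ht)⟩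

theorem eventually_timeInterval {t : ℝ} (ht : t ∈ timeInterval T) (ht0 : 0 < t) :
    ∀ᶠ t' in 𝓝 t, t' ∈ timeInterval T ∧ 0 < t' := by
  obtain ⟨t₁, ht₁, hlt⟩ := exists_gt_mem_timeInterval ht
  filter_upwards [Ioo_mem_nhds ht0 hlt] with s hs
  exact ⟨mem_timeInterval_of_le ht₁ hs.1.le hs.2.le, hs.1⟩

/-- The speed cannot touch a small multiple of the barrier from above. -/
theorem IsSolution.not_contact (hf : IsCurvatureFunction f) (hu : IsSolution f σ ε T Ω u₀ u)
    (hΩ : IsOpen Ω) (hσ : 0 < σ) {x₀ : EuclideanSpace ℝ (Fin n)} {r M η s : ℝ} (hr : 0 < r)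
    (hball : Metric.closedBall x₀ r ⊆ Ω) (hη : 0 < η) (hs : 0 < s)
    (hsmall : η * barrierConst σ M r ≤ σ) {x : EuclideanSpace ℝ (Fin n)}
    (hx : x ∈ Metric.closedBall x₀ r) {t : ℝ} (ht : t ∈ timeInterval T) (ht0 : 0 < t)
    (hM : u x t ≤ M) (hw : stSlope u (x, t) ≤ M)
    (h2 : ∀ y : EuclideanSpace ℝ (Fin n), ‖y‖ ≤ 1 →
      |dirDeriv (y, 0) (dirDeriv (y, 0) (Function.uncurry u)) (x, t)| ≤ M)
    (hzero : stSlope u (x, t) * f (principalCurvatures (fun y => u y t) x) -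
      η * ballBarrier x₀ r (x, t) + s * (1 + t) = 0)
    (hnonneg : ∀ y ∈ Metric.closedBall x₀ r, 0 ≤
      stSlope u (y, t) * f (principalCurvatures (fun z => u z t) y) -
        η * ballBarrier x₀ r (y, t) + s * (1 + t))
    (hbefore : ∀ t' ∈ Set.Ico 0 t, 0 <
      stSlope u (x, t') * f (principalCurvatures (fun z => u z t') x) -
        η * ballBarrier x₀ r (x, t') + s * (1 + t')) : False := by
  have hxΩ := hball hx
  have hsm := hu.smoothNear hΩ hxΩ ht ht0
  have hpos := hu.eventually_pos hΩ hxΩ ht ht0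
  have hB := smoothNear_speed (σ := σ) hsm hpos
  have hBeq := hu.speed_eq hΩ hxΩ ht ht0
  have hB0 : 0 ≤ speed σ u (x, t) := hBeq ▸ hu.speed_nonneg hf hxΩ ht
  rw [← hBeq] at hzero
  -- At the contact `η ρ = B + s (1 + t) > 0`, so the point lies in the open ball and spatial
  -- derivatives can be compared.
  have hρ : 0 < ballBarrier x₀ r (x, t) := by
    by_contra hcon
    nlinarith [mul_pos hs (by linarith : 0 < 1 + t)]
  have hd : ‖x - x₀‖ < r := by
    rw [ballBarrier] at hρ
    exact lt_of_pow_lt_pow_left₀ 2 hr.le (by simpa using hρ)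
  have hnear : ∀ᶠ t' in 𝓝 t, t' ∈ timeInterval T ∧ 0 < t' := eventually_timeInterval ht ht0
  -- The perturbation `s (1 + t)` supplies the strict sign: the ball barrier does not depend on
  -- time.
  have htime : dirDeriv (0, 1) (speed σ u) (x, t) ≤ -s := by
    have h1 : HasDerivAt (fun t' => speed σ u (x, t')) (dirDeriv (0, 1) (speed σ u) (x, t)) t :=
      deriv_time (u := fun y t' => speed σ u (y, t')) hB.differentiableAt
    have h3 : HasDerivAt (fun t' : ℝ => speed σ u (x, t') - η * (r ^ 2 - ‖x - x₀‖ ^ 2) +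
        s * (1 + t')) (dirDeriv (0, 1) (speed σ u) (x, t) + s * 1) t :=
      (h1.sub_const _).add (((hasDerivAt_id t).const_add 1).const_mul s)
    have h4 : HasDerivWithinAt (fun t' : ℝ =>
        stSlope u (x, t') * f (principalCurvatures (fun z => u z t') x) -
        η * ballBarrier x₀ r (x, t') + s * (1 + t'))
        (dirDeriv (0, 1) (speed σ u) (x, t) + s * 1) (Set.Iio t) t := by
      refine (h3.congr_of_eventuallyEq ?_).hasDerivWithinAt
      filter_upwards [hnear] with t' ht'
      rw [hu.speed_eq hΩ hxΩ ht'.1 ht'.2, ballBarrier]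
    have h5 := deriv_nonpos_of_pos_before ht0 h4 (by rw [← hBeq]; exact hzero) hbefore
    linarith
  -- Where `B = 0` no principal frame is available, but `B ≥ 0` then has a minimum in time, so its
  -- time derivative vanishes and contradicts `-s < 0`.
  rcases hB0.eq_or_lt with hB0 | hB0
  · have h1 : HasDerivAt (fun t' => speed σ u (x, t')) (dirDeriv (0, 1) (speed σ u) (x, t)) t :=
      deriv_time (u := fun y t' => speed σ u (y, t')) hB.differentiableAt
    have h3 : IsLocalMin (fun t' => speed σ u (x, t')) t := by
      filter_upwards [hnear] with t' ht'
      rw [← hB0, hu.speed_eq hΩ hxΩ ht'.1 ht'.2]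
      exact hu.speed_nonneg hf hxΩ ht'.1
    linarith [h3.hasDerivAt_eq_zero h1]
  have hκ : 0 < f (principalCurvatures (fun y => u y t) x) :=
    pos_of_mul_pos_right (hBeq ▸ hB0) stSlope_pos.le
  obtain ⟨e, l, φ, F⟩ := hu.exists_principalFrame hf hΩ hxΩ ht ht0 hκ
  have hηρ : SmoothNear (fun q => η * ballBarrier x₀ r q) (x, t) :=
    (SmoothNear.const η).mul smoothNear_ballBarrier
  have hmin : IsLocalMin (fun y => speed σ u (y, t) - η * ballBarrier x₀ r (y, t)) x := by
    filter_upwards [Metric.isOpen_ball.mem_nhds (mem_ball_iff_norm.2 hd)] with y hy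
    have hy' := Metric.ball_subset_closedBall hy
    have := hnonneg y hy'
    rw [← hu.speed_eq hΩ (hball hy') ht ht0] at this
    linarith
  have hslice := slice_min (hB.sub hηρ) hmin
  have e1 : ∀ q, SmoothNear (speed σ u) q → ∀ y : EuclideanSpace ℝ (Fin n),
      dirDeriv (y, 0) (fun q => speed σ u q - η * ballBarrier x₀ r q) q =
      dirDeriv (y, 0) (speed σ u) q - η * dirDeriv (y, 0) (ballBarrier x₀ r) q := by
    intro q hq y
    rw [dirDeriv_sub hq.differentiableAt
      ((SmoothNear.const η).mul smoothNear_ballBarrier).differentiableAt,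
      dirDeriv_mul (differentiableAt_const _) smoothNear_ballBarrier.differentiableAt,
      dirDeriv_const]
    ring
  have e2 : ∀ y : EuclideanSpace ℝ (Fin n),
      dirDeriv (y, 0) (dirDeriv (y, 0) fun q => speed σ u q - η * ballBarrier x₀ r q) (x, t) =
      dirDeriv (y, 0) (dirDeriv (y, 0) (speed σ u)) (x, t) -
        η * dirDeriv (y, 0) (dirDeriv (y, 0) (ballBarrier x₀ r)) (x, t) := by
    intro y
    have hb : SmoothNear (dirDeriv (y, 0) (ballBarrier x₀ r)) (x, t) :=
      smoothNear_ballBarrier.dirDeriv _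
    rw [dirDeriv_congr (hB.eventually.mono fun q hq => e1 q hq y),
      dirDeriv_sub (hB.dirDeriv _).differentiableAt
        ((SmoothNear.const η).mul hb).differentiableAt,
      dirDeriv_mul (differentiableAt_const _) hb.differentiableAt, dirDeriv_const]
    ring
  have hnn := F.speed_time_nonneg hf hsm hpos hσ (r := r) (η := η) hM hw h2 hr.le hη.le ?_
    (fun y => ?_) (fun y hy => ?_) hsmall
  · linarith
  · have : ballBarrier x₀ r (x, t) ≤ r ^ 2 := by
      rw [ballBarrier]; linarith [sq_nonneg ‖x - x₀‖]
    nlinarith [mul_pos hs (by linarith : 0 < 1 + t)]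
  · have h3 := (hslice y).1
    rw [e1 _ hB, dirDeriv_ballBarrier, sub_eq_zero] at h3
    rw [h3, abs_mul, abs_of_pos hη, mul_assoc]
    refine mul_le_mul_of_nonneg_left ?_ hη.le
    rw [abs_mul, abs_neg, abs_two, mul_assoc]
    have := (abs_real_inner_le_norm (x - x₀) y).trans
      (mul_le_mul_of_nonneg_right hd.le (norm_nonneg y))
    dsimp only
    linarith
  · have h3 := (hslice y).2
    rw [e2, dirDeriv_dirDeriv_ballBarrier] at h3
    have : ‖y‖ ^ 2 ≤ 1 := pow_le_one₀ (norm_nonneg _) hy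
    dsimp only at h3
    nlinarith

/-- Strict local convexity is preserved along the flow. -/
theorem IsSolution.strictlyConvexAt (hf : IsCurvatureFunction f) (hu : IsSolution f σ ε T Ω u₀ u)
    (hΩ : IsOpen Ω) (hσ : 0 < σ) (h0 : ∀ x ∈ Ω, StrictlyConvexAt (fun y => u y 0) x)
    {τ : ℝ} (hτ : τ ∈ timeInterval T) {x₀ : EuclideanSpace ℝ (Fin n)} (hx₀ : x₀ ∈ Ω) :
    StrictlyConvexAt (fun y => u y τ) x₀ := by
  rw [hu.strictlyConvexAt_iff hf hΩ hx₀ hτ]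
  obtain ⟨r, hr, hball⟩ := Metric.nhds_basis_closedBall.mem_iff.1 (hΩ.mem_nhds hx₀)
  have hK : IsCompact (Metric.closedBall x₀ r) := isCompact_closedBall x₀ r
  obtain ⟨M, hM1, hM⟩ := hu.exists_derivative_bounds hΩ hK hball hτ
  have hz : (0 : ℝ) ∈ timeInterval T := mem_timeInterval_of_le hτ le_rfl hτ.1
  have hcs := hu.continuousOn_speed hΩ
  have hc0 : ContinuousOn (fun x => stSlope u (x, 0) *
      f (principalCurvatures (fun y => u y 0) x)) (Metric.closedBall x₀ r) :=
    hcs.comp (continuous_id.prodMk continuous_const).continuousOn fun x hx => ⟨hball hx, hz⟩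
  obtain ⟨x₁, hx₁, hmin⟩ := hK.exists_isMinOn ⟨x₀, Metric.mem_closedBall_self hr.le⟩ hc0
  set b := stSlope u (x₁, 0) * f (principalCurvatures (fun y => u y 0) x₁) with hb
  have hb0 : 0 < b := mul_pos stSlope_pos
    ((hu.strictlyConvexAt_iff hf hΩ (hball hx₁) hz).1 (h0 x₁ (hball hx₁)))
  have hC : 0 < barrierConst σ M r := by
    have : 0 < M := by linarith
    rw [barrierConst]; positivity
  -- The first bound makes the barrier estimate applicable; the second places the barrier below the
  -- initial speed.
  set η := min (σ / barrierConst σ M r) (b / r ^ 2) with hηdef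
  have hη : 0 < η := lt_min (by positivity) (by positivity)
  have hη1 : η * barrierConst σ M r ≤ σ := (le_div_iff₀ hC).1 (min_le_left _ _)
  have hη2 : η * r ^ 2 ≤ b := (le_div_iff₀ (by positivity)).1 (min_le_right _ _)
  have key : ∀ s > 0, 0 < stSlope u (x₀, τ) * f (principalCurvatures (fun y => u y τ) x₀) -
      η * ballBarrier x₀ r (x₀, τ) + s * (1 + τ) := by
    intro s hs
    refine pos_of_no_contact (h := fun x t => stSlope u (x, t) *
      f (principalCurvatures (fun y => u y t) x) - η * ballBarrier x₀ r (x, t) + s * (1 + t))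
      hK (τ := τ) ?_ (fun x hx => ?_) (fun x hx t ht hzero hnn hbef => ?_) x₀
      (Metric.mem_closedBall_self hr.le) τ ⟨hτ.1, le_rfl⟩
    · have h1 := hcs.mono (Set.prod_mono hball (Icc_subset_timeInterval hτ))
      refine (h1.sub (continuous_const.mul contDiff_ballBarrier.continuous).continuousOn).add ?_
      exact (continuous_const.mul (continuous_const.add continuous_snd)).continuousOn
    · have h1 : b ≤ _ := hmin hx
      have h2 : ballBarrier x₀ r (x, 0) ≤ r ^ 2 := by
        rw [ballBarrier]; linarith [sq_nonneg ‖x - x₀‖]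
      have h3 := mul_le_mul_of_nonneg_left h2 hη.le
      dsimp only at h1 ⊢
      linarith
    · have ht' : t ∈ timeInterval T := mem_timeInterval_of_le hτ ht.1.le ht.2
      obtain ⟨m1, -, m3, -, m5⟩ := hM x hx t ht
      exact hu.not_contact hf hΩ hσ hr hball hη hs hη1 hx ht' ht.1 m1 m3 m5 hzero hnn hbef
  have hlim : η * r ^ 2 ≤
      stSlope u (x₀, τ) * f (principalCurvatures (fun y => u y τ) x₀) := by
    refine le_of_forall_pos_le_add fun s hs => ?_
    have h1τ : 0 < 1 + τ := by linarith [hτ.1]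
    have := key (s / (1 + τ)) (by positivity)
    rw [div_mul_cancel₀ _ h1τ.ne'] at this
    simp only [ballBarrier, sub_self, norm_zero] at this
    linarith
  exact pos_of_mul_pos_right ((by positivity : 0 < η * r ^ 2).trans_le hlim) stSlope_pos.le

end ConvexityPreserved

/-! ### Strict positivity of the velocity -/

section Ellipticity

variable {n : ℕ} {f : (Fin n → ℝ) → ℝ}

/-- Uniform ellipticity on compact subsets of the cone. -/
theorem IsCurvatureFunction.exists_partial_bounds (hf : IsCurvatureFunction f) {σ : ℝ}
    (hσ : 0 < σ) (Λ : ℝ) : ∃ c > 0, ∃ C, ∀ l ∈ posCone n, (∀ i, l i ≤ Λ) → σ ≤ f l →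
      (∀ i, c ≤ fderiv ℝ f l (Pi.single i 1)) ∧ ∑ i, fderiv ℝ f l (Pi.single i 1) ≤ C := by
  -- Compact and contained in the open cone, because `f = 0 < σ` on the boundary of the cone.
  set S : Set (Fin n → ℝ) := {l ∈ Set.Icc (fun _ => 0) (fun _ => Λ) | σ ≤ f l} with hS
  have hbox : Set.Icc (fun _ => 0) (fun _ => Λ) ⊆ closure (posCone n) := fun l hl => by
    rw [closure_posCone]; exact hl.1
  have hcl : IsClosed S :=
    (hf.continuousOn.mono hbox).preimage_isClosed_of_isClosed isClosed_Icc isClosed_Ici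
  have hcomp : IsCompact S := isCompact_Icc.of_isClosed_subset hcl fun l hl => hl.1
  have hpos : S ⊆ posCone n := fun l hl => hf.mem_posCone (hbox hl.1) (hσ.trans_le hl.2)
  have hshift : ∀ l ∈ posCone n, ∀ i, l + Pi.single i 1 ∈ posCone n := fun l hl i j => by
    by_cases hij : j = i
    · subst hij; simpa using add_pos (hl j) one_pos
    · simpa [hij] using hl j
  have hfc : ContinuousOn f (posCone n) := hf.continuousOn.mono subset_closure
  have hlow : ∀ i, ∃ c > 0, ∀ l ∈ S, c ≤ fderiv ℝ f l (Pi.single i 1) := by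
    intro i
    rcases S.eq_empty_or_nonempty with he | hne
    · exact ⟨1, one_pos, fun l hl => by simp [he] at hl⟩
    -- By concavity this continuous increment bounds the `i`-th partial derivative from below, so
    -- continuity of the derivative is not needed.
    have hg : ContinuousOn (fun l => f (l + Pi.single i 1) - f l) S :=
      (hfc.comp (continuous_id.add continuous_const).continuousOn
        fun l hl => hshift l (hpos hl) i).sub (hfc.mono hpos)
    obtain ⟨m, hm, hmin⟩ := hcomp.exists_isMinOn hne hg
    have hm' := hshift m (hpos hm) i
    refine ⟨f (m + Pi.single i 1) - f m, ?_, fun l hl => (hmin hl).trans ?_⟩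
    · have h1 := hf.le_tangent hm' (hpos hm)
      rw [sub_add_cancel_left, map_neg] at h1
      linarith [hf.partial_pos _ hm' i]
    · have h1 := hf.le_tangent (hpos hl) (hshift l (hpos hl) i)
      rw [add_sub_cancel_left] at h1
      dsimp only
      linarith
  have hup : ∀ i, ∃ C, ∀ l ∈ S, fderiv ℝ f l (Pi.single i 1) ≤ C := by
    intro i
    -- By Euler's identity one summand `f_i * l i` is at most `f`, so this quotient bounds `f_i`
    -- from above.
    have hg : ContinuousOn (fun l : Fin n → ℝ => f l / l i) S :=
      (hfc.mono hpos).div (continuous_apply i).continuousOn fun l hl => (hpos hl i).ne'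
    obtain ⟨C, hC⟩ := hcomp.exists_bound_of_continuousOn hg
    refine ⟨C, fun l hl => le_trans ?_ ((le_abs_self _).trans (hC l hl))⟩
    rw [le_div_iff₀ (hpos hl i), ← hf.sum_partial_mul (hpos hl)]
    exact Finset.single_le_sum (f := fun i => fderiv ℝ f l (Pi.single i 1) * l i)
      (fun j _ => mul_nonneg (hf.partial_pos l (hpos hl) j).le (hpos hl j).le)
      (Finset.mem_univ i)
  choose c hc hc' using hlow
  choose C hC using hup
  have hmem : ∀ l ∈ posCone n, (∀ i, l i ≤ Λ) → σ ≤ f l → l ∈ S := fun l hl h1 h2 =>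
    ⟨⟨fun i => (hl i).le, h1⟩, h2⟩
  obtain ⟨c₀, hc₀, hle⟩ : ∃ c₀ > 0, ∀ i, c₀ ≤ c i := by
    rcases isEmpty_or_nonempty (Fin n) with he | hne
    · exact ⟨1, one_pos, fun i => he.elim i⟩
    · obtain ⟨i₀, hi₀⟩ := Finite.exists_min c
      exact ⟨c i₀, hc i₀, hi₀⟩
  exact ⟨c₀, hc₀, ∑ i, C i, fun l hl h1 h2 => ⟨fun i => (hle i).trans (hc' i l (hmem l hl h1 h2)),
    Finset.sum_le_sum fun i _ => hC i l (hmem l hl h1 h2)⟩⟩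

end Ellipticity

/-! ### Evolution of `u u_t` -/

section Velocity

variable {n : ℕ} {f : (Fin n → ℝ) → ℝ} {σ : ℝ} {u : EuclideanSpace ℝ (Fin n) → ℝ → ℝ}
  {B : EuclideanSpace ℝ (Fin n) × ℝ → ℝ} {p : EuclideanSpace ℝ (Fin n) × ℝ}
  {e : Fin n → EuclideanSpace ℝ (Fin n)} {l φ : Fin n → ℝ}

theorem formG_sum {ψ : EuclideanSpace ℝ (Fin n) × ℝ → ℝ} (c : Fin n → ℝ)
    (e : Fin n → EuclideanSpace ℝ (Fin n)) (y : EuclideanSpace ℝ (Fin n)) :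
    formG ψ (∑ i, c i • e i) y p = ∑ i, c i * formG ψ (e i) y p := by
  have h1 : ((∑ i, c i • e i : EuclideanSpace ℝ (Fin n)), (0 : ℝ)) = ∑ i, c i • (e i, (0 : ℝ)) := by
    ext j
    · simp [Prod.fst_sum]
    · simp [Prod.snd_sum]
  simp only [formG, dirDeriv, h1, map_sum, map_smul, smul_eq_mul, sum_inner, real_inner_smul_left,
    mul_add, Finset.sum_add_distrib, Finset.sum_mul]
  simp only [mul_assoc]

/-- The frame is orthonormal for `g`, not for the Euclidean product. Expanding `d` in it and using
Cauchy–Schwarz with `g(d, d) ≤ w² |d|²` shows that its Euclidean products still control `d`. -/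
theorem IsPrincipalFrame.norm_sq_le (F : IsPrincipalFrame f (Function.uncurry u) B p e l φ)
    (h : SmoothNear (Function.uncurry u) p) (d : EuclideanSpace ℝ (Fin n)) :
    ‖d‖ ^ 2 ≤ stSlope u p ^ 2 * ∑ i, inner ℝ d (e i) ^ 2 := by
  have h1 : ‖d‖ ^ 2 = ∑ i, formG (Function.uncurry u) (e i) d p * inner ℝ d (e i) := by
    have : inner ℝ d d = inner ℝ d (∑ i, formG (Function.uncurry u) (e i) d p • e i) :=
      congrArg _ (F.expand d)
    rw [inner_sum] at this
    simp only [real_inner_smul_right] at this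
    rw [← this, real_inner_self_eq_norm_sq]
  have h2 : ∑ i, formG (Function.uncurry u) (e i) d p ^ 2 ≤ stSlope u p ^ 2 * ‖d‖ ^ 2 := by
    have e1 : formG (Function.uncurry u) d d p =
        ∑ i, formG (Function.uncurry u) (e i) d p * formG (Function.uncurry u) (e i) d p := by
      rw [← formG_sum, ← F.expand d]
    have e2 : dirDeriv (d, 0) (Function.uncurry u) p ^ 2 ≤ ‖d‖ ^ 2 * (stSlope u p ^ 2 - 1) := by
      have h3 := inner_gradVec h (gradVec u p)
      rw [real_inner_self_eq_norm_sq, dirDeriv_gradVec_self h] at h3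
      rw [← inner_gradVec h, ← h3, ← mul_pow, ← sq_abs]
      exact pow_le_pow_left₀ (abs_nonneg _) (abs_real_inner_le_norm _ _) 2
    simp only [sq (formG _ _ _ _), ← e1]
    rw [formG, real_inner_self_eq_norm_sq]
    linarith
  have h3 := Finset.sum_mul_sq_le_sq_mul_sq Finset.univ
    (fun i => formG (Function.uncurry u) (e i) d p) (fun i => inner ℝ d (e i))
  rw [← h1] at h3
  rcases (sq_nonneg ‖d‖).eq_or_lt with h0 | h0
  · rw [← h0]
    exact mul_nonneg (sq_nonneg _) (Finset.sum_nonneg fun i _ => sq_nonneg _)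
  · have h4 : ‖d‖ ^ 2 * ‖d‖ ^ 2 ≤
        ‖d‖ ^ 2 * (stSlope u p ^ 2 * ∑ i, inner ℝ d (e i) ^ 2) := by
      calc ‖d‖ ^ 2 * ‖d‖ ^ 2 = (‖d‖ ^ 2) ^ 2 := (sq _).symm
        _ ≤ _ := h3
        _ ≤ stSlope u p ^ 2 * ‖d‖ ^ 2 * ∑ i, inner ℝ d (e i) ^ 2 :=
          mul_le_mul_of_nonneg_right h2 (Finset.sum_nonneg fun i _ => sq_nonneg _)
        _ = _ := by ring
    exact le_of_mul_le_mul_left h4 h0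

/-- The function `u u_t`. -/
def velocity (u : EuclideanSpace ℝ (Fin n) → ℝ → ℝ) (p : EuclideanSpace ℝ (Fin n) × ℝ) : ℝ :=
  Function.uncurry u p * dirDeriv (0, 1) (Function.uncurry u) p

theorem smoothNear_velocity (h : SmoothNear (Function.uncurry u) p) : SmoothNear (velocity u) p :=
  h.mul (h.dirDeriv _)

theorem dirDeriv_velocity (h : SmoothNear (Function.uncurry u) p)
    (a : EuclideanSpace ℝ (Fin n) × ℝ) :
    dirDeriv a (velocity u) p =
      dirDeriv a (Function.uncurry u) p * dirDeriv (0, 1) (Function.uncurry u) p +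
      Function.uncurry u p * dirDeriv a (dirDeriv (0, 1) (Function.uncurry u)) p :=
  dirDeriv_mul h.differentiableAt (h.dirDeriv _).differentiableAt

theorem dirDeriv_dirDeriv_velocity (h : SmoothNear (Function.uncurry u) p)
    (a : EuclideanSpace ℝ (Fin n) × ℝ) :
    dirDeriv a (dirDeriv a (velocity u)) p =
      dirDeriv a (dirDeriv a (Function.uncurry u)) p * dirDeriv (0, 1) (Function.uncurry u) p +
      2 * dirDeriv a (Function.uncurry u) p *
        dirDeriv a (dirDeriv (0, 1) (Function.uncurry u)) p +
      Function.uncurry u p * dirDeriv a (dirDeriv a (dirDeriv (0, 1) (Function.uncurry u))) p := by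
  have h1 := h.dirDeriv a
  have h2 := h.dirDeriv (0, 1)
  have h3 := h2.dirDeriv a
  rw [dirDeriv_congr (h.eventually.mono fun q hq => dirDeriv_velocity hq a),
    dirDeriv_add (h1.mul h2).differentiableAt (h.mul h3).differentiableAt,
    dirDeriv_mul h1.differentiableAt h2.differentiableAt,
    dirDeriv_mul h.differentiableAt h3.differentiableAt]
  ring

/-- The evolution equation of `u u_t`. -/
theorem IsPrincipalFrame.velocity_evolution
    (F : IsPrincipalFrame f (Function.uncurry u) (speed σ u) p e l φ)
    (h : SmoothNear (Function.uncurry u) p) (hpos : ∀ᶠ q in 𝓝 p, 0 < Function.uncurry u q) :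
    dirDeriv (0, 1) (velocity u) p =
      2 * dirDeriv (0, 1) (Function.uncurry u) p ^ 2 + Function.uncurry u p ^ 2 *
        ∑ i, φ i * (dirDeriv (e i, 0) (dirDeriv (e i, 0) (velocity u)) p -
          2 * l i * dirDeriv (e i, 0) (Function.uncurry u) p *
            dirDeriv (e i, 0) (dirDeriv (0, 1) (Function.uncurry u)) p) -
      σ * Function.uncurry u p ^ 2 * dirDeriv (0, 1) (stSlope u) p := by
  have hu0 : Function.uncurry u p ≠ 0 := hpos.self_of_nhds.ne'
  have hB := smoothNear_speed (σ := σ) h hpos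
  have hw := smoothNear_stSlope h
  have hD : SmoothNear (fun q => speed σ u q - σ * stSlope u q) p :=
    hB.sub ((SmoothNear.const σ).mul hw)
  have hv : dirDeriv (0, 1) (Function.uncurry u) =ᶠ[𝓝 p]
      (fun q => Function.uncurry u q * (speed σ u q - σ * stSlope u q)) := by
    filter_upwards [hpos] with q hq
    rw [speed, add_sub_cancel_right]
    field_simp
  -- The reason for the factor `u`: two derivatives of `u u_t` reproduce the variation of `B` up to
  -- a first-order term in `u_t`, with no leftover multiple of `u_t`.
  have h1 : ∀ i, dirDeriv (e i, 0) (dirDeriv (e i, 0) (velocity u)) p -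
      2 * l i * dirDeriv (e i, 0) (Function.uncurry u) p *
        dirDeriv (e i, 0) (dirDeriv (0, 1) (Function.uncurry u)) p =
      2 * (1 - l i) * dirDeriv (e i, 0) (Function.uncurry u) p *
          dirDeriv (e i, 0) (dirDeriv (0, 1) (Function.uncurry u)) p +
        dirDeriv (0, 1) (Function.uncurry u) p *
          dirDeriv (e i, 0) (dirDeriv (e i, 0) (Function.uncurry u)) p +
        Function.uncurry u p *
          dirDeriv (e i, 0) (dirDeriv (e i, 0) (dirDeriv (0, 1) (Function.uncurry u))) p := by
    intro i
    rw [dirDeriv_dirDeriv_velocity h]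
    ring
  simp only [h1]
  rw [← F.time_variation h (Filter.EventuallyEq.refl _ _), dirDeriv_velocity h, dirDeriv_congr hv,
    dirDeriv_mul h.differentiableAt hD.differentiableAt,
    dirDeriv_sub hB.differentiableAt ((SmoothNear.const σ).mul hw).differentiableAt,
    dirDeriv_mul (differentiableAt_const _) hw.differentiableAt, dirDeriv_const]
  linear_combination (-dirDeriv (0, 1) (Function.uncurry u) p) * hv.self_of_nhds

/-- The constant in the barrier estimate for the velocity. -/
def velocityConst (σ M r C : ℝ) : ℝ :=
  4 * M ^ 2 * C + C * (2 * M * (1 + M ^ 2) * (4 * r + M * r ^ 2)) + 4 * σ * M * r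

/-- Here `Q ρ²` is the barrier at the contact, with `d = x - x₀`. Its Hessian contains `8 Q d ⊗ d`,
which ellipticity and `norm_sq_le` turn into a positive multiple of `|d|² = r² - ρ`; all other terms
carry a factor `ρ` or a good sign. -/
theorem IsPrincipalFrame.velocity_time_ge (hf : IsCurvatureFunction f)
    (F : IsPrincipalFrame f (Function.uncurry u) (speed σ u) p e l φ)
    (h : SmoothNear (Function.uncurry u) p) (hpos : ∀ᶠ q in 𝓝 p, 0 < Function.uncurry u q)
    (hσ : 0 < σ) {M r Q ρ c C : ℝ} {d : EuclideanSpace ℝ (Fin n)}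
    (hM : Function.uncurry u p ≤ M) (hM' : (Function.uncurry u p)⁻¹ ≤ M) (hw : stSlope u p ≤ M)
    (h2 : ∀ y : EuclideanSpace ℝ (Fin n), ‖y‖ ≤ 1 →
      |dirDeriv (y, 0) (dirDeriv (y, 0) (Function.uncurry u)) p| ≤ M)
    (hc : ∀ i, c ≤ φ i) (hc0 : 0 < c) (hC : ∑ i, φ i ≤ C)
    (hv : 0 ≤ dirDeriv (0, 1) (Function.uncurry u) p)
    (hr : 0 ≤ r) (hQ : 0 ≤ Q) (hρ : ρ = r ^ 2 - ‖d‖ ^ 2) (hρ0 : 0 ≤ ρ)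
    (hV : velocity u p ≤ Q * ρ ^ 2)
    (hV1 : ∀ y : EuclideanSpace ℝ (Fin n),
      dirDeriv (y, 0) (velocity u) p = -(4 * Q * ρ * inner ℝ d y))
    (hV2 : ∀ y : EuclideanSpace ℝ (Fin n), Q * (8 * inner ℝ d y ^ 2 - 4 * ρ * ‖y‖ ^ 2) ≤
      dirDeriv (y, 0) (dirDeriv (y, 0) (velocity u)) p) :
    Q * (8 * c / M ^ 4 * (r ^ 2 - ρ) - velocityConst σ M r C * ρ) ≤
      dirDeriv (0, 1) (velocity u) p := by
  have h0 : 0 < Function.uncurry u p := hpos.self_of_nhds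
  have hw1 : 1 ≤ stSlope u p := one_le_stSlope
  have hw0 : 0 < stSlope u p := stSlope_pos
  have hM1 : 1 ≤ M := hw1.trans hw
  have hM0 : 0 < M := by linarith
  have hdr : ‖d‖ ≤ r := abs_le_of_sq_le_sq' (by linarith) hr |>.2
  have hρr : ρ ≤ r ^ 2 := by rw [hρ]; linarith [sq_nonneg ‖d‖]
  have hV1' : ∀ y : EuclideanSpace ℝ (Fin n),
      |dirDeriv (y, 0) (velocity u) p| ≤ 4 * Q * ρ * r * ‖y‖ := by
    intro y
    rw [hV1, abs_neg, abs_mul, abs_of_nonneg (by positivity : 0 ≤ 4 * Q * ρ), mul_assoc _ r]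
    exact mul_le_mul_of_nonneg_left ((abs_real_inner_le_norm d y).trans
      (mul_le_mul_of_nonneg_right hdr (norm_nonneg y))) (by positivity)
  have hvM : dirDeriv (0, 1) (Function.uncurry u) p ≤ M * (Q * ρ * r ^ 2) := by
    have a1 : dirDeriv (0, 1) (Function.uncurry u) p = (Function.uncurry u p)⁻¹ * velocity u p := by
      rw [velocity]; field_simp
    have a2 : Q * ρ ^ 2 ≤ Q * ρ * r ^ 2 := by
      rw [sq, ← mul_assoc]; exact mul_le_mul_of_nonneg_left hρr (by positivity)
    have a3 : 0 ≤ velocity u p := mul_nonneg h0.le hv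
    rw [a1]
    exact mul_le_mul hM' (hV.trans a2) a3 hM0.le
  rw [F.velocity_evolution h hpos]
  have hgr : ∀ y : EuclideanSpace ℝ (Fin n), Function.uncurry u p *
      dirDeriv (y, 0) (dirDeriv (0, 1) (Function.uncurry u)) p = dirDeriv (y, 0) (velocity u) p -
        dirDeriv (y, 0) (Function.uncurry u) p *
          dirDeriv (0, 1) (Function.uncurry u) p := fun y => by
    rw [dirDeriv_velocity h]; ring
  have hzterm : σ * Function.uncurry u p ^ 2 * dirDeriv (0, 1) (stSlope u) p ≤
      Q * (4 * σ * M * r * ρ) := by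
    have a1 := stSlope_mul_dirDeriv (a := (0, 1)) h
    have a2 := hgr (gradVec u p)
    rw [dirDeriv_gradVec_self h, ← a1] at a2
    have a3 := (le_abs_self _).trans (hV1' (gradVec u p))
    have a4 : 4 * Q * ρ * r * ‖gradVec u p‖ ≤ 4 * Q * ρ * r * stSlope u p :=
      mul_le_mul_of_nonneg_left (norm_gradVec_le h) (by positivity)
    -- Since `u_t ≥ 0`, this zeroth-order part of `w_t` has the favourable sign and is dropped.
    have a5 : 0 ≤ (stSlope u p ^ 2 - 1) * dirDeriv (0, 1) (Function.uncurry u) p :=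
      mul_nonneg (by nlinarith) hv
    have a6 : stSlope u p * (Function.uncurry u p * dirDeriv (0, 1) (stSlope u) p) ≤
        stSlope u p * (4 * Q * ρ * r) := by linarith
    have a7 := le_of_mul_le_mul_left a6 hw0
    calc σ * Function.uncurry u p ^ 2 * dirDeriv (0, 1) (stSlope u) p =
          σ * Function.uncurry u p * (Function.uncurry u p * dirDeriv (0, 1) (stSlope u) p) := by
          ring
      _ ≤ σ * Function.uncurry u p * (4 * Q * ρ * r) := by gcongr
      _ ≤ σ * M * (4 * Q * ρ * r) := by gcongr
      _ = _ := by ring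
  have hterm : ∀ i, Function.uncurry u p ^ 2 * (8 * Q * c * inner ℝ d (e i) ^ 2) -
        φ i * (4 * Q * ρ * M ^ 2 + 2 * M * (1 + M ^ 2) * (4 * r + M * r ^ 2) * (Q * ρ)) ≤
      Function.uncurry u p ^ 2 * (φ i * (dirDeriv (e i, 0) (dirDeriv (e i, 0) (velocity u)) p -
          2 * l i * dirDeriv (e i, 0) (Function.uncurry u) p *
            dirDeriv (e i, 0) (dirDeriv (0, 1) (Function.uncurry u)) p)) := by
    intro i
    have hφ := F.partial_pos hf i
    have hl0 : 0 < l i := F.mem i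
    have hl : l i ≤ 1 + M ^ 2 := F.curvature_le h h0 hM h2 i
    have he := F.norm_le_one i
    have hg := F.abs_slope_le_one i
    have t1 : Function.uncurry u p ^ 2 * (8 * Q * inner ℝ d (e i) ^ 2) - 4 * Q * ρ * M ^ 2 ≤
        Function.uncurry u p ^ 2 * dirDeriv (e i, 0) (dirDeriv (e i, 0) (velocity u)) p := by
      have a1 := mul_le_mul_of_nonneg_left (hV2 (e i)) (sq_nonneg (Function.uncurry u p))
      have a2 : Function.uncurry u p ^ 2 * ‖e i‖ ^ 2 ≤ M ^ 2 * 1 := by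
        have : ‖e i‖ ^ 2 ≤ 1 := pow_le_one₀ (norm_nonneg _) he
        gcongr
      have a3 := mul_le_mul_of_nonneg_left a2 (by positivity : 0 ≤ 4 * Q * ρ)
      linarith
    have t2 : |Function.uncurry u p ^ 2 * (2 * l i * dirDeriv (e i, 0) (Function.uncurry u) p *
        dirDeriv (e i, 0) (dirDeriv (0, 1) (Function.uncurry u)) p)| ≤
        2 * M * (1 + M ^ 2) * (4 * r + M * r ^ 2) * (Q * ρ) := by
      have a0 : |Function.uncurry u p *
          dirDeriv (e i, 0) (dirDeriv (0, 1) (Function.uncurry u)) p| ≤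
          (4 * r + M * r ^ 2) * (Q * ρ) := by
        rw [hgr]
        refine (abs_sub _ _).trans ?_
        rw [abs_mul _ (dirDeriv (0, 1) (Function.uncurry u) p), abs_of_nonneg hv]
        have b1 := (hV1' (e i)).trans (mul_le_of_le_one_right (by positivity) he)
        have b2 := (mul_le_of_le_one_left hv hg).trans hvM
        linarith
      have a1 : Function.uncurry u p ^ 2 * (2 * l i * dirDeriv (e i, 0) (Function.uncurry u) p *
          dirDeriv (e i, 0) (dirDeriv (0, 1) (Function.uncurry u)) p) =
          2 * Function.uncurry u p * l i * dirDeriv (e i, 0) (Function.uncurry u) p *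
          (Function.uncurry u p * dirDeriv (e i, 0) (dirDeriv (0, 1) (Function.uncurry u)) p) := by
        ring
      rw [a1, abs_mul, abs_mul, abs_of_pos (by positivity : 0 < 2 * Function.uncurry u p * l i)]
      calc 2 * Function.uncurry u p * l i * |dirDeriv (e i, 0) (Function.uncurry u) p| *
            |Function.uncurry u p * dirDeriv (e i, 0) (dirDeriv (0, 1) (Function.uncurry u)) p| ≤
            2 * M * (1 + M ^ 2) * 1 * ((4 * r + M * r ^ 2) * (Q * ρ)) := by gcongr
        _ = _ := by ring
    have t3 := (le_abs_self _).trans t2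
    have t4 := mul_le_mul_of_nonneg_left (sub_le_sub t1 t3) hφ.le
    have t5 : Function.uncurry u p ^ 2 * (8 * Q * c * inner ℝ d (e i) ^ 2) ≤
        φ i * (Function.uncurry u p ^ 2 * (8 * Q * inner ℝ d (e i) ^ 2)) := by
      have := mul_le_mul_of_nonneg_right (hc i) (by positivity :
        0 ≤ Function.uncurry u p ^ 2 * (8 * Q * inner ℝ d (e i) ^ 2))
      linarith
    linarith
  have hsum := Finset.sum_le_sum fun i (_ : i ∈ Finset.univ) => hterm i
  rw [Finset.sum_sub_distrib, ← Finset.sum_mul, ← Finset.mul_sum, ← Finset.mul_sum,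
    ← Finset.mul_sum] at hsum
  have hmain : Q * (8 * c / M ^ 4 * (r ^ 2 - ρ)) ≤
      Function.uncurry u p ^ 2 * (8 * Q * c * ∑ i, inner ℝ d (e i) ^ 2) := by
    have a1 := F.norm_sq_le h d
    have a2 : r ^ 2 - ρ = ‖d‖ ^ 2 := by linarith
    -- One factor `M²` comes from `u ≥ 1 / M`, the other from `w ≤ M`; together they give `M ^ 4` in
    -- the constant.
    have a3 : 1 ≤ Function.uncurry u p ^ 2 * M ^ 2 := by
      have : 1 ≤ Function.uncurry u p * M := by
        have := mul_le_mul_of_nonneg_left hM' h0.le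
        rwa [mul_inv_cancel₀ h0.ne'] at this
      rw [← mul_pow]
      exact one_le_pow₀ this
    have a4 : 0 ≤ ∑ i, inner ℝ d (e i) ^ 2 := Finset.sum_nonneg fun i _ => sq_nonneg _
    have a5 : stSlope u p ^ 2 * ∑ i, inner ℝ d (e i) ^ 2 ≤ M ^ 2 * ∑ i, inner ℝ d (e i) ^ 2 := by
      gcongr
    have a6 : ‖d‖ ^ 2 ≤ (Function.uncurry u p ^ 2 * M ^ 2) * (M ^ 2 * ∑ i, inner ℝ d (e i) ^ 2) :=
      (a1.trans a5).trans (le_mul_of_one_le_left (by positivity) a3)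
    rw [a2, div_mul_eq_mul_div, mul_div_assoc', div_le_iff₀ (by positivity)]
    calc Q * (8 * c * ‖d‖ ^ 2) ≤ Q * (8 * c * ((Function.uncurry u p ^ 2 * M ^ 2) *
          (M ^ 2 * ∑ i, inner ℝ d (e i) ^ 2))) := by gcongr
      _ = _ := by ring
  have hCC : (∑ i, φ i) * (4 * Q * ρ * M ^ 2 + 2 * M * (1 + M ^ 2) * (4 * r + M * r ^ 2) * (Q * ρ))
      ≤ C * (4 * Q * ρ * M ^ 2 + 2 * M * (1 + M ^ 2) * (4 * r + M * r ^ 2) * (Q * ρ)) := by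
    gcongr
  rw [velocityConst]
  nlinarith [sq_nonneg (dirDeriv (0, 1) (Function.uncurry u) p)]

end Velocity

/-! ### Strong maximum principle for `u u_t` -/

section VelocityPositive

variable {n : ℕ} {f : (Fin n → ℝ) → ℝ} {σ ε : ℝ} {T : EReal}
  {Ω : Set (EuclideanSpace ℝ (Fin n))} {u₀ : EuclideanSpace ℝ (Fin n) → ℝ}
  {u : EuclideanSpace ℝ (Fin n) → ℝ → ℝ} {p : EuclideanSpace ℝ (Fin n) × ℝ}

/-- Forward difference quotients of a nondecreasing `u` are nonnegative, hence `u_t ≥ 0`; using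
times after `t` includes `t = 0`. -/
theorem IsAdmissibleSolution.le_curvature (hf : IsCurvatureFunction f)
    (hu : IsAdmissibleSolution f σ ε T Ω u₀ u) (hΩ : IsOpen Ω) (hbdd : Bornology.IsBounded Ω)
    (hu₀ : IsInitialHeight Ω u₀) (hσ : 0 < σ)
    (h0 : ∀ x ∈ Ω, σ < f (principalCurvatures (fun y => u y 0) x))
    {x : EuclideanSpace ℝ (Fin n)} (hx : x ∈ Ω) {t : ℝ} (ht : t ∈ timeInterval T) :
    σ ≤ f (principalCurvatures (fun y => u y t) x) := by
  obtain ⟨t', ht', hlt⟩ := exists_gt_mem_timeInterval ht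
  have h1 : HasDerivWithinAt (fun s => u x s) _ (Set.Ioo t t') t :=
    (hu.evolution x hx t ht).mono fun s hs =>
      mem_timeInterval_of_le ht' (ht.1.trans hs.1.le) hs.2.le
  have h2 : 0 ≤ u x t * slope (fun y => u y t) x *
      (f (principalCurvatures (fun y => u y t) x) - σ) := by
    have h3 := (hasDerivWithinAt_iff_tendsto_slope' (by simp)).1 h1
    have : (𝓝[Set.Ioo t t'] t).NeBot := by
      rw [nhdsWithin_Ioo_eq_nhdsGT hlt]; infer_instance
    refine ge_of_tendsto h3 ?_
    filter_upwards [self_mem_nhdsWithin] with s hs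
    rw [slope_def_field]
    refine div_nonneg (sub_nonneg.2 ?_) (sub_nonneg.2 hs.1.le)
    have := hu.mono_time hf hΩ hbdd hu₀ hσ h0 ht.1 (sub_nonneg.2 hs.1.le)
      (by rw [add_sub_cancel]; exact mem_timeInterval_of_le ht' (ht.1.trans hs.1.le) hs.2.le)
      (subset_closure hx)
    rwa [add_sub_cancel] at this
  have h4 := nonneg_of_mul_nonneg_right h2
    (mul_pos (hu.pos x (subset_closure hx) t ht) (slope_pos _ _))
  linarith

/-- The decaying barrier `η e^{-Kt} (r² - |x - x₀|²)²`. -/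
def decayBarrier (η K : ℝ) (x₀ : EuclideanSpace ℝ (Fin n)) (r : ℝ)
    (q : EuclideanSpace ℝ (Fin n) × ℝ) : ℝ :=
  η * Real.exp (-K * q.2) * (ballBarrier x₀ r q * ballBarrier x₀ r q)

section Barrier

variable {η K r : ℝ} {x₀ y : EuclideanSpace ℝ (Fin n)}

theorem contDiff_decayBarrier : ContDiff ℝ ∞ (decayBarrier η K x₀ r) :=
  (contDiff_const.mul (contDiff_const.mul contDiff_snd).exp).mul
    (contDiff_ballBarrier.mul contDiff_ballBarrier)

theorem smoothNear_decayBarrier : SmoothNear (decayBarrier η K x₀ r) p :=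
  Filter.Eventually.of_forall fun _ => contDiff_decayBarrier.contDiffAt

theorem smoothNear_decay :
    SmoothNear (fun q : EuclideanSpace ℝ (Fin n) × ℝ => η * Real.exp (-K * q.2)) p :=
  Filter.Eventually.of_forall fun _ =>
    (contDiff_const.mul (contDiff_const.mul contDiff_snd).exp).contDiffAt

theorem dirDeriv_decay (a : EuclideanSpace ℝ (Fin n) × ℝ) :
    dirDeriv a (fun q : EuclideanSpace ℝ (Fin n) × ℝ => η * Real.exp (-K * q.2)) p =
      -K * a.2 * (η * Real.exp (-K * p.2)) := by
  have h1 : HasFDerivAt (fun q : EuclideanSpace ℝ (Fin n) × ℝ => η * Real.exp (-K * q.2)) _ p :=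
    ((hasFDerivAt_snd.const_mul (-K)).exp).const_mul η
  rw [dirDeriv, h1.fderiv]
  simp
  ring

theorem dirDeriv_decayBarrier (a : EuclideanSpace ℝ (Fin n) × ℝ) :
    dirDeriv a (decayBarrier η K x₀ r) p = -K * a.2 * decayBarrier η K x₀ r p +
      η * Real.exp (-K * p.2) * (2 * ballBarrier x₀ r p * dirDeriv a (ballBarrier x₀ r) p) := by
  have h1 : DifferentiableAt ℝ (ballBarrier x₀ r) p := smoothNear_ballBarrier.differentiableAt
  change dirDeriv a (fun q => η * Real.exp (-K * q.2) * (ballBarrier x₀ r q * ballBarrier x₀ r q)) p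
    = _
  rw [dirDeriv_mul smoothNear_decay.differentiableAt (h1.fun_mul h1), dirDeriv_mul h1 h1,
    dirDeriv_decay, decayBarrier]
  ring

theorem dirDeriv_space_decayBarrier :
    dirDeriv (y, 0) (decayBarrier η K x₀ r) p =
      -(4 * (η * Real.exp (-K * p.2)) * ballBarrier x₀ r p * inner ℝ (p.1 - x₀) y) := by
  rw [dirDeriv_decayBarrier, dirDeriv_ballBarrier]
  ring

theorem dirDeriv_dirDeriv_space_decayBarrier :
    dirDeriv (y, 0) (dirDeriv (y, 0) (decayBarrier η K x₀ r)) p =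
      η * Real.exp (-K * p.2) *
        (8 * inner ℝ (p.1 - x₀) y ^ 2 - 4 * ballBarrier x₀ r p * ‖y‖ ^ 2) := by
  have h0 : dirDeriv (y, 0) (decayBarrier η K x₀ r) = fun q => η * Real.exp (-K * q.2) *
      ((2 * ballBarrier x₀ r q) * dirDeriv (y, 0) (ballBarrier x₀ r) q) := funext fun q => by
    rw [dirDeriv_decayBarrier]; ring
  have h1 : SmoothNear (ballBarrier x₀ r) p := smoothNear_ballBarrier
  have h2 : SmoothNear (fun q => 2 * ballBarrier x₀ r q) p := (SmoothNear.const 2).mul h1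
  have h3 := h1.dirDeriv (y, 0)
  rw [h0, dirDeriv_mul smoothNear_decay.differentiableAt (h2.mul h3).differentiableAt,
    dirDeriv_decay, dirDeriv_mul h2.differentiableAt h3.differentiableAt,
    dirDeriv_mul (differentiableAt_const _) h1.differentiableAt, dirDeriv_const,
    dirDeriv_dirDeriv_ballBarrier, dirDeriv_ballBarrier]
  ring

end Barrier

/-- Fixes the decay rate: `K` makes the discriminant of this quadratic in `ρ` negative, so the term
`K ρ²` from the decay of the barrier covers the region near the centre, where `R - ρ` is small. -/
theorem quadratic_pos {a C R ρ K : ℝ} (ha : 0 < a) (hC : 0 ≤ C) (hR : 0 < R) (hρ : 0 < ρ)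
    (hK : K = (a + C) ^ 2 / (2 * a * R)) : 0 < a * (R - ρ) - C * ρ + K * ρ ^ 2 := by
  have h1 : 4 * a * R * (a * (R - ρ) - C * ρ + K * ρ ^ 2) =
      (2 * a * R - (a + C) * ρ) ^ 2 + (a + C) ^ 2 * ρ ^ 2 := by
    rw [hK]; field_simp; ring
  have h2 : 0 < (2 * a * R - (a + C) * ρ) ^ 2 + (a + C) ^ 2 * ρ ^ 2 := by positivity
  rw [← h1] at h2
  exact pos_of_mul_pos_right h2 (by positivity)

/-- The velocity cannot touch the decaying barrier from above. -/
theorem IsSolution.velocity_not_contact (hf : IsCurvatureFunction f)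
    (hu : IsSolution f σ ε T Ω u₀ u) (hΩ : IsOpen Ω) (hσ : 0 < σ)
    (hge : ∀ x ∈ Ω, ∀ t ∈ timeInterval T, σ ≤ f (principalCurvatures (fun y => u y t) x))
    {x₀ : EuclideanSpace ℝ (Fin n)} {r M η s c C K : ℝ} (hr : 0 < r)
    (hball : Metric.closedBall x₀ r ⊆ Ω) (hη : 0 < η) (hs : 0 < s) (hM1 : 1 ≤ M) (hc0 : 0 < c)
    (hell : ∀ l ∈ posCone n, (∀ i, l i ≤ 1 + M ^ 2) → σ ≤ f l →
      (∀ i, c ≤ fderiv ℝ f l (Pi.single i 1)) ∧ ∑ i, fderiv ℝ f l (Pi.single i 1) ≤ C)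
    (hK : K = (8 * c / M ^ 4 + velocityConst σ M r C) ^ 2 / (2 * (8 * c / M ^ 4) * r ^ 2))
    {x : EuclideanSpace ℝ (Fin n)}
    (hx : x ∈ Metric.closedBall x₀ r) {t : ℝ} (ht : t ∈ timeInterval T) (ht0 : 0 < t)
    (hM : u x t ≤ M) (hM' : (u x t)⁻¹ ≤ M) (hw : stSlope u (x, t) ≤ M)
    (h2 : ∀ y : EuclideanSpace ℝ (Fin n), ‖y‖ ≤ 1 →
      |dirDeriv (y, 0) (dirDeriv (y, 0) (Function.uncurry u)) (x, t)| ≤ M)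
    (hzero : velocity u (x, t) - decayBarrier η K x₀ r (x, t) + s = 0)
    (hnonneg : ∀ y ∈ Metric.closedBall x₀ r, 0 ≤
      velocity u (y, t) - decayBarrier η K x₀ r (y, t) + s)
    (htime : dirDeriv (0, 1) (velocity u) (x, t) -
      dirDeriv (0, 1) (decayBarrier η K x₀ r) (x, t) ≤ 0) : False := by
  have hxΩ := hball hx
  have hsm := hu.smoothNear hΩ hxΩ ht ht0
  have hpos := hu.eventually_pos hΩ hxΩ ht ht0
  have hV := smoothNear_velocity hsm
  have hv : 0 ≤ dirDeriv (0, 1) (Function.uncurry u) (x, t) := by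
    rw [hu.dirDeriv_time hΩ hxΩ ht ht0]
    exact mul_nonneg (mul_pos (hu.pos x (subset_closure hxΩ) t ht) (slope_pos _ _)).le
      (sub_nonneg.2 (hge x hxΩ t ht))
  have hV0 : 0 ≤ velocity u (x, t) := mul_nonneg hpos.self_of_nhds.le hv
  set Q := η * Real.exp (-K * t) with hQ
  have hQ0 : 0 < Q := by positivity
  set ρ := ballBarrier x₀ r (x, t) with hρdef
  have hbar : decayBarrier η K x₀ r (x, t) = Q * ρ ^ 2 := by
    rw [decayBarrier, ← hρdef, sq]
  have hdr : ‖x - x₀‖ ≤ r := mem_closedBall_iff_norm.1 hx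
  have hρd : ρ = r ^ 2 - ‖x - x₀‖ ^ 2 := rfl
  have hρ0 : 0 ≤ ρ := by
    rw [hρd, sub_nonneg]; gcongr
  -- On the sphere the barrier vanishes, and `u u_t ≥ 0` together with `s > 0` excludes a contact;
  -- this is where `f(κ) ≥ σ` is essential.
  have hρpos : 0 < ρ := by
    rcases hρ0.eq_or_lt with h | h
    · rw [hbar, ← h] at hzero
      norm_num at hzero
      linarith
    · exact h
  have hd : ‖x - x₀‖ < r := lt_of_pow_lt_pow_left₀ 2 hr.le (by linarith)
  have hκ := hge x hxΩ t ht
  obtain ⟨e, l, φ, F⟩ := hu.exists_principalFrame hf hΩ hxΩ ht ht0 (hσ.trans_le hκ)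
  have hfl : σ ≤ f l := by
    rw [← F.value, hu.speed_eq hΩ hxΩ ht ht0]
    exact hκ.trans (le_mul_of_one_le_left (hσ.le.trans hκ) one_le_stSlope)
  obtain ⟨hc, hC⟩ := hell l F.mem (F.curvature_le hsm hpos.self_of_nhds hM h2) hfl
  simp only [← F.partial_eq] at hc hC
  have hC0 : 0 ≤ C := by linarith [F.one_le_sum_partial hf]
  have hmin : IsLocalMin (fun y => velocity u (y, t) - decayBarrier η K x₀ r (y, t)) x := by
    filter_upwards [Metric.isOpen_ball.mem_nhds (mem_ball_iff_norm.2 hd)] with y hy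
    have := hnonneg y (Metric.ball_subset_closedBall hy)
    linarith
  have hslice := slice_min (hV.sub smoothNear_decayBarrier) hmin
  have e1 : ∀ q, SmoothNear (velocity u) q → ∀ y : EuclideanSpace ℝ (Fin n),
      dirDeriv (y, 0) (fun q => velocity u q - decayBarrier η K x₀ r q) q =
      dirDeriv (y, 0) (velocity u) q - dirDeriv (y, 0) (decayBarrier η K x₀ r) q := fun q hq y =>
    dirDeriv_sub hq.differentiableAt smoothNear_decayBarrier.differentiableAt
  have hmain := F.velocity_time_ge hf hsm hpos hσ (r := r) (Q := Q) (ρ := ρ) (c := c) (C := C)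
    (d := x - x₀) hM hM' hw h2 hc hc0 hC hv hr.le hQ0.le hρd hρ0 ?_ (fun y => ?_) (fun y => ?_)
  · rw [dirDeriv_decayBarrier, dirDeriv_ballBarrier, inner_zero_right, hbar] at htime
    have hq := quadratic_pos (a := 8 * c / M ^ 4) (C := velocityConst σ M r C) (R := r ^ 2)
      (by positivity) (by rw [velocityConst]; positivity) (by positivity) hρpos hK
    have := mul_pos hQ0 hq
    dsimp only at htime
    linarith
  · linarith
  · have h3 := (hslice y).1
    rw [e1 _ hV, dirDeriv_space_decayBarrier, sub_eq_zero] at h3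
    exact h3
  · have h3 := (hslice y).2
    have h4 : SmoothNear (decayBarrier η K x₀ r) (x, t) := smoothNear_decayBarrier
    rw [dirDeriv_congr (hV.eventually.mono fun q hq => e1 q hq y),
      dirDeriv_sub (hV.dirDeriv _).differentiableAt (h4.dirDeriv _).differentiableAt,
      dirDeriv_dirDeriv_space_decayBarrier] at h3
    exact sub_nonneg.1 h3

theorem IsSolution.velocity_eq (hu : IsSolution f σ ε T Ω u₀ u) (hΩ : IsOpen Ω)
    {x : EuclideanSpace ℝ (Fin n)} (hx : x ∈ Ω) {t : ℝ} (ht : t ∈ timeInterval T)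
    (ht0 : 0 < t) : velocity u (x, t) = u x t ^ 2 * stSlope u (x, t) *
      (f (principalCurvatures (fun y => u y t) x) - σ) := by
  rw [velocity, hu.dirDeriv_time hΩ hx ht ht0, Function.uncurry_apply_pair, stSlope]
  ring

/-- A quantitative strong maximum principle: `u u_t` has the sign of `f(κ) - σ`, is bounded below on
a small ball at time `0`, and stays above a decaying barrier that is positive at the centre. -/
theorem IsSolution.lt_curvature (hf : IsCurvatureFunction f) (hu : IsSolution f σ ε T Ω u₀ u)
    (hΩ : IsOpen Ω) (hσ : 0 < σ)
    (hge : ∀ x ∈ Ω, ∀ t ∈ timeInterval T, σ ≤ f (principalCurvatures (fun y => u y t) x))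
    (h0 : ∀ x ∈ Ω, σ < f (principalCurvatures (fun y => u y 0) x))
    {τ : ℝ} (hτ : τ ∈ timeInterval T) {x₀ : EuclideanSpace ℝ (Fin n)} (hx₀ : x₀ ∈ Ω) :
    σ < f (principalCurvatures (fun y => u y τ) x₀) := by
  obtain ⟨r, hr, hball⟩ := Metric.nhds_basis_closedBall.mem_iff.1 (hΩ.mem_nhds hx₀)
  have hK : IsCompact (Metric.closedBall x₀ r) := isCompact_closedBall x₀ r
  obtain ⟨M, hM1, hM⟩ := hu.exists_derivative_bounds hΩ hK hball hτ
  obtain ⟨c, hc0, C, hell⟩ := hf.exists_partial_bounds hσ (1 + M ^ 2)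
  set K := (8 * c / M ^ 4 + velocityConst σ M r C) ^ 2 / (2 * (8 * c / M ^ 4) * r ^ 2) with hKdef
  have hz : (0 : ℝ) ∈ timeInterval T := mem_timeInterval_of_le hτ le_rfl hτ.1
  have hcV : ContinuousOn (fun p : EuclideanSpace ℝ (Fin n) × ℝ => u p.1 p.2 ^ 2 * stSlope u p *
      (f (principalCurvatures (fun y => u y p.2) p.1) - σ)) (Ω ×ˢ timeInterval T) :=
    (((hu.contDiffOn_interior hΩ).continuousOn.pow 2).mul (hu.continuousOn_stSlope hΩ)).mul
      ((hu.continuousOn_curvature hΩ).sub continuousOn_const)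
  have hc0' : ContinuousOn (fun x => u x 0 ^ 2 * stSlope u (x, 0) *
      (f (principalCurvatures (fun y => u y 0) x) - σ)) (Metric.closedBall x₀ r) :=
    hcV.comp (continuous_id.prodMk continuous_const).continuousOn fun x hx => ⟨hball hx, hz⟩
  obtain ⟨x₁, hx₁, hmin⟩ := hK.exists_isMinOn ⟨x₀, Metric.mem_closedBall_self hr.le⟩ hc0'
  set b := u x₁ 0 ^ 2 * stSlope u (x₁, 0) *
    (f (principalCurvatures (fun y => u y 0) x₁) - σ) with hb
  have hb0 : 0 < b := mul_pos (mul_pos (pow_pos (hu.pos x₁ (subset_closure (hball hx₁)) 0 hz) 2)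
    stSlope_pos) (sub_pos.2 (h0 x₁ (hball hx₁)))
  -- The barrier is at most `η r ^ 4 = b` at time `0`, hence below the initial velocity on the ball.
  set η := b / r ^ 4 with hηdef
  have hη : 0 < η := by positivity
  have key : ∀ s > 0, 0 < u x₀ τ ^ 2 * stSlope u (x₀, τ) *
      (f (principalCurvatures (fun y => u y τ) x₀) - σ) -
      decayBarrier η K x₀ r (x₀, τ) + s := by
    intro s hs
    refine pos_of_no_contact (h := fun x t => u x t ^ 2 * stSlope u (x, t) *
      (f (principalCurvatures (fun y => u y t) x) - σ) - decayBarrier η K x₀ r (x, t) + s)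
      hK (τ := τ) ?_ (fun x hx => ?_) (fun x hx t ht hzero hnn hbef => ?_) x₀
      (Metric.mem_closedBall_self hr.le) τ ⟨hτ.1, le_rfl⟩
    · have h1 := hcV.mono (Set.prod_mono hball (Icc_subset_timeInterval hτ))
      exact (h1.sub contDiff_decayBarrier.continuous.continuousOn).add continuousOn_const
    · have h1 : b ≤ _ := hmin hx
      have h2 : decayBarrier η K x₀ r (x, 0) ≤ b := by
        have hd : ‖x - x₀‖ ^ 2 ≤ r ^ 2 := by
          have := mem_closedBall_iff_norm.1 hx
          gcongr
        have h3 : ballBarrier x₀ r (x, 0) ≤ r ^ 2 := by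
          rw [ballBarrier]; linarith [sq_nonneg ‖x - x₀‖]
        have h4 : 0 ≤ ballBarrier x₀ r (x, 0) := by
          rw [ballBarrier]; exact sub_nonneg.2 hd
        have h5 := mul_le_mul_of_nonneg_left (mul_le_mul h3 h3 h4 (sq_nonneg r)) hη.le
        rw [decayBarrier, mul_zero, Real.exp_zero, mul_one]
        refine h5.trans (le_of_eq ?_)
        rw [hηdef]
        field_simp
      dsimp only at h1 ⊢
      linarith
    · have ht' : t ∈ timeInterval T := mem_timeInterval_of_le hτ ht.1.le ht.2
      obtain ⟨m1, m2, m3, -, m5⟩ := hM x hx t ht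
      have hsm := hu.smoothNear hΩ (hball hx) ht' ht.1
      have hd : HasDerivAt (fun t' => velocity u (x, t') - decayBarrier η K x₀ r (x, t') + s)
          (dirDeriv (0, 1) (velocity u) (x, t) -
            dirDeriv (0, 1) (decayBarrier η K x₀ r) (x, t)) t :=
        ((deriv_time (u := fun y t' => velocity u (y, t'))
          (smoothNear_velocity hsm).differentiableAt).sub
          (deriv_time (u := fun y t' => decayBarrier η K x₀ r (y, t'))
            smoothNear_decayBarrier.differentiableAt)).add_const s
      have hd' := hd.congr_of_eventuallyEq (f₁ := fun t' => u x t' ^ 2 * stSlope u (x, t') *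
        (f (principalCurvatures (fun y => u y t') x) - σ) - decayBarrier η K x₀ r (x, t') + s) (by
          filter_upwards [eventually_timeInterval ht' ht.1] with t' h
          rw [hu.velocity_eq hΩ (hball hx) h.1 h.2])
      have htime := deriv_nonpos_of_pos_before ht.1 hd'.hasDerivWithinAt hzero hbef
      refine hu.velocity_not_contact hf hΩ hσ hge hr hball hη hs hM1 hc0 hell hKdef hx ht' ht.1
        m1 m2 m3 m5 ?_ (fun y hy => ?_) htime
      · rw [hu.velocity_eq hΩ (hball hx) ht' ht.1]; exact hzero
      · rw [hu.velocity_eq hΩ (hball hy) ht' ht.1]; exact hnn y hy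
  have hlim : decayBarrier η K x₀ r (x₀, τ) ≤ u x₀ τ ^ 2 * stSlope u (x₀, τ) *
      (f (principalCurvatures (fun y => u y τ) x₀) - σ) :=
    le_of_forall_pos_le_add fun s hs => by linarith [key s hs]
  have hbar : 0 < decayBarrier η K x₀ r (x₀, τ) := by
    simp only [decayBarrier, ballBarrier, sub_self, norm_zero]
    have : (0 : ℝ) < r ^ 2 - 0 ^ 2 := by rw [zero_pow two_ne_zero, sub_zero]; positivity
    positivity
  exact sub_pos.1 (pos_of_mul_pos_right (hbar.trans_le hlim)
    (mul_nonneg (sq_nonneg _) stSlope_pos.le))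

end VelocityPositive

end HypFlow

end

theorem theorem1p5 {n : ℕ} (Ω : Set (EuclideanSpace ℝ (Fin n)))
    (hΩ : HypFlow.IsBoundedSmoothDomain Ω)
    (f : (Fin n → ℝ) → ℝ) (hf : HypFlow.IsCurvatureFunction f)
    (σ ε : ℝ) (hσ : 0 < σ ∧ σ < 1) (hε : 0 < ε) (T : EReal) (hT : 0 < T)
    (u₀ : EuclideanSpace ℝ (Fin n) → ℝ) (hu₀ : HypFlow.IsInitialHeight Ω u₀)
    (u : EuclideanSpace ℝ (Fin n) → ℝ → ℝ) :
    (HypFlow.IsAdmissibleSolution f σ ε T Ω u₀ u →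
      (∀ x ∈ Ω, σ < f (HypFlow.principalCurvatures (fun y => u y 0) x)) →
      ∀ t ∈ HypFlow.timeInterval T, ∀ x ∈ Ω,
        σ < f (HypFlow.principalCurvatures (fun y => u y t) x)) ∧
    (HypFlow.IsSolution f σ ε T Ω u₀ u →
      (∀ x ∈ Ω, HypFlow.StrictlyConvexAt (fun y => u y 0) x) →
      ∀ t ∈ HypFlow.timeInterval T, ∀ x ∈ Ω,
        HypFlow.StrictlyConvexAt (fun y => u y t) x) := by
  refine ⟨fun hu h0 t ht x hx => ?_, fun hu h0 t ht x hx => ?_⟩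
  · exact hu.toIsSolution.lt_curvature hf hΩ.isOpen hσ.1
      (fun y hy s hs => hu.le_curvature hf hΩ.isOpen hΩ.isBounded hu₀ hσ.1 h0 hy hs) h0 ht hx
  · exact hu.strictlyConvexAt hf hΩ.isOpen hσ.1 h0 ht hx
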